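/- A super Lie group is a pair $(G_0,\mathfrak g)$, where $\mathfrak g=\mathfrak g_0\oplus\mathfrak g_1$ is a finite-dimensional real Lie superalgebra and $G_0$ is a connected Lie group with Lie algebra $\mathfrak g_0$ that acts smoothly on $\mathfrak g$ by automorphisms, the action on $\mathfrak g_0$ being the adjoint action and the differential of the action on $\mathfrak g$ being the adjoint action of $\mathfrak g_0$. A sub super Lie group $(H_0,\mathfrak h)$ of $(G_0,\mathfrak g)$ consists of a closed (connected) Lie subgroup $H_0\subseteq G_0$ and a graded subalgebra $\mathfrak h\subseteq\mathfrak g$ such that $\mathfrak h_0$ is the Lie algebra of $H_0$ and the action of $H_0$ on $\mathfrak h$ is the restriction of that of $G_0$ on $\mathfrak g$; it is special if $\mathfrak h_1=\mathfrak g_1$. A unitary representation $(\pi,\rho^\pi,\mathcal H)$ of $(G_0,\mathfrak g)$ is a $\mathbb Z_2$-graded Hilbert space $\mathcal H$ with a (strongly continuous) unitary representation $\pi$ of $G_0$ by even operators and an $\mathbb R$-linear map $\rho^\pi:\mathfrak g_1\to\mathrm{End}_{\mathbb C}(\mathcal H^\infty)$, where $\mathcal H^\infty$ is the space of smooth vectors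 of $\pi$, such that every $\rho^\pi(X)$ is odd and symmetric, $\rho^\pi(X)\rho^\pi(Y)+\rho^\pi(Y)\rho^\pi(X)=-\sqrt{-1}\,\pi^\infty([X,Y])$ on $\mathcal H^\infty$, and $\rho^\pi(g\cdot X)=\pi(g)\rho^\pi(X)\pi(g^{-1})$. Two unitary representations are unitarily equivalent ($\simeq$) if there is an even isometry of one Hilbert space onto the other that intertwines the actions of $G_0$ and $\mathfrak g_1$. Let $(H_0,\mathfrak h)$ be a special sub super Lie group of $(G_0,\mathfrak g)$, with $G_0$ and $H_0$ unimodular, and fix a nonzero $G_0$-invariant measure $\mu$ on $H_0\backslash G_0$ that is finite on compact sets. For a unitary representation $(\sigma,\rho^\sigma,\mathcal K)$ of $(H_0,\mathfrak h)$, the induced representation $\mathrm{Ind}_{(H_0,\mathfrak h)}^{(G_0,\mathfrak g)}(\sigma,\rho^\sigma,\mathcal K)=(\pi,\rho^\pi,\mathcal H)$ is defined as follows: $\mathcal H$ is the space of measurable $f:G_0\to\mathcal K$ (modulo equality almost everywhere) with $f(hg)=\sigma(h)f(g)$ for $h\in H_0$, $g\in G_0$ and $\int_{H_0\backslash G_0}\|f(g)\|^2\,d\mu<\infty$,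 graded by the grading of $\mathcal K$; $(\pi(g)f)(g')=f(g'g)$; and, for $X\in\mathfrak g_1$, $\rho^\pi(X)$ is the restriction to $\mathcal H^\infty$ of the closure of the operator $(\rho^\pi(X)f)(g)=\rho^\sigma(g\cdot X)(f(g))$ defined on the smooth functions $f\in\mathcal H$ whose support is compact modulo $H_0$. **Proposition.** Let $(G_0,\mathfrak g)$ be a super Lie group, $(K_0,\mathfrak k)$ a special sub super Lie group of $(G_0,\mathfrak g)$, and $(H_0,\mathfrak h)$ a special sub super Lie group of $(K_0,\mathfrak k)$. Assume that $G_0$, $K_0$ and $H_0$ are unimodular, and let $(\sigma,\rho^\sigma,\mathcal K)$ be a unitary representation of $(H_0,\mathfrak h)$. Then, for any choice of the invariant measures, the three induced representations below are unitary representations, and $$\mathrm{Ind}_{(H_0,\mathfrak h)}^{(G_0,\mathfrak g)}(\sigma,\rho^\sigma,\mathcal K)\simeq\mathrm{Ind}_{(K_0,\mathfrak k)}^{(G_0,\mathfrak g)}\mathrm{Ind}_{(H_0,\mathfrak h)}^{(K_0,\mathfrak k)}(\sigma,\rho^\sigma,\mathcal K).$$ -/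

import Mathlib

open scoped Manifold ContDiff
open MeasureTheory

universe u w w'

noncomputable section

namespace SuperLie

/-! ### Super Lie groups (Harish-Chandra pairs) -/

/-- The adjoint action of a Lie group on its Lie algebra (the tangent space at `1`):
the differential at `1` of conjugation by `g`. -/
def adjointAction {E : Type*} [NormedAddCommGroup E] [NormedSpace ℝ E]
    {G : Type*} [TopologicalSpace G] [ChartedSpace E G] [Group G] (g : G) :
    GroupLieAlgebra 𝓘(ℝ, E) G → GroupLieAlgebra 𝓘(ℝ, E) G :=
  fun X => (mfderiv 𝓘(ℝ, E) 𝓘(ℝ, E) (fun x : G => g * x * g⁻¹) 1 X : E)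

/-- A super Lie group `(G₀, 𝔤)`, `𝔤 = 𝔤₀ ⊕ 𝔤₁`.  The even part `𝔤₀` of the Lie superalgebra is the
Lie algebra `GroupLieAlgebra 𝓘(ℝ, E) G₀` of the connected Lie group `G₀`, with its bracket.  The
remaining components of the superbracket are `ad : 𝔤₀ × 𝔤₁ → 𝔤₁` and the symmetric
`br : 𝔤₁ × 𝔤₁ → 𝔤₀`; the components of the super Jacobi identity that involve odd elements are
`ad_lie`, `lie_br` and `ad_br`. -/
structure SuperLieGroup where
  /-- the model vector space of the manifold `G₀` -/
  E : Type u
  [instNormE : NormedAddCommGroup E]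
  [instSpaceE : NormedSpace ℝ E]
  [instFinE : FiniteDimensional ℝ E]
  /-- the underlying connected Lie group -/
  G₀ : Type u
  [instGroup : Group G₀]
  [instTop : TopologicalSpace G₀]
  [instCharted : ChartedSpace E G₀]
  [instLie : LieGroup 𝓘(ℝ, E) ∞ G₀]
  [instT2 : T2Space G₀]
  [instSecond : SecondCountableTopology G₀]
  [instConn : ConnectedSpace G₀]
  /-- the odd part; its norm serves only to speak of smooth maps, all norms being equivalent -/
  𝔤₁ : Type u
  [instNorm₁ : NormedAddCommGroup 𝔤₁]
  [instSpace₁ : NormedSpace ℝ 𝔤₁]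
  [instFin₁ : FiniteDimensional ℝ 𝔤₁]
  /-- the bracket of an even and an odd element -/
  ad : GroupLieAlgebra 𝓘(ℝ, E) G₀ →ₗ[ℝ] 𝔤₁ →ₗ[ℝ] 𝔤₁
  /-- the bracket of two odd elements -/
  br : 𝔤₁ →ₗ[ℝ] 𝔤₁ →ₗ[ℝ] GroupLieAlgebra 𝓘(ℝ, E) G₀
  br_symm : ∀ X Y, br X Y = br Y X
  ad_lie : ∀ X Y Z, ad ⁅X, Y⁆ Z = ad X (ad Y Z) - ad Y (ad X Z)
  lie_br : ∀ X Y Z, ⁅X, br Y Z⁆ = br (ad X Y) Z + br Y (ad X Z)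
  ad_br : ∀ X Y Z, ad (br X Y) Z + ad (br Y Z) X + ad (br Z X) Y = 0
  /-- the action of `G₀` on the odd part (its action on `𝔤₀` is the adjoint action) -/
  act : G₀ →* (𝔤₁ →ₗ[ℝ] 𝔤₁)
  contMDiff_act : ContMDiff (𝓘(ℝ, E).prod 𝓘(ℝ, 𝔤₁)) 𝓘(ℝ, 𝔤₁) ∞
    (fun p : G₀ × 𝔤₁ => act p.1 p.2)
  act_ad : ∀ g X Y, act g (ad X Y) = ad (adjointAction g X) (act g Y)
  adjointAction_br : ∀ g X Y, adjointAction g (br X Y) = br (act g X) (act g Y)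
  /-- the differential of the action of `G₀` is the adjoint action of `𝔤₀` -/
  mfderiv_act : ∀ X Y, (mfderiv 𝓘(ℝ, E) 𝓘(ℝ, 𝔤₁) (fun g : G₀ => act g Y) 1 X : 𝔤₁) = ad X Y

attribute [instance] SuperLieGroup.instNormE SuperLieGroup.instSpaceE SuperLieGroup.instFinE
  SuperLieGroup.instGroup SuperLieGroup.instTop SuperLieGroup.instCharted SuperLieGroup.instLie
  SuperLieGroup.instT2 SuperLieGroup.instSecond SuperLieGroup.instConn SuperLieGroup.instNorm₁
  SuperLieGroup.instSpace₁ SuperLieGroup.instFin₁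

namespace SuperLieGroup

/-- `G₀` carries its Borel σ-algebra. -/
instance (G : SuperLieGroup.{u}) : MeasurableSpace G.G₀ := borel G.G₀

instance (G : SuperLieGroup.{u}) : BorelSpace G.G₀ := ⟨rfl⟩

instance (G : SuperLieGroup.{u}) : IsTopologicalGroup G.G₀ :=
  topologicalGroup_of_lieGroup 𝓘(ℝ, G.E) ∞

/-- The even part `𝔤₀` of the Lie superalgebra. -/
abbrev 𝔤₀ (G : SuperLieGroup.{u}) : Type u := GroupLieAlgebra 𝓘(ℝ, G.E) G.G₀

/-- `G₀` is unimodular: its (left) Haar measures are right invariant. -/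
def IsUnimodular (G : SuperLieGroup.{u}) : Prop :=
  ∀ m : Measure G.G₀, m.IsHaarMeasure → m.IsMulRightInvariant

/-- The homomorphism of Lie algebras given by the differential at `1` of a homomorphism of Lie
groups. -/
def lieMap {H G : SuperLieGroup.{u}} (φ : H.G₀ →* G.G₀) : H.𝔤₀ → G.𝔤₀ :=
  fun X => (mfderiv 𝓘(ℝ, H.E) 𝓘(ℝ, G.E) φ 1 X : G.E)

end SuperLieGroup

/-- A sub super Lie group `(H₀, 𝔥)` of `(G₀, 𝔤)`, given by its inclusion: `H₀` is a closed Lie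
subgroup of `G₀`, and `𝔥` is a graded subalgebra whose even part is the Lie algebra of `H₀`
(included in `𝔤₀` by the differential of `H₀ → G₀`), the action of `H₀` being the restricted one. -/
structure SubSuperLieGroup (H G : SuperLieGroup.{u}) where
  even : H.G₀ →* G.G₀
  contMDiff_even : ContMDiff 𝓘(ℝ, H.E) 𝓘(ℝ, G.E) ∞ even
  isClosedEmbedding_even : Topology.IsClosedEmbedding even
  lieMap_injective : Function.Injective (SuperLieGroup.lieMap even)
  odd : H.𝔤₁ →ₗ[ℝ] G.𝔤₁
  odd_injective : Function.Injective odd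
  odd_act : ∀ h X, odd (H.act h X) = G.act (even h) (odd X)
  odd_ad : ∀ X Y, odd (H.ad X Y) = G.ad (SuperLieGroup.lieMap even X) (odd Y)
  lieMap_br : ∀ X Y, SuperLieGroup.lieMap even (H.br X Y) = G.br (odd X) (odd Y)

/-- A sub super Lie group is special if `𝔥₁ = 𝔤₁`. -/
structure SpecialSub (H G : SuperLieGroup.{u}) extends SubSuperLieGroup H G where
  odd_surjective : Function.Surjective odd

namespace SpecialSub

variable {G K H : SuperLieGroup.{u}}

/-- The identification `𝔥₁ = 𝔤₁`. -/
def oddEquiv (i : SpecialSub H G) : H.𝔤₁ ≃ₗ[ℝ] G.𝔤₁ :=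
  LinearEquiv.ofBijective i.odd ⟨i.odd_injective, i.odd_surjective⟩

theorem lieMap_comp (i : SpecialSub K G) (j : SpecialSub H K) (X : H.𝔤₀) :
    SuperLieGroup.lieMap (i.even.comp j.even) X =
      SuperLieGroup.lieMap i.even (SuperLieGroup.lieMap j.even X) := by
  have hi : MDifferentiableAt 𝓘(ℝ, K.E) 𝓘(ℝ, G.E) i.even (j.even 1) :=
    i.contMDiff_even.mdifferentiableAt (by simp)
  have hj : MDifferentiableAt 𝓘(ℝ, H.E) 𝓘(ℝ, K.E) j.even 1 :=
    j.contMDiff_even.mdifferentiableAt (by simp)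
  have h := mfderiv_comp (1 : H.G₀) hi hj
  have h1 : j.even 1 = 1 := map_one _
  unfold SuperLieGroup.lieMap
  rw [MonoidHom.coe_comp, h]
  change (mfderiv 𝓘(ℝ, K.E) 𝓘(ℝ, G.E) i.even (j.even 1) : K.E → G.E) _ = _
  rw [h1]
  rfl

/-- A special sub super Lie group of a special sub super Lie group is a special sub super Lie
group. -/
def comp (i : SpecialSub K G) (j : SpecialSub H K) : SpecialSub H G where
  even := i.even.comp j.even
  contMDiff_even := i.contMDiff_even.comp j.contMDiff_even
  isClosedEmbedding_even := i.isClosedEmbedding_even.comp j.isClosedEmbedding_even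
  lieMap_injective := by
    intro X Y hXY
    rw [lieMap_comp, lieMap_comp] at hXY
    exact j.lieMap_injective (i.lieMap_injective hXY)
  odd := i.odd.comp j.odd
  odd_injective := i.odd_injective.comp j.odd_injective
  odd_act := fun h X => by simp [j.odd_act, i.odd_act]
  odd_ad := fun X Y => by
    rw [lieMap_comp, LinearMap.comp_apply, LinearMap.comp_apply, j.odd_ad, i.odd_ad]
  lieMap_br := fun X Y => by
    rw [lieMap_comp, j.lieMap_br, i.lieMap_br, LinearMap.comp_apply, LinearMap.comp_apply]
  odd_surjective := i.odd_surjective.comp j.odd_surjective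

/-- The space `H₀ \ G₀` of right cosets `H₀ g`, with the quotient topology and the quotient
σ-algebra (which is the Borel σ-algebra of the quotient topology, `G₀` being Polish). -/
abbrev Cosets (i : SpecialSub H G) : Type u := Quotient (QuotientGroup.rightRel i.even.range)

theorem rightRel_iff (i : SpecialSub H G) {x y : G.G₀} :
    QuotientGroup.rightRel i.even.range x y ↔ ∃ h, i.even h * x = y := by
  rw [QuotientGroup.rightRel_apply]
  constructor
  · rintro ⟨h, hh⟩
    exact ⟨h, by rw [hh]; group⟩
  · rintro ⟨h, rfl⟩
    exact ⟨h, by group⟩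

/-- The action of `g` on `H₀ \ G₀` by right multiplication, `H₀ x ↦ H₀ x g`. -/
def translate (i : SpecialSub H G) (g : G.G₀) : i.Cosets → i.Cosets :=
  Quotient.map (· * g) (by
    intro x y hxy
    obtain ⟨h, rfl⟩ := i.rightRel_iff.1 hxy
    exact i.rightRel_iff.2 ⟨h, by group⟩)

theorem measurable_translate (i : SpecialSub H G) (g : G.G₀) : Measurable (i.translate g) := by
  rw [measurable_from_quotient]
  change Measurable fun x : G.G₀ => (Quotient.mk'' (x * g) : i.Cosets)
  exact measurable_quotient_mk''.comp (measurable_mul_const g)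

/-- A nonzero `G₀`-invariant measure on `H₀ \ G₀`, finite on compact sets. -/
structure InvariantMeasure (i : SpecialSub H G) where
  measure : Measure i.Cosets
  ne_zero : measure ≠ 0
  lt_top_of_isCompact : ∀ C : Set i.Cosets, IsCompact C → measure C < ⊤
  map_translate : ∀ g, measure.map (i.translate g) = measure

end SpecialSub

/-! ### Unitary representations -/

/-- The data of a representation of a super Lie group: a graded inner product space `V`, an action
`π` of `G₀` by linear isometries, and operators `ρ X` for odd `X`, each with its own domain.
The conditions under which it is a unitary representation are in `PreRep.IsUnitary`. -/
structure PreRep (G : SuperLieGroup.{u}) where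
  V : Type w
  [instNorm : NormedAddCommGroup V]
  [instInner : InnerProductSpace ℂ V]
  gr : ZMod 2 → Submodule ℂ V
  π : G.G₀ →* (V ≃ₗᵢ[ℂ] V)
  ρ : G.𝔤₁ → (V →ₗ.[ℂ] V)

attribute [instance] PreRep.instNorm PreRep.instInner

namespace PreRep

variable {G : SuperLieGroup.{u}}

/-- The space `V^∞` of smooth vectors of the representation `π` of `G₀`. -/
def smoothVectors (σ : PreRep.{u, w} G) : Submodule ℂ σ.V where
  carrier := {v | ContMDiff 𝓘(ℝ, G.E) 𝓘(ℝ, σ.V) ∞ (fun g : G.G₀ => σ.π g v)}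
  add_mem' := fun {v v'} hv hv' => by
    simp only [Set.mem_ofPred_eq, map_add] at *
    exact hv.add hv'
  zero_mem' := by
    simp only [Set.mem_ofPred_eq, map_zero]
    exact contMDiff_const
  smul_mem' := fun c v hv => by
    simp only [Set.mem_ofPred_eq, map_smul] at *
    have hc : ContDiff ℝ ∞ (fun x : σ.V => c • x) := contDiff_const_smul c
    exact hc.contMDiff.comp hv

/-- The infinitesimal action `π^∞(X) v = d/dt π(exp tX) v` at `t = 0`. -/
def dπ (σ : PreRep.{u, w} G) (X : G.𝔤₀) (v : σ.V) : σ.V :=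
  (mfderiv 𝓘(ℝ, G.E) 𝓘(ℝ, σ.V) (fun g : G.G₀ => σ.π g v) 1 X : σ.V)

/-- The data `(π, ρ, V)` form a unitary representation of `(G₀, 𝔤)`. -/
structure IsUnitary (σ : PreRep.{u, w} G) : Prop where
  /-- `V` is a Hilbert space, the orthogonal direct sum of `V₀` and `V₁` -/
  complete : CompleteSpace σ.V
  gr_orthogonal : ∀ i, (σ.gr i)ᗮ = σ.gr (i + 1)
  /-- `π` is a (strongly continuous) unitary representation by even operators -/
  continuous_π : ∀ v, Continuous fun g => σ.π g v
  π_even : ∀ g i, ∀ v ∈ σ.gr i, σ.π g v ∈ σ.gr i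
  /-- `ρ` is a real linear map from `𝔤₁` to the endomorphisms of `V^∞` -/
  ρ_domain : ∀ X, (σ.ρ X).domain = σ.smoothVectors
  ρ_mem : ∀ X v, σ.ρ X v ∈ σ.smoothVectors
  ρ_add : ∀ X Y, σ.ρ (X + Y) = σ.ρ X + σ.ρ Y
  ρ_smul : ∀ (c : ℝ) X, σ.ρ (c • X) = (c : ℂ) • σ.ρ X
  /-- `ρ X` is odd and symmetric -/
  ρ_odd : ∀ X i, ∀ v : (σ.ρ X).domain, (v : σ.V) ∈ σ.gr i → σ.ρ X v ∈ σ.gr (i + 1)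
  ρ_symm : ∀ X, ∀ v v' : (σ.ρ X).domain, inner ℂ (σ.ρ X v) (v' : σ.V) = inner ℂ (v : σ.V) (σ.ρ X v')
  /-- `ρ(X) ρ(Y) + ρ(Y) ρ(X) = -i π^∞([X, Y])` on `V^∞` -/
  ρ_comm : ∀ X Y, ∀ v ∈ σ.smoothVectors, ∀ a b a' b' : σ.V,
    (v, a) ∈ (σ.ρ Y).graph → (a, a') ∈ (σ.ρ X).graph →
    (v, b) ∈ (σ.ρ X).graph → (b, b') ∈ (σ.ρ Y).graph →
    a' + b' = -Complex.I • σ.dπ (G.br X Y) v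
  /-- `ρ(g · X) = π(g) ρ(X) π(g⁻¹)` -/
  ρ_act : ∀ g X, ∀ v a : σ.V,
    (v, a) ∈ (σ.ρ (G.act g X)).graph ↔ (σ.π g⁻¹ v, σ.π g⁻¹ a) ∈ (σ.ρ X).graph

/-- Unitary equivalence: there is an even isometry of `σ.V` onto `τ.V` that intertwines the
actions of `G₀` and of `𝔤₁`. -/
def UnitarilyEquivalent (σ : PreRep.{u, w} G) (τ : PreRep.{u, w'} G) : Prop :=
  ∃ T : σ.V ≃ₗᵢ[ℂ] τ.V,
    (∀ i, ∀ v ∈ σ.gr i, T v ∈ τ.gr i) ∧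
    (∀ g v, T (σ.π g v) = τ.π g (T v)) ∧
    (∀ X v a, (v, a) ∈ (σ.ρ X).graph ↔ (T v, T a) ∈ (τ.ρ X).graph)

end PreRep

/-! ### Special induction -/

namespace SpecialSub

variable {G H : SuperLieGroup.{u}}

/-- The equivariance condition `f(hg) = σ(h) f(g)`. -/
def IsEquivariant (i : SpecialSub H G) (σ : PreRep.{u, w} H) (f : G.G₀ → σ.V) : Prop :=
  ∀ h g, f (i.even h * g) = σ.π h (f g)

theorem IsEquivariant.inner_out {i : SpecialSub H G} {σ : PreRep.{u, w} H} {f f' : G.G₀ → σ.V}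
    (hf : i.IsEquivariant σ f) (hf' : i.IsEquivariant σ f') (g : G.G₀) :
    inner ℂ (f (Quotient.mk'' g : i.Cosets).out) (f' (Quotient.mk'' g : i.Cosets).out) =
      inner ℂ (f g) (f' g) := by
  obtain ⟨h, hh⟩ := i.rightRel_iff.1 (Quotient.mk_out (s := QuotientGroup.rightRel _) g)
  conv_rhs => rw [← hh, hf, hf', LinearIsometryEquiv.inner_map_map]

theorem IsEquivariant.enorm_out {i : SpecialSub H G} {σ : PreRep.{u, w} H} {f : G.G₀ → σ.V}
    (hf : i.IsEquivariant σ f) (g : G.G₀) :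
    ‖f (Quotient.mk'' g : i.Cosets).out‖ₑ = ‖f g‖ₑ := by
  obtain ⟨h, hh⟩ := i.rightRel_iff.1 (Quotient.mk_out (s := QuotientGroup.rightRel _) g)
  conv_rhs => rw [← hh, hf, ← ofReal_norm, LinearIsometryEquiv.norm_map, ofReal_norm]

theorem IsEquivariant.measurable_enorm {i : SpecialSub H G} {σ : PreRep.{u, w} H}
    {f : G.G₀ → σ.V} (hf : i.IsEquivariant σ f) (hm : StronglyMeasurable f) :
    Measurable fun x : i.Cosets => ‖f x.out‖ₑ := by
  rw [measurable_from_quotient]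
  have : (fun x : i.Cosets => ‖f x.out‖ₑ) ∘ Quotient.mk'' = fun g => ‖f g‖ₑ :=
    funext fun g => hf.enorm_out g
  rw [this]
  exact hm.enorm

/-- The functions `f : G₀ → 𝒦` that are (strongly) measurable, satisfy `f(hg) = σ(h) f(g)`, and are
square integrable over `H₀ \ G₀`.  The function `‖f‖` is constant on cosets, so that its value at
a coset `x` is read off at the representative `x.out`. -/
def sections (i : SpecialSub H G) (μ : i.InvariantMeasure) (σ : PreRep.{u, w} H) :
    Submodule ℂ (G.G₀ → σ.V) where
  carrier := {f | StronglyMeasurable f ∧ i.IsEquivariant σ f ∧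
    ∫⁻ x : i.Cosets, ‖f x.out‖ₑ ^ 2 ∂μ.measure < ⊤}
  add_mem' := by
    rintro f f' ⟨hm, he, hi⟩ ⟨hm', he', hi'⟩
    refine ⟨hm.add hm', fun h g => by simp [he h g, he' h g], ?_⟩
    have hmeas := (he.measurable_enorm hm).pow_const 2
    calc ∫⁻ x : i.Cosets, ‖(f + f') x.out‖ₑ ^ 2 ∂μ.measure
        ≤ ∫⁻ x : i.Cosets, (2 * ‖f x.out‖ₑ ^ 2 + 2 * ‖f' x.out‖ₑ ^ 2) ∂μ.measure := by
          refine lintegral_mono fun x => ?_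
          calc ‖(f + f') x.out‖ₑ ^ 2 ≤ (‖f x.out‖ₑ + ‖f' x.out‖ₑ) ^ 2 := by
                gcongr
                exact enorm_add_le _ _
            _ ≤ 2 * ‖f x.out‖ₑ ^ 2 + 2 * ‖f' x.out‖ₑ ^ 2 := by
                have := ENNReal.rpow_add_le_mul_rpow_add_rpow ‖f x.out‖ₑ ‖f' x.out‖ₑ
                  (p := 2) (by norm_num)
                norm_num at this
                rw [← mul_add]
                exact_mod_cast this
      _ < ⊤ := by
          rw [lintegral_add_left (hmeas.const_mul 2), lintegral_const_mul' _ _ (by simp),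
            lintegral_const_mul' _ _ (by simp)]
          exact ENNReal.add_lt_top.2 ⟨ENNReal.mul_lt_top (by simp) hi,
            ENNReal.mul_lt_top (by simp) hi'⟩
  zero_mem' := ⟨stronglyMeasurable_const, fun h g => by simp, by simp⟩
  smul_mem' := by
    rintro c f ⟨hm, he, hi⟩
    refine ⟨hm.const_smul c, fun h g => by simp [he h g], ?_⟩
    simp only [Pi.smul_apply, enorm_smul, mul_pow]
    rw [lintegral_const_mul' _ _ (by simp)]
    exact ENNReal.mul_lt_top (by simp) hi

/-- The space `sections`, as a type of its own, to carry the `L²` inner product. -/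
def Sect (i : SpecialSub H G) (μ : i.InvariantMeasure) (σ : PreRep.{u, w} H) : Type (max u w) :=
  ↥(i.sections μ σ)

namespace Sect

variable {i : SpecialSub H G} {μ : i.InvariantMeasure} {σ : PreRep.{u, w} H}

instance : AddCommGroup (i.Sect μ σ) := inferInstanceAs (AddCommGroup ↥(i.sections μ σ))

instance : Module ℂ (i.Sect μ σ) := inferInstanceAs (Module ℂ ↥(i.sections μ σ))

/-- The function underlying an element of `Sect`. -/
def toFun (f : i.Sect μ σ) : G.G₀ → σ.V := (show ↥(i.sections μ σ) from f).1

instance : CoeFun (i.Sect μ σ) (fun _ => G.G₀ → σ.V) := ⟨toFun⟩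

theorem stronglyMeasurable (f : i.Sect μ σ) : StronglyMeasurable f := f.2.1

theorem equivariant (f : i.Sect μ σ) : i.IsEquivariant σ f := f.2.2.1

theorem lintegral_lt_top (f : i.Sect μ σ) :
    ∫⁻ x : i.Cosets, ‖f x.out‖ₑ ^ 2 ∂μ.measure < ⊤ := f.2.2.2

theorem measurable_inner (f f' : i.Sect μ σ) :
    Measurable fun x : i.Cosets => inner ℂ (f x.out) (f' x.out) := by
  rw [measurable_from_quotient]
  have : (fun x : i.Cosets => inner ℂ (f x.out) (f' x.out)) ∘ Quotient.mk'' =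
      fun g => inner ℂ (f g) (f' g) := funext fun g => f.equivariant.inner_out f'.equivariant g
  rw [this]
  exact (f.stronglyMeasurable.inner f'.stronglyMeasurable).measurable

theorem integrable_inner (f f' : i.Sect μ σ) :
    Integrable (fun x : i.Cosets => inner ℂ (f x.out) (f' x.out)) μ.measure := by
  refine ⟨(measurable_inner f f').aestronglyMeasurable, ?_⟩
  have hmeas := (f.equivariant.measurable_enorm f.stronglyMeasurable).pow_const 2
  refine lt_of_le_of_lt (lintegral_mono (g := fun x : i.Cosets =>
    ‖f x.out‖ₑ ^ 2 + ‖f' x.out‖ₑ ^ 2) fun x => ?_) ?_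
  · have h1 : ‖inner ℂ (f x.out) (f' x.out)‖ ≤ ‖f x.out‖ ^ 2 + ‖f' x.out‖ ^ 2 :=
      (norm_inner_le_norm _ _).trans
        (by nlinarith [sq_nonneg (‖f x.out‖ - ‖f' x.out‖), sq_nonneg ‖f x.out‖,
          sq_nonneg ‖f' x.out‖])
    calc ‖inner ℂ (f x.out) (f' x.out)‖ₑ
        = ENNReal.ofReal ‖inner ℂ (f x.out) (f' x.out)‖ := (ofReal_norm _).symm
      _ ≤ ENNReal.ofReal (‖f x.out‖ ^ 2 + ‖f' x.out‖ ^ 2) := ENNReal.ofReal_le_ofReal h1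
      _ = _ := by
        rw [ENNReal.ofReal_add (by positivity) (by positivity),
          ENNReal.ofReal_pow (by positivity), ENNReal.ofReal_pow (by positivity), ofReal_norm,
          ofReal_norm]
  · rw [lintegral_add_left hmeas]
    exact ENNReal.add_lt_top.2 ⟨f.lintegral_lt_top, f'.lintegral_lt_top⟩

/-- The inner product `⟨f, f'⟩ = ∫_{H₀ \ G₀} ⟨f(g), f'(g)⟩ dμ`. -/
instance core : PreInnerProductSpace.Core ℂ (i.Sect μ σ) where
  inner f f' := ∫ x : i.Cosets, inner ℂ (f x.out) (f' x.out) ∂μ.measure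
  conj_inner_symm f f' := by
    rw [← integral_conj]
    simp only [inner_conj_symm]
  re_inner_nonneg f := by
    have h : (RCLike.re (∫ x : i.Cosets, inner ℂ (f x.out) (f x.out) ∂μ.measure)) =
        ∫ x : i.Cosets, RCLike.re (inner ℂ (f x.out) (f x.out)) ∂μ.measure :=
      (integral_re (integrable_inner f f)).symm
    rw [h]
    exact integral_nonneg fun x => inner_self_nonneg
  add_left f f' f'' := by
    rw [← integral_add (integrable_inner f f'') (integrable_inner f' f'')]
    exact integral_congr_ae (.of_forall fun x => inner_add_left _ _ _)
  smul_left f f' c := by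
    rw [← integral_const_mul]
    exact integral_congr_ae (.of_forall fun x => inner_smul_left _ _ _)

instance : SeminormedAddCommGroup (i.Sect μ σ) :=
  InnerProductSpace.Core.toSeminormedAddCommGroup (𝕜 := ℂ)

instance : InnerProductSpace ℂ (i.Sect μ σ) := InnerProductSpace.ofCore core

theorem inner_def (f f' : i.Sect μ σ) :
    inner ℂ f f' = ∫ x : i.Cosets, inner ℂ (f x.out) (f' x.out) ∂μ.measure := rfl

theorem lintegral_translate {φ : i.Cosets → ENNReal} (hφ : Measurable φ) (g : G.G₀) :
    ∫⁻ x, φ (i.translate g x) ∂μ.measure = ∫⁻ x, φ x ∂μ.measure := by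
  conv_rhs => rw [← μ.map_translate g]
  rw [lintegral_map hφ (i.measurable_translate g)]

theorem translate_out (g : G.G₀) (x : i.Cosets) :
    i.translate g x = Quotient.mk'' (x.out * g) := by
  conv_lhs => rw [← Quotient.out_eq x]
  rfl

/-- Right translation, `(π(g) f)(g') = f(g' g)`. -/
def rightTranslate (g : G.G₀) : i.Sect μ σ →ₗ[ℂ] i.Sect μ σ where
  toFun f := ⟨fun g' => f (g' * g), by
    have he : i.IsEquivariant σ (fun g' => f (g' * g)) := fun h g' => by
      change f (i.even h * g' * g) = _
      rw [mul_assoc]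
      exact f.equivariant h _
    refine ⟨f.stronglyMeasurable.comp_measurable (measurable_mul_const g), he, ?_⟩
    have h := lintegral_translate (μ := μ)
      ((f.equivariant.measurable_enorm f.stronglyMeasurable).pow_const 2) g
    simp only [translate_out, f.equivariant.enorm_out] at h
    rw [h]
    exact f.lintegral_lt_top⟩
  map_add' _ _ := rfl
  map_smul' _ _ := rfl

theorem rightTranslate_apply (g g' : G.G₀) (f : i.Sect μ σ) :
    rightTranslate g f g' = f (g' * g) := rfl

theorem inner_rightTranslate (g : G.G₀) (f f' : i.Sect μ σ) :
    inner ℂ (rightTranslate g f) (rightTranslate g f') = inner ℂ f f' := by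
  simp only [inner_def, rightTranslate_apply]
  conv_rhs => rw [← μ.map_translate g]
  rw [integral_map (i.measurable_translate g).aemeasurable
    (measurable_inner f f').aestronglyMeasurable]
  simp only [translate_out, f.equivariant.inner_out f'.equivariant]

theorem norm_rightTranslate (g : G.G₀) (f : i.Sect μ σ) : ‖rightTranslate g f‖ = ‖f‖ := by
  rw [@norm_eq_sqrt_re_inner ℂ, @norm_eq_sqrt_re_inner ℂ, inner_rightTranslate]

/-- `f` is smooth and its support is compact modulo `H₀`. -/
def IsSmoothCompact (f : i.Sect μ σ) : Prop :=
  ContMDiff 𝓘(ℝ, G.E) 𝓘(ℝ, σ.V) ∞ f ∧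
    ∃ C : Set G.G₀, IsCompact C ∧ ∀ g, f g ≠ 0 → ∃ h, ∃ c ∈ C, g = i.even h * c

end Sect

/-- The Hilbert space of the induced representation: square integrable equivariant functions,
modulo equality almost everywhere. -/
abbrev IndSpace (i : SpecialSub H G) (μ : i.InvariantMeasure) (σ : PreRep.{u, w} H) :
    Type (max u w) :=
  SeparationQuotient (i.Sect μ σ)

variable (i : SpecialSub H G) (μ : i.InvariantMeasure) (σ : PreRep.{u, w} H)

/-- The class of `f` modulo equality almost everywhere. -/
abbrev toInd : i.Sect μ σ →L[ℂ] i.IndSpace μ σ := SeparationQuotient.mkCLM ℂ (i.Sect μ σ)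

/-- Right translation on the space of the induced representation. -/
def indLinear (g : G.G₀) : i.IndSpace μ σ →ₗᵢ[ℂ] i.IndSpace μ σ where
  toLinearMap := (SeparationQuotient.liftCLM
    ((i.toInd μ σ).comp (LinearIsometry.toContinuousLinearMap
      ⟨Sect.rightTranslate g, Sect.norm_rightTranslate g⟩))
    (fun _ _ h => (h.map (ContinuousLinearMap.continuous _)).eq)).toLinearMap
  norm_map' := by
    intro v
    obtain ⟨f, rfl⟩ := SeparationQuotient.surjective_mk v
    exact Sect.norm_rightTranslate g f

theorem indLinear_toInd (g : G.G₀) (f : i.Sect μ σ) :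
    i.indLinear μ σ g (i.toInd μ σ f) = i.toInd μ σ (Sect.rightTranslate g f) := rfl

theorem indLinear_mul (g g' : G.G₀) (v : i.IndSpace μ σ) :
    i.indLinear μ σ (g * g') v = i.indLinear μ σ g (i.indLinear μ σ g' v) := by
  obtain ⟨f, rfl⟩ := SeparationQuotient.surjective_mk v
  change i.toInd μ σ _ = i.toInd μ σ _
  congr 1
  apply Subtype.ext
  funext x
  change f (x * (g * g')) = f (x * g * g')
  rw [mul_assoc]

theorem indLinear_one (v : i.IndSpace μ σ) : i.indLinear μ σ 1 v = v := by
  obtain ⟨f, rfl⟩ := SeparationQuotient.surjective_mk v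
  change i.toInd μ σ _ = i.toInd μ σ _
  congr 1
  apply Subtype.ext
  funext x
  change f (x * 1) = f x
  rw [mul_one]

/-- The right regular action of `G₀` on the space of the induced representation. -/
def indπ : G.G₀ →* (i.IndSpace μ σ ≃ₗᵢ[ℂ] i.IndSpace μ σ) where
  toFun g :=
    { (i.indLinear μ σ g) with
      invFun := i.indLinear μ σ g⁻¹
      left_inv := fun v => by
        change i.indLinear μ σ g⁻¹ (i.indLinear μ σ g v) = v
        rw [← indLinear_mul, inv_mul_cancel, indLinear_one]
      right_inv := fun v => by
        change i.indLinear μ σ g (i.indLinear μ σ g⁻¹ v) = v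
        rw [← indLinear_mul, mul_inv_cancel, indLinear_one] }
  map_one' := LinearIsometryEquiv.ext fun v => i.indLinear_one μ σ v
  map_mul' g g' := LinearIsometryEquiv.ext fun v => i.indLinear_mul μ σ g g' v

/-- The grading: classes of functions with values in `𝒦₀`, respectively in `𝒦₁`. -/
def indGr (k : ZMod 2) : Submodule ℂ (i.IndSpace μ σ) :=
  Submodule.map (i.toInd μ σ).toLinearMap
    { carrier := {f : i.Sect μ σ | ∀ g, f g ∈ σ.gr k}
      add_mem' := fun hf hf' g => (σ.gr k).add_mem (hf g) (hf' g)
      zero_mem' := fun _ => (σ.gr k).zero_mem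
      smul_mem' := fun c _ hf g => (σ.gr k).smul_mem c (hf g) }

/-- The graph of the operator `(ρ(X) f)(g) = ρ^σ(g · X) (f(g))`, defined on the space of smooth
functions with compact support modulo `H₀`. -/
def indGraph (X : G.𝔤₁) : Submodule ℂ (i.IndSpace μ σ × i.IndSpace μ σ) where
  carrier := {p | ∃ f f' : i.Sect μ σ, f.IsSmoothCompact ∧
    (∀ g, (f g, f' g) ∈ (σ.ρ (i.oddEquiv.symm (G.act g X))).graph) ∧
    p = (i.toInd μ σ f, i.toInd μ σ f')}
  add_mem' := by
    rintro _ _ ⟨f₁, f₁', ⟨hs₁, C₁, hC₁, hc₁⟩, h₁, rfl⟩ ⟨f₂, f₂', ⟨hs₂, C₂, hC₂, hc₂⟩, h₂, rfl⟩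
    refine ⟨f₁ + f₂, f₁' + f₂', ⟨hs₁.add hs₂, C₁ ∪ C₂, hC₁.union hC₂, fun g hg => ?_⟩,
      fun g => Submodule.add_mem _ (h₁ g) (h₂ g), by simp⟩
    by_cases hg₁ : f₁ g = 0
    · have hg₂ : f₂ g ≠ 0 := fun h0 => hg (by
        change f₁ g + f₂ g = 0
        rw [hg₁, h0, add_zero])
      obtain ⟨h, c, hc, e⟩ := hc₂ g hg₂
      exact ⟨h, c, Or.inr hc, e⟩
    · obtain ⟨h, c, hc, e⟩ := hc₁ g hg₁
      exact ⟨h, c, Or.inl hc, e⟩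
  zero_mem' := ⟨0, 0, ⟨contMDiff_const, ∅, isCompact_empty, fun g hg => (hg rfl).elim⟩,
    fun g => Submodule.zero_mem _, by simp [Prod.zero_eq_mk]⟩
  smul_mem' := by
    rintro a _ ⟨f, f', ⟨hs, C, hC, hc⟩, h, rfl⟩
    have ha : ContDiff ℝ ∞ (fun x : σ.V => a • x) := contDiff_const_smul a
    refine ⟨a • f, a • f', ⟨ha.contMDiff.comp hs, C, hC, fun g hg => hc g fun h0 => hg ?_⟩,
      fun g => Submodule.smul_mem _ a (h g), by simp⟩
    change a • f g = 0
    rw [h0, smul_zero]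

/-- The induced representation of `(G₀, 𝔤)`.  The operator `ρ(X)` is the closure of the operator
with graph `indGraph X`, restricted to the space of smooth vectors of the right regular
representation. -/
def ind : PreRep.{u, max u w} G where
  V := i.IndSpace μ σ
  gr := i.indGr μ σ
  π := i.indπ μ σ
  ρ X := ((i.indGraph μ σ X).topologicalClosure ⊓
    (PreRep.smoothVectors ⟨i.IndSpace μ σ, i.indGr μ σ, i.indπ μ σ, fun _ => 0⟩).prod
      ⊤).toLinearPMap

end SpecialSub

end SuperLie

end

/-! A section f over H₀\G₀ is turned into the section g ↦ (k ↦ f(kg)) over K₀\G₀ with values in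
sections over H₀\K₀. On smooth sections with compact support modulo H₀ this map visibly respects
right translation, the gradings and, since k·(g·X) = (kg)·X, the odd operators. The analytic content
is that it multiplies norms by a constant, that its image is dense, that its values are smooth, and
that the induced data are unitary representations at all, with odd operators defined on every smooth
vector.

Norms. A Haar measure on H₀ and an invariant measure on a coset space combine to a right invariant
measure on G₀ (`weil`). Doing this directly or through K₀ gives two such measures, proportional by
uniqueness of Haar measure. A weight with integral 1 over every coset (`exists_bruhat`) brings the
proportionality back to the coset spaces (`exists_lintegral_stages`). The constant depends on the
chosen invariant measures and is divided out.

Density. For a test function φ and a vector u, the average g ↦ ∫ φ(hg) σ(h⁻¹)u dh is a smooth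
section. Pairing f with it unfolds to the integral of φ⟨f, u⟩ over G₀, so a section orthogonal to
all averages vanishes almost everywhere (`dense_of_orbitAverage_mem`). For K₀ in G₀ and u a smooth
section over H₀\K₀, the average comes from a section over H₀\G₀ (`denseRange_stage`).

Smoothness. On sections supported over one compact set C the L² norm is bounded by the supremum norm
over C, and an operator with such a bound takes smooth families to smooth families
(`contMDiffAt_of_bound_compact`).

Unitarity. The relation ρ(X)² = -(i/2) dπ([X,X]) and symmetry give ‖ρ(X)v‖² ≤ ‖dπ([X,X])v‖ ‖v‖, so
ρ(X)v is a bounded linear function of the pair (v, dπ([X,X])v). A dense invariant space of smooth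
vectors is a core for dπ (`exists_mem_approx`), hence the closure of ρ(X) reaches all smooth
vectors, and its algebraic properties pass from the core by weak pairing (`isUnitary_of_core`).
Likewise, symmetric operators on the same domain that agree on a dense part of it are equal
(`unitarilyEquivalent_of_dense`). -/

open scoped Topology ENNReal Pointwise

noncomputable section

/-! ### Smooth dependence on parameters, and extension of bounded operators -/

section
variable {E : Type*} [NormedAddCommGroup E] [NormedSpace ℝ E]
  {E' : Type*} [NormedAddCommGroup E'] [NormedSpace ℝ E']
  {W : Type*} [NormedAddCommGroup W] [NormedSpace ℝ W]
  {M : Type*} [TopologicalSpace M] [ChartedSpace E M] [IsManifold 𝓘(ℝ, E) ∞ M]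
  {N : Type*} [TopologicalSpace N] [ChartedSpace E' N] [IsManifold 𝓘(ℝ, E') ∞ N]

/-- A partial derivative, at a fixed point and in a fixed direction, of a smooth map depends
smoothly on the parameter. -/
theorem ContMDiff.mfderiv_param {f : N → M → W}
    (hf : ContMDiff (𝓘(ℝ, E').prod 𝓘(ℝ, E)) 𝓘(ℝ, W) ∞ (fun p : N × M => f p.1 p.2))
    (x₀ : M) (X : E) :
    ContMDiff 𝓘(ℝ, E') 𝓘(ℝ, W) ∞
      (fun y => (mfderiv 𝓘(ℝ, E) 𝓘(ℝ, W) (f y) x₀ : E → W) X) := by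
  intro y₀
  have : IsManifold 𝓘(ℝ, E) 1 M := IsManifold.of_le (n := ∞) (by simp)
  have : IsManifold 𝓘(ℝ, E') 1 N := IsManifold.of_le (n := ∞) (by simp)
  have h := ContMDiffAt.mfderiv_apply (I := 𝓘(ℝ, E)) (I' := 𝓘(ℝ, W)) (J := 𝓘(ℝ, E')) (J' := 𝓘(ℝ, E'))
    (m := ∞) (n := ∞) (x₀ := y₀) f (fun _ => x₀) id (fun _ => X) (hf _) contMDiffAt_const
    contMDiffAt_id contMDiffAt_const (by simp)
  refine h.congr_of_eventuallyEq (.of_forall fun y => ?_)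
  -- The base point does not vary with y and the target is a vector space, so both coordinate
  -- changes in this formula are identities.
  have h1 := inTangentCoordinates_eq (I := 𝓘(ℝ, E)) (I' := 𝓘(ℝ, W)) (fun _ : N => x₀)
    (fun y => f y x₀) (fun y => (mfderiv 𝓘(ℝ, E) 𝓘(ℝ, W) (f y) x₀ : E →L[ℝ] W)) (x₀ := y₀) (x := y)
    (by simp) (Set.mem_univ _)
  refine Eq.trans ?_ (congrArg (fun L : E →L[ℝ] W => L X) h1).symm
  have h2 := (tangentBundleCore 𝓘(ℝ, E) M).coordChange_self (achart E x₀) x₀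
    (by simp) X
  change _ = (tangentBundleCore 𝓘(ℝ, W) W).coordChange (achart W (f y x₀)) (achart W (f y₀ x₀)) (f y x₀)
    ((mfderiv 𝓘(ℝ, E) 𝓘(ℝ, W) (f y) x₀ : E →L[ℝ] W)
      ((tangentBundleCore 𝓘(ℝ, E) M).coordChange (achart E x₀) (achart E x₀) x₀ X))
  rw [h2, tangentBundleCore_coordChange_model_space]
  rfl

/-- Both the differentiated variable and the target lie in vector spaces, so tangent coordinates
disappear. The joint smoothness supplies uniformity over a compact set and the inductive step in
`contDiffOn_restrict_compact`. -/
theorem ContMDiffAt.fderiv_param {f : E' → M → W} {x₀ : E'} {y₀ : M}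
    (hf : ContMDiffAt (𝓘(ℝ, E').prod 𝓘(ℝ, E)) 𝓘(ℝ, W) ∞ (fun p : E' × M => f p.1 p.2) (x₀, y₀)) :
    ContMDiffAt (𝓘(ℝ, E').prod 𝓘(ℝ, E)) 𝓘(ℝ, E' →L[ℝ] W) ∞
      (fun p : E' × M => fderiv ℝ (fun x => f x p.2) p.1) (x₀, y₀) := by
  have h := ContMDiffAt.mfderiv (I := 𝓘(ℝ, E')) (I' := 𝓘(ℝ, W)) (J := 𝓘(ℝ, E').prod 𝓘(ℝ, E))
    (M := E') (N := E' × M)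
    (m := ∞) (n := ∞) (x₀ := (x₀, y₀)) (fun p x => f x p.2) (fun p => p.1)
    (ContMDiffAt.comp (g := fun p : E' × M => f p.1 p.2) (f := fun q : (E' × M) × E' => (q.2, q.1.2))
      ((x₀, y₀), x₀) hf
      (contMDiffAt_snd.prodMk (contMDiffAt_snd.comp _ contMDiffAt_fst)))
    contMDiffAt_fst (by simp)
  refine h.congr_of_eventuallyEq (.of_forall fun p => ?_)
  simp only [inTangentCoordinates_model_space, mfderiv_eq_fderiv]

/-- A smooth function of two variables, restricted to a compact set in the second variable, is a
smooth map of the first variable into the space of continuous functions; here the first variable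
is in a vector space. -/
theorem contDiffOn_restrict_compact [FiniteDimensional ℝ E'] {U : Set E'} (hU : IsOpen U) (C : Set M)
    [CompactSpace C] {f : E' → M → W}
    (hf : ∀ x ∈ U, ∀ y ∈ C, ContMDiffAt (𝓘(ℝ, E').prod 𝓘(ℝ, E)) 𝓘(ℝ, W) ∞
      (fun p : E' × M => f p.1 p.2) (x, y))
    {Ψ : E' → C(C, W)} (hΨ : ∀ x ∈ U, ∀ y : C, Ψ x y = f x y) : ContDiffOn ℝ ∞ Ψ U := by
  rw [contDiffOn_infty]
  intro n
  -- the differential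
  have key : ∀ (f : E' → M → W), (∀ x ∈ U, ∀ y ∈ C, ContMDiffAt (𝓘(ℝ, E').prod 𝓘(ℝ, E)) 𝓘(ℝ, W) ∞
      (fun p : E' × M => f p.1 p.2) (x, y)) → ∀ Ψ : E' → C(C, W),
      (∀ x ∈ U, ∀ y : C, Ψ x y = f x y) → ∀ x ∈ U, ∃ L : E' →L[ℝ] C(C, W),
        (∀ v y, L v y = fderiv ℝ (fun x => f x (y : M)) x v) ∧ HasFDerivAt Ψ L x := by
    intro f hf Ψ hΨ x hx
    have hD : ∀ y ∈ C, ContinuousAt (fun p : E' × M => fderiv ℝ (fun x => f x p.2) p.1) (x, y) :=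
      fun y hy => (hf x hx y hy).fderiv_param.continuousAt
    have hDC : Continuous fun y : C => fderiv ℝ (fun x => f x (y : M)) x := by
      rw [continuous_iff_continuousAt]
      intro y
      exact (hD y y.2).comp (f := fun y : C => (x, (y : M)))
        (continuousAt_const.prodMk continuous_subtype_val.continuousAt)
    let L₀ : E' →ₗ[ℝ] C(C, W) :=
      { toFun := fun v => ⟨fun y => fderiv ℝ (fun x => f x (y : M)) x v, hDC.clm_apply continuous_const⟩
        map_add' := fun v w => by ext y; simp
        map_smul' := fun c v => by ext y; simp }
    refine ⟨L₀.toContinuousLinearMap, fun v y => rfl, ?_⟩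
    rw [hasFDerivAt_iff_isLittleO, Asymptotics.isLittleO_iff]
    intro ε hε
    -- Compactness of C makes the continuity of the derivative uniform in y. The mean value
    -- inequality on a ball then bounds the Taylor remainder in the supremum norm.
    have h1 : ∀ᶠ z in 𝓝 x, ∀ y ∈ C,
        ‖fderiv ℝ (fun x => f x y) z - fderiv ℝ (fun x => f x y) x‖ ≤ ε := by
      refine (isCompact_iff_compactSpace.2 ‹_›).eventually_forall_of_forall_eventually fun y hy => ?_
      have h2 : ContinuousAt (fun p : E' × M => fderiv ℝ (fun x => f x p.2) x) (x, y) :=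
        (hD y hy).comp (f := fun p : E' × M => (x, p.2)) (x := (x, y))
          (continuousAt_const.prodMk continuous_snd.continuousAt)
      have h3 := ((hD y hy).sub h2).norm
      have h4 : ‖fderiv ℝ (fun x => f x y) x - fderiv ℝ (fun x => f x y) x‖ < ε := by simpa using hε
      exact (h3.eventually_lt continuousAt_const h4).mono fun p hp => hp.le
    obtain ⟨δ, hδ, hδε⟩ := Metric.eventually_nhds_iff_ball.1 (h1.and (hU.eventually_mem hx))
    filter_upwards [Metric.ball_mem_nhds x hδ] with z hz
    rw [ContinuousMap.norm_le _ (by positivity)]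
    intro y
    have hzU := (hδε z hz).2
    change ‖Ψ z y - Ψ x y - fderiv ℝ (fun x => f x (y : M)) x (z - x)‖ ≤ _
    rw [hΨ z hzU, hΨ x hx]
    refine (convex_ball x δ).norm_image_sub_le_of_norm_hasFDerivWithin_le'
      (f := fun x => f x (y : M)) (f' := fun z => fderiv ℝ (fun x => f x (y : M)) z) ?_ ?_
      (Metric.mem_ball_self hδ) hz
    · intro w hw
      have h5 : ContMDiffAt 𝓘(ℝ, E') 𝓘(ℝ, W) ∞ (fun x => f x (y : M)) w :=
        ContMDiffAt.comp (g := fun p : E' × M => f p.1 p.2) (f := fun x => (x, (y : M))) w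
          (hf w (hδε w hw).2 y y.2) (contMDiffAt_id.prodMk contMDiffAt_const)
      exact (h5.contDiffAt.differentiableAt (by simp)).hasFDerivAt.hasFDerivWithinAt
    · exact fun w hw => (hδε w hw).1 y y.2
  induction n generalizing f Ψ with
  | zero =>
    rw [Nat.cast_zero, contDiffOn_zero]
    intro x hx
    obtain ⟨L, -, hL⟩ := key f hf Ψ hΨ x hx
    exact hL.continuousAt.continuousWithinAt
  | succ n ih =>
    rw [Nat.cast_succ]
    refine contDiffOn_succ_of_fderiv_apply ?_ (by simp) fun v => ?_
    · intro x hx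
      obtain ⟨L, -, hL⟩ := key f hf Ψ hΨ x hx
      exact hL.differentiableAt.differentiableWithinAt
    -- A directional derivative of Ψ is again the restriction to C of a smooth function of two
    -- variables.
    · refine ih (f := fun x y => fderiv ℝ (fun x => f x y) x v) ?_ ?_
      · intro x hx y hy
        exact (hf x hx y hy).fderiv_param.clm_apply contMDiffAt_const
      · intro x hx y
        obtain ⟨L, hLv, hL⟩ := key f hf Ψ hΨ x hx
        rw [fderivWithin_of_isOpen hU hx, hL.fderiv, hLv]

/-- A map into a closed subspace is smooth if it is smooth as a map into the whole space. -/
theorem contDiffOn_of_subtype [FiniteDimensional ℝ E'] {U : Set E'} (hU : IsOpen U)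
    {P : Submodule ℝ W} (hP : IsClosed (P : Set W)) {ψ : E' → P}
    (h : ContDiffOn ℝ ∞ (fun x => (ψ x : W)) U) : ContDiffOn ℝ ∞ ψ U := by
  rw [contDiffOn_infty] at h ⊢
  intro n
  replace h := h n
  have key : ∀ ψ : E' → P, ∀ x ∈ U, ∀ L : E' →L[ℝ] W, HasFDerivAt (fun x => (ψ x : W)) L x →
      ∃ L' : E' →L[ℝ] P, (∀ v, (L' v : W) = L v) ∧ HasFDerivAt ψ L' x := by
    intro ψ x hx L hL
    -- Directional derivatives are limits of difference quotients, which lie in the closed subspace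
    -- P.
    have hmem : ∀ v, L v ∈ P := by
      intro v
      have h1 := (hL.comp_hasDerivAt_of_eq (0 : ℝ) (f := fun t : ℝ => x + t • v)
        (((hasDerivAt_id (0:ℝ)).smul_const v).const_add x) (by simp))
      rw [one_smul, hasDerivAt_iff_tendsto_slope] at h1
      refine hP.mem_of_tendsto h1 (.of_forall fun t => ?_)
      exact P.smul_mem _ (P.sub_mem (ψ _).2 (ψ _).2)
    refine ⟨L.codRestrict P hmem, fun v => rfl, ?_⟩
    rw [hasFDerivAt_iff_isLittleO, ← Asymptotics.isLittleO_norm_left] at hL ⊢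
    exact hL
  induction n generalizing ψ with
  | zero =>
    rw [Nat.cast_zero, contDiffOn_zero] at h ⊢
    exact continuousOn_iff_continuous_domRestrict.2
      (Continuous.subtype_mk (continuousOn_iff_continuous_domRestrict.1 h) _)
  | succ n ih =>
    rw [Nat.cast_succ] at h ⊢
    have hd : ∀ x ∈ U, HasFDerivAt (fun x => (ψ x : W)) (fderiv ℝ (fun x => (ψ x : W)) x) x :=
      fun x hx => ((h.differentiableOn (by simp)).differentiableAt (hU.mem_nhds hx)).hasFDerivAt
    refine contDiffOn_succ_of_fderiv_apply ?_ (by simp) fun v => ?_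
    · intro x hx
      obtain ⟨L, -, hL⟩ := key ψ x hx _ (hd x hx)
      exact hL.differentiableAt.differentiableWithinAt
    · refine ih ?_
      refine (((contDiffOn_succ_iff_fderiv_of_isOpen hU).1 h).2.2.clm_apply
        (contDiffOn_const (c := v))).congr fun x hx => ?_
      obtain ⟨L, hLv, hL⟩ := key ψ x hx _ (hd x hx)
      rw [fderivWithin_of_isOpen hU hx, hL.fderiv, hLv]

/-- Let `T` be an operator that is bounded by the supremum norm over a compact set. If `f` is a
smooth function of two variables, then `T` applied to `f` in the second variable depends smoothly
on the first one, and its differential is obtained by applying `T` to that of `f`. -/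
theorem contMDiffAt_of_bound_compact [FiniteDimensional ℝ E'] (C : Set M) [CompactSpace C]
    {B : Type*} [NormedAddCommGroup B] [NormedSpace ℝ B] [CompleteSpace B]
    {D : Type*} [AddCommGroup D] [Module ℝ D] (ev : D →ₗ[ℝ] C(C, W)) (T : D →ₗ[ℝ] B)
    (hT : ∃ c, ∀ d, ‖T d‖ ≤ c * ‖ev d‖)
    {f : N → M → W}
    (hf : ContMDiff (𝓘(ℝ, E').prod 𝓘(ℝ, E)) 𝓘(ℝ, W) ∞ (fun p : N × M => f p.1 p.2))
    {Φ : N → B} {x₀ : N} (hΦ : ∀ᶠ x in 𝓝 x₀, ∃ d, (∀ y : C, ev d y = f x y) ∧ Φ x = T d) :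
    ContMDiffAt 𝓘(ℝ, E') 𝓘(ℝ, B) ∞ Φ x₀ ∧
      ∀ (X : E') (d : D),
        (∀ y : C, ev d y = (mfderiv 𝓘(ℝ, E') 𝓘(ℝ, W) (fun x => f x y) x₀ : E' → W) X) →
        (mfderiv 𝓘(ℝ, E') 𝓘(ℝ, B) Φ x₀ : E' → B) X = T d := by
  -- T is controlled by `ev`, hence extends to a bounded operator on the closure P of the range of
  -- `ev`. For x near x₀ the function f(x, ·) restricted to C lies in P, so Φ is locally a bounded
  -- operator after a smooth map.
  set P : Submodule ℝ C(C, W) := (LinearMap.range ev).topologicalClosure with hPdef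
  have hP : IsClosed (P : Set C(C, W)) := Submodule.isClosed_topologicalClosure _
  let ev' : D →ₗ[ℝ] P := ev.codRestrict P fun d =>
    Submodule.le_topologicalClosure _ (LinearMap.mem_range_self ev d)
  have hdense : DenseRange ev' := by
    intro p
    rw [Metric.mem_closure_iff]
    intro ε hε
    have h1 : (p : C(C, W)) ∈ closure (LinearMap.range ev : Set C(C, W)) := p.2
    obtain ⟨_, ⟨d, rfl⟩, hd⟩ := Metric.mem_closure_iff.1 h1 ε hε
    exact ⟨ev' d, ⟨d, rfl⟩, hd⟩
  let T' : P →L[ℝ] B := T.extendOfNorm ev'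
  have hT' : ∀ d, T' (ev' d) = T d := LinearMap.extendOfNorm_eq hdense hT
  set e := extChartAt 𝓘(ℝ, E') x₀ with he
  have hsymm : ContinuousAt e.symm (e x₀) := continuousAt_extChartAt_symm x₀
  have hx₀ : e.symm (e x₀) = x₀ := extChartAt_to_inv x₀
  have hev : ∀ᶠ z in 𝓝 (e x₀), z ∈ e.target ∧
      ∃ d, (∀ y : C, ev d y = f (e.symm z) y) ∧ Φ (e.symm z) = T d := by
    refine ((isOpen_extChartAt_target x₀).eventually_mem (mem_extChartAt_target x₀)).and ?_
    have : Filter.Tendsto e.symm (𝓝 (e x₀)) (𝓝 x₀) := by simpa [ContinuousAt, hx₀] using hsymm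
    exact this.eventually hΦ
  obtain ⟨U, hU, hUo, hxU⟩ := eventually_nhds_iff.1 hev
  choose! d hd using fun z hz => (hU z hz).2
  have hψ : ContDiffOn ℝ ∞ (fun z => ((ev' (d z) : P) : C(C, W))) U := by
    refine contDiffOn_restrict_compact (E := E) hUo C (f := fun z y => f (e.symm z) y) ?_ ?_
    · intro z hz y _
      have h1 : ContMDiffAt 𝓘(ℝ, E') 𝓘(ℝ, E') ∞ e.symm z :=
        (contMDiffOn_extChartAt_symm x₀).contMDiffAt
          ((isOpen_extChartAt_target x₀).mem_nhds (hU z hz).1)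
      exact ContMDiffAt.comp (g := fun p : N × M => f p.1 p.2)
        (f := fun p : E' × M => (e.symm p.1, p.2)) (z, y) (hf _)
        ((h1.comp (z, y) contMDiffAt_fst).prodMk contMDiffAt_snd)
    · exact fun z hz y => (hd z hz).1 y
  have hψ' := contDiffOn_of_subtype hUo hP hψ
  have hΦe : ∀ᶠ z in 𝓝 (e x₀), (Φ ∘ e.symm) z = T' (ev' (d z)) := by
    filter_upwards [hUo.mem_nhds hxU] with z hz
    rw [hT']
    exact (hd z hz).2
  have hsm : ContDiffAt ℝ ∞ (Φ ∘ e.symm) (e x₀) :=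
    (T'.contDiff.contDiffAt.comp _ (hψ'.contDiffAt (hUo.mem_nhds hxU))).congr_of_eventuallyEq hΦe
  have hΦs : ContMDiffAt 𝓘(ℝ, E') 𝓘(ℝ, B) ∞ Φ x₀ := by
    rw [contMDiffAt_iff_source]
    exact hsm.contMDiffAt.contMDiffWithinAt
  refine ⟨hΦs, fun X d' hd' => ?_⟩
  have h1 : HasFDerivAt (fun z => ev' (d z)) (fderiv ℝ (fun z => ev' (d z)) (e x₀)) (e x₀) :=
    ((hψ'.contDiffAt (hUo.mem_nhds hxU)).differentiableAt (by simp)).hasFDerivAt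
  have h2 : fderiv ℝ (Φ ∘ e.symm) (e x₀) = T'.comp (fderiv ℝ (fun z => ev' (d z)) (e x₀)) :=
    ((T'.hasFDerivAt.comp _ h1).congr_of_eventuallyEq hΦe).fderiv
  have h3 : (mfderiv 𝓘(ℝ, E') 𝓘(ℝ, B) Φ x₀ : E' → B) X = fderiv ℝ (Φ ∘ e.symm) (e x₀) X := by
    rw [(hΦs.mdifferentiableAt (by simp)).mfderiv]
    simp only [writtenInExtChartAt, extChartAt_model_space_eq_id, modelWithCornersSelf_coe,
      Set.range_id, fderivWithin_univ]
    rfl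
  rw [h3, h2, ContinuousLinearMap.comp_apply, ← hT']
  congr 1
  ext y
  change _ = ev d' y
  rw [hd' y]
  have hfy : ContMDiff 𝓘(ℝ, E') 𝓘(ℝ, W) ∞ (fun x => f x y) :=
    hf.comp (contMDiff_id.prodMk contMDiff_const)
  rw [((hfy x₀).mdifferentiableAt (by simp)).mfderiv]
  simp only [writtenInExtChartAt, extChartAt_model_space_eq_id, modelWithCornersSelf_coe, Set.range_id,
    fderivWithin_univ]
  -- Evaluation at y is bounded and linear, so the derivative of the C(C, W)-valued map is computed
  -- pointwise.
  have h4 := ((ContinuousMap.evalCLM ℝ y).comp P.subtypeL).hasFDerivAt.comp (e x₀) h1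
  have h5 : (fun z => f (e.symm z) y) =ᶠ[𝓝 (e x₀)]
      ((ContinuousMap.evalCLM ℝ y).comp P.subtypeL) ∘ fun z => ev' (d z) := by
    filter_upwards [hUo.mem_nhds hxU] with z hz
    exact ((hd z hz).1 y).symm
  have h6 := (h4.congr_of_eventuallyEq h5).fderiv
  change _ = fderiv ℝ (fun z => f (e.symm z) y) (e x₀) X
  rw [h6]
  rfl

/-- An operator that is bounded in terms of a map into a Hilbert space is the composition of that
map and a bounded operator. -/
theorem exists_clm_eq_comp_of_bound {D V X : Type*} [AddCommGroup D] [Module ℂ D]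
    [NormedAddCommGroup V] [NormedSpace ℂ V] [CompleteSpace V]
    [NormedAddCommGroup X] [InnerProductSpace ℂ X] [CompleteSpace X]
    (A : D →ₗ[ℂ] V) (R : D →ₗ[ℂ] X) (h : ∃ c, ∀ d, ‖A d‖ ≤ c * ‖R d‖) :
    ∃ S : X →L[ℂ] V, ∀ d, A d = S (R d) := by
  set P : Submodule ℂ X := (LinearMap.range R).topologicalClosure with hPdef
  have hP : IsClosed (P : Set X) := Submodule.isClosed_topologicalClosure _
  have : CompleteSpace P := hP.completeSpace_coe
  let R' : D →ₗ[ℂ] P := R.codRestrict P fun d =>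
    Submodule.le_topologicalClosure _ (LinearMap.mem_range_self R d)
  have hdense : DenseRange R' := by
    intro p
    rw [Metric.mem_closure_iff]
    intro ε hε
    have h1 : (p : X) ∈ closure (LinearMap.range R : Set X) := p.2
    obtain ⟨_, ⟨d, rfl⟩, hd⟩ := Metric.mem_closure_iff.1 h1 ε hε
    exact ⟨R' d, ⟨d, rfl⟩, hd⟩
  -- The Hilbert structure of X is used to extend by zero on the orthogonal complement of P.
  refine ⟨(A.extendOfNorm R').comp P.orthogonalProjectionOnto, fun d => ?_⟩
  rw [ContinuousLinearMap.comp_apply]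
  have h1 : P.orthogonalProjectionOnto (R d) = R' d :=
    Submodule.orthogonalProjectionOnto_mem_subspace_eq_self (R' d)
  rw [h1]
  exact (LinearMap.extendOfNorm_eq hdense h d).symm

end

/-! ### Curves tangent to the Lie algebra, and the infinitesimal action on smooth vectors -/

namespace SuperLie

/-- Every element of the Lie algebra is tangent to a curve of which all left translates have the same
tangent vector at `1`. -/
theorem exists_curve (G : SuperLieGroup.{u}) (Z : G.𝔤₀) :
    ∃ γ : ℝ → G.G₀, Continuous γ ∧ γ 0 = 1 ∧
      ∀ {W : Type w} [NormedAddCommGroup W] [NormedSpace ℝ W] (F : G.G₀ → W),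
        ContMDiff 𝓘(ℝ, G.E) 𝓘(ℝ, W) ∞ F → ∀ t, HasDerivAt (fun s => F ((γ t)⁻¹ * γ s))
          (mfderiv 𝓘(ℝ, G.E) 𝓘(ℝ, W) F 1 Z : W) t := by
  have : LieGroup 𝓘(ℝ, G.E) (minSmoothness ℝ 3) G.G₀ :=
    LieGroup.of_le (n := ∞) (by
      rw [minSmoothness_of_isRCLikeNormedField]
      exact WithTop.coe_le_coe.2 (le_top : (3 : ℕ∞) ≤ ⊤))
  set v : (g : G.G₀) → TangentSpace 𝓘(ℝ, G.E) g := mulInvariantVectorField Z with hv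
  have hsm : ContMDiff 𝓘(ℝ, G.E) 𝓘(ℝ, G.E).tangent 1
      (fun g => (⟨g, v g⟩ : TangentBundle 𝓘(ℝ, G.E) G.G₀)) :=
    (contMDiff_mulInvariantVectorField Z).of_le (by simp)
  have : IsManifold 𝓘(ℝ, G.E) 1 G.G₀ := IsManifold.of_le (n := ∞) (by simp)
  have hmul : ∀ g x : G.G₀, MDifferentiableAt 𝓘(ℝ, G.E) 𝓘(ℝ, G.E) (g * ·) x := fun g x =>
    (contMDiff_mul_left (I := 𝓘(ℝ, G.E)) (n := ∞) (a := g)).mdifferentiableAt (by simp)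
  have hvg : ∀ g h : G.G₀, (mfderiv 𝓘(ℝ, G.E) 𝓘(ℝ, G.E) (g * ·) h) (v h) = v (g * h) := by
    intro g h
    have h1 := mfderiv_comp_apply_of_eq (I := 𝓘(ℝ, G.E)) (I' := 𝓘(ℝ, G.E)) (I'' := 𝓘(ℝ, G.E))
      (x := (1 : G.G₀)) (f := (h * ·)) (g := (g * ·)) (y := h) (hmul g h) (hmul h 1) (mul_one h) Z
    have h2 : (g * ·) ∘ (h * ·) = ((g * h) * · : G.G₀ → G.G₀) := by
      funext x
      simp [mul_assoc]
    rw [h2] at h1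
    exact h1.symm
  have hloc : ∃ ε > 0, ∃ γ : ℝ → G.G₀, γ 0 = 1 ∧ IsMIntegralCurveOn γ v (Set.Ioo (-ε) ε) := by
    obtain ⟨γ, h0, hγ⟩ := exists_isMIntegralCurveAt_of_contMDiffAt_boundaryless 0 (hsm 1)
    obtain ⟨ε, hε, hγ⟩ := isMIntegralCurveAt_iff'.1 hγ
    refine ⟨ε, hε, γ, h0, ?_⟩
    simpa [Real.ball_eq_Ioo] using hγ
  obtain ⟨ε, hε, γ₀, h0, hγ₀⟩ := hloc
  -- Left translates of the local curve are integral curves of the left invariant field through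
  -- every point, all on the same interval. This uniform existence time yields an integral curve on
  -- the whole line.
  obtain ⟨γ, hγ0, hγ⟩ := exists_isMIntegralCurve_of_isMIntegralCurveOn hsm hε
    (fun x => ⟨fun t => x * γ₀ t, by simp [h0], fun t ht => by
      have h1 := ((hmul x (γ₀ t)).hasMFDerivAt).comp_hasMFDerivWithinAt t (hγ₀ t ht)
      have h2 := hvg x (γ₀ t)
      refine h1.congr_mfderiv ?_
      ext
      change (mfderiv 𝓘(ℝ, G.E) 𝓘(ℝ, G.E) (x * ·) (γ₀ t) : G.E →L[ℝ] G.E) ((1 : ℝ) • v (γ₀ t)) =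
        (1 : ℝ) • v (x * γ₀ t)
      rw [one_smul, one_smul]
      exact h2⟩) 1
  refine ⟨γ, ?_, hγ0, ?_⟩
  · rw [continuous_iff_continuousAt]
    exact fun t => (hγ t).continuousAt
  intro W _ _ F hF t
  have h1 := ((hmul (γ t)⁻¹ (γ t)).hasMFDerivAt).comp t (hγ t)
  have h2 : MDifferentiableAt 𝓘(ℝ, G.E) 𝓘(ℝ, W) F ((γ t)⁻¹ * γ t) :=
    (hF _).mdifferentiableAt (by simp)
  have h3 : HasFDerivAt (fun s => F ((γ t)⁻¹ * γ s)) ((mfderiv 𝓘(ℝ, G.E) 𝓘(ℝ, W) F ((γ t)⁻¹ * γ t) :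
      G.E →L[ℝ] W).comp ((mfderiv 𝓘(ℝ, G.E) 𝓘(ℝ, G.E) ((γ t)⁻¹ * ·) (γ t) : G.E →L[ℝ] G.E).comp
      ((1 : ℝ →L[ℝ] ℝ).smulRight (v (γ t) : G.E)))) t := (h2.hasMFDerivAt.comp t h1).hasFDerivAt
  have h7 : HasDerivAt (fun s => F ((γ t)⁻¹ * γ s)) _ t := HasFDerivAt.hasDerivAt (F := W) h3
  refine h7.congr_deriv ?_
  change (mfderiv 𝓘(ℝ, G.E) 𝓘(ℝ, W) F ((γ t)⁻¹ * γ t) : G.E →L[ℝ] W)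
    ((mfderiv 𝓘(ℝ, G.E) 𝓘(ℝ, G.E) ((γ t)⁻¹ * ·) (γ t) : G.E →L[ℝ] G.E) ((1 : ℝ) • v (γ t))) = _
  rw [one_smul]
  -- Left invariance carries the velocity at γ(t) back to the value of the field at 1, which is Z.
  have h4 : (mfderiv 𝓘(ℝ, G.E) 𝓘(ℝ, G.E) ((γ t)⁻¹ * ·) (γ t) : G.E →L[ℝ] G.E) (v (γ t)) = v 1 :=
    (hvg (γ t)⁻¹ (γ t)).trans (congrArg (fun g => (v g : G.E)) (inv_mul_cancel (γ t)))
  have h5 : (v 1 : G.E) = Z := by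
    have h6 : HasMFDerivAt 𝓘(ℝ, G.E) 𝓘(ℝ, G.E) ((1 : G.G₀) * ·) 1
        (ContinuousLinearMap.id ℝ (TangentSpace 𝓘(ℝ, G.E) (1 : G.G₀))) :=
      (hasMFDerivAt_id (1 : G.G₀)).congr_of_eventuallyEq (.of_forall fun x => by simp)
    exact congrArg (fun L : G.E →L[ℝ] G.E => L Z) h6.mfderiv
  rw [h4, h5, inv_mul_cancel]
namespace PreRep

variable {G : SuperLieGroup.{u}} (τ : PreRep.{u, w} G)

theorem π_mul_apply (g h : G.G₀) (v : τ.V) : τ.π (g * h) v = τ.π g (τ.π h v) := by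
  rw [map_mul]
  rfl

theorem π_one_apply (v : τ.V) : τ.π 1 v = v := by
  rw [map_one]
  rfl

theorem π_inv_π (g : G.G₀) (v : τ.V) : τ.π g⁻¹ (τ.π g v) = v := by
  rw [← π_mul_apply, inv_mul_cancel, π_one_apply]

theorem π_π_inv (g : G.G₀) (v : τ.V) : τ.π g (τ.π g⁻¹ v) = v := by
  rw [← π_mul_apply, mul_inv_cancel, π_one_apply]

theorem inner_π_left (g : G.G₀) (v v' : τ.V) : inner ℂ (τ.π g v) v' = inner ℂ v (τ.π g⁻¹ v') := by
  rw [← (τ.π g⁻¹).inner_map_map, π_inv_π]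

variable {τ}

theorem mem_smoothVectors {v : τ.V} :
    v ∈ τ.smoothVectors ↔ ContMDiff 𝓘(ℝ, G.E) 𝓘(ℝ, τ.V) ∞ (fun g : G.G₀ => τ.π g v) := Iff.rfl

theorem π_mem_smoothVectors {v : τ.V} (hv : v ∈ τ.smoothVectors) (g : G.G₀) :
    τ.π g v ∈ τ.smoothVectors := by
  rw [mem_smoothVectors] at hv ⊢
  have h := hv.comp (contMDiff_mul_right (I := 𝓘(ℝ, G.E)) (n := ∞) (a := g))
  refine h.congr fun x => ?_
  rw [← π_mul_apply]
  rfl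

/-- One curve serves all smooth vectors at once, so sums and inner products of vectors can be
differentiated along it. -/
theorem exists_curve_dπ (τ : PreRep.{u, w} G) (Z : G.𝔤₀) :
    ∃ γ : ℝ → G.G₀, Continuous γ ∧ γ 0 = 1 ∧ ∀ v ∈ τ.smoothVectors, ∀ t,
      HasDerivAt (fun s => τ.π ((γ t)⁻¹ * γ s) v) (τ.dπ Z v) t := by
  obtain ⟨γ, h1, h2, h3⟩ := exists_curve.{u, w} G Z
  exact ⟨γ, h1, h2, fun v hv t => h3 _ hv t⟩

theorem exists_curve_dπ_zero (τ : PreRep.{u, w} G) (Z : G.𝔤₀) :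
    ∃ γ : ℝ → G.G₀, γ 0 = 1 ∧ ∀ v ∈ τ.smoothVectors,
      HasDerivAt (fun s => τ.π (γ s) v) (τ.dπ Z v) 0 := by
  obtain ⟨γ, -, h2, h3⟩ := τ.exists_curve_dπ Z
  refine ⟨γ, h2, fun v hv => ?_⟩
  simpa [h2] using h3 v hv 0

theorem dπ_add {v v' : τ.V} (hv : v ∈ τ.smoothVectors) (hv' : v' ∈ τ.smoothVectors) (Z : G.𝔤₀) :
    τ.dπ Z (v + v') = τ.dπ Z v + τ.dπ Z v' := by
  obtain ⟨γ, -, h⟩ := τ.exists_curve_dπ_zero Z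
  have h1 := (h v hv).add (h v' hv')
  have h2 := h _ (τ.smoothVectors.add_mem hv hv')
  refine h2.unique (h1.congr_of_eventuallyEq (.of_forall fun s => ?_))
  simp

theorem dπ_smul {v : τ.V} (hv : v ∈ τ.smoothVectors) (c : ℂ) (Z : G.𝔤₀) :
    τ.dπ Z (c • v) = c • τ.dπ Z v := by
  obtain ⟨γ, -, h⟩ := τ.exists_curve_dπ_zero Z
  have h1 := (h v hv).const_smul c
  have h2 := h _ (τ.smoothVectors.smul_mem c hv)
  refine h2.unique (h1.congr_of_eventuallyEq (.of_forall fun s => ?_))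
  simp

/-- The infinitesimal action, as a linear map on the space of smooth vectors. -/
def dπₗ (τ : PreRep.{u, w} G) (Z : G.𝔤₀) : τ.smoothVectors →ₗ[ℂ] τ.V where
  toFun v := τ.dπ Z v
  map_add' v v' := dπ_add v.2 v'.2 Z
  map_smul' c v := dπ_smul v.2 c Z

theorem dπ_add_left (Z Z' : G.𝔤₀) (v : τ.V) : τ.dπ (Z + Z') v = τ.dπ Z v + τ.dπ Z' v :=
  (mfderiv 𝓘(ℝ, G.E) 𝓘(ℝ, τ.V) (fun g : G.G₀ => τ.π g v) 1).map_add Z Z'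

/-- The infinitesimal action is skew symmetric. -/
theorem inner_dπ_left {v v' : τ.V} (hv : v ∈ τ.smoothVectors) (hv' : v' ∈ τ.smoothVectors)
    (Z : G.𝔤₀) : inner ℂ (τ.dπ Z v) v' = -inner ℂ v (τ.dπ Z v') := by
  obtain ⟨γ, h0, h⟩ := τ.exists_curve_dπ_zero Z
  have h1 := (h v hv).inner ℂ (h v' hv')
  simp only [LinearIsometryEquiv.inner_map_map] at h1
  have h2 := h1.unique (hasDerivAt_const _ _)
  simp only [h0, π_one_apply] at h2
  exact eq_neg_of_add_eq_zero_right h2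

/-- The map (g, x) ↦ π(xg)v is smooth in both variables, and dπ(Z)π(g)v is its partial derivative in
x at 1. -/
theorem contMDiff_dπ_π {v : τ.V} (hv : v ∈ τ.smoothVectors) (Z : G.𝔤₀) :
    ContMDiff 𝓘(ℝ, G.E) 𝓘(ℝ, τ.V) ∞ (fun g : G.G₀ => τ.dπ Z (τ.π g v)) := by
  have h1 : ContMDiff (𝓘(ℝ, G.E).prod 𝓘(ℝ, G.E)) 𝓘(ℝ, τ.V) ∞
      (fun p : G.G₀ × G.G₀ => τ.π p.2 (τ.π p.1 v)) := by
    have h2 := (mem_smoothVectors.1 hv).comp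
      ((contMDiff_snd (M := G.G₀) (N := G.G₀) (I := 𝓘(ℝ, G.E)) (J := 𝓘(ℝ, G.E)) (n := ∞)).mul
        contMDiff_fst)
    refine h2.congr fun p => ?_
    rw [← π_mul_apply]
    rfl
  exact ContMDiff.mfderiv_param (f := fun g x => τ.π x (τ.π g v)) h1 1 Z

/-- A dense invariant space of smooth vectors is a core for the infinitesimal action. -/
theorem exists_mem_approx [CompleteSpace τ.V] (hc : ∀ v, Continuous fun g => τ.π g v)
    {D : Submodule ℂ τ.V} (hD : D ≤ τ.smoothVectors) (hdense : Dense (D : Set τ.V))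
    (hinv : ∀ g, ∀ v ∈ D, τ.π g v ∈ D) (Z : G.𝔤₀) {v : τ.V} (hv : v ∈ τ.smoothVectors)
    {ε : ℝ} (hε : 0 < ε) :
    ∃ d ∈ D, ‖d - v‖ < ε ∧ ‖τ.dπ Z d - τ.dπ Z v‖ < ε := by
  -- Since dπ(Z) is skew, A = dπ(Z) - 1 satisfies ‖Aw‖² = ‖dπ(Z)w‖² + ‖w‖². Approximating Av by Ad
  -- therefore approximates v and dπ(Z)v together, and it suffices that A maps D onto a dense
  -- subspace.
  let A : τ.smoothVectors →ₗ[ℂ] τ.V := τ.dπₗ Z - τ.smoothVectors.subtype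
  let B : D →ₗ[ℂ] τ.V := A.comp (Submodule.inclusion hD)
  have hA : ∀ w : τ.smoothVectors, ‖A w‖ ^ 2 = ‖τ.dπ Z w‖ ^ 2 + ‖(w : τ.V)‖ ^ 2 := by
    intro w
    change ‖τ.dπ Z w - w‖ ^ 2 = _
    rw [@norm_sub_sq ℂ]
    have h1 := inner_dπ_left w.2 w.2 Z
    have h2 : RCLike.re (inner ℂ (τ.dπ Z (w : τ.V)) (w : τ.V)) = 0 := by
      have h3 := congrArg RCLike.re h1
      rw [map_neg, inner_re_symm (w : τ.V)] at h3
      linarith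
    rw [h2]
    ring
  have hrange : (LinearMap.range B).topologicalClosure = ⊤ := by
    rw [Submodule.topologicalClosure_eq_top_iff, Submodule.eq_bot_iff]
    intro ψ hψ
    rw [Submodule.mem_orthogonal'] at hψ
    have hψ' : ∀ d ∈ D, inner ℂ ψ (τ.dπ Z d) = inner ℂ ψ d := by
      intro d hd
      have h1 : inner ℂ ψ (τ.dπ Z d - d) = 0 := hψ _ ⟨⟨d, hd⟩, rfl⟩
      rwa [inner_sub_right, sub_eq_zero] at h1
    obtain ⟨γ, hγc, hγ0, hγ⟩ := τ.exists_curve_dπ Z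
    -- For ψ orthogonal to A(D), the function y(t) = ⟨ψ, π(γ(t)⁻¹)d⟩ solves y' = -y; invariance of D
    -- lets the orthogonality be used at π(γ(t)⁻¹)d.
    have hderiv : ∀ d ∈ D, ∀ t, HasDerivAt (fun s => inner ℂ ψ (τ.π (γ s)⁻¹ d))
        (-inner ℂ ψ (τ.π (γ t)⁻¹ d)) t := by
      intro d hd t
      set e := τ.π (γ t)⁻¹ d with he
      have hee : e ∈ D := hinv _ _ hd
      have h1 := hγ e (hD hee) t
      have h2 : HasDerivAt (fun s => τ.π (γ s)⁻¹ d) (-τ.dπ Z e) t := by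
        rw [hasDerivAt_iff_tendsto_slope] at h1 ⊢
        -- The difference quotient along the inverse curve is the negative of the known one, moved
        -- by π(γ(s)⁻¹γ(t)). These isometries converge strongly to the identity, which gives the
        -- limit.
        have h3 : ∀ s, slope (fun s => τ.π (γ s)⁻¹ d) t s =
            -τ.π ((γ s)⁻¹ * γ t) (slope (fun s => τ.π ((γ t)⁻¹ * γ s) e) t s) := by
          intro s
          have hs : ∀ (g : G.G₀) (c : ℝ) (x : τ.V), τ.π g (c • x) = c • τ.π g x := fun g c x =>
            (τ.π g).toLinearEquiv.toLinearMap.map_smul_of_tower c x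
          simp only [slope, vsub_eq_sub, hs, map_sub, he, ← π_mul_apply]
          rw [← smul_neg, neg_sub]
          congr 3
          · group
          · group
        have h4 : Filter.Tendsto (fun s => (γ s)⁻¹ * γ t) (𝓝[≠] t) (𝓝 1) := by
          have : Continuous fun s => (γ s)⁻¹ * γ t := by fun_prop
          have h5 := this.tendsto t
          rw [inv_mul_cancel] at h5
          exact h5.mono_left nhdsWithin_le_nhds
        have h6 : Filter.Tendsto (fun s => τ.π ((γ s)⁻¹ * γ t)
            (slope (fun s => τ.π ((γ t)⁻¹ * γ s) e) t s)) (𝓝[≠] t) (𝓝 (τ.dπ Z e)) := by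
          have h7 : Filter.Tendsto (fun s => τ.π ((γ s)⁻¹ * γ t) (τ.dπ Z e)) (𝓝[≠] t)
              (𝓝 (τ.dπ Z e)) := by
            have := ((hc (τ.dπ Z e)).tendsto 1).comp h4
            rwa [π_one_apply] at this
          refine h7.congr_dist ?_
          have h8 := tendsto_iff_dist_tendsto_zero.1 h1
          refine h8.congr fun s => ?_
          rw [LinearIsometryEquiv.dist_map, dist_comm]
        exact h6.neg.congr fun s => (h3 s).symm
      have h9 := (hasDerivAt_const t ψ).inner ℂ h2
      simpa [hψ' e hee] using h9
    have hzero : ∀ d ∈ D, inner ℂ ψ d = 0 := by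
      intro d hd
      have h1 : ∀ t : ℝ, HasDerivAt (fun s : ℝ => Complex.exp s * inner ℂ ψ (τ.π (γ s)⁻¹ d)) 0 t := by
        intro t
        have h2 := ((Complex.hasDerivAt_exp (t : ℂ)).comp_ofReal).mul (hderiv d hd t)
        refine h2.congr_deriv ?_
        ring
      have h3 : ∀ t : ℝ, Complex.exp t * inner ℂ ψ (τ.π (γ t)⁻¹ d) = inner ℂ ψ d := by
        intro t
        have h4 := is_const_of_deriv_eq_zero (fun t => (h1 t).differentiableAt)
          (fun t => (h1 t).deriv) t 0
        simpa [hγ0, π_one_apply] using h4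
      have h5 : ∀ t : ℝ, ‖inner ℂ ψ d‖ ≤ Real.exp t * (‖ψ‖ * ‖d‖) := by
        intro t
        rw [← h3 t, norm_mul, Complex.norm_exp_ofReal]
        gcongr
        refine (norm_inner_le_norm _ _).trans ?_
        rw [LinearIsometryEquiv.norm_map]
      -- The solution is y(t) = e^(-t) y(0), while y stays bounded. Letting t tend to -∞ forces y(0)
      -- = 0.
      have h6 : Filter.Tendsto (fun t : ℝ => Real.exp t * (‖ψ‖ * ‖d‖)) Filter.atBot (𝓝 0) := by
        simpa using Real.tendsto_exp_atBot.mul_const (‖ψ‖ * ‖d‖)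
      exact norm_le_zero_iff.1 (ge_of_tendsto' h6 h5)
    exact hdense.eq_zero_of_inner_left ℂ hzero
  have hv' : A ⟨v, hv⟩ ∈ (LinearMap.range B).topologicalClosure := by
    rw [hrange]
    trivial
  obtain ⟨_, ⟨d, rfl⟩, hd⟩ := Metric.mem_closure_iff.1 hv' ε hε
  refine ⟨d, d.2, ?_⟩
  have h1 := hA (Submodule.inclusion hD d - ⟨v, hv⟩)
  rw [map_sub] at h1
  rw [dist_comm, dist_eq_norm] at hd
  change ‖B d - A ⟨v, hv⟩‖ ^ 2 = ‖τ.dπₗ Z (Submodule.inclusion hD d - ⟨v, hv⟩)‖ ^ 2 + _ at h1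
  rw [map_sub] at h1
  change ‖B d - A ⟨v, hv⟩‖ ^ 2 = ‖τ.dπ Z d - τ.dπ Z v‖ ^ 2 + ‖(d : τ.V) - v‖ ^ 2 at h1
  constructor
  · exact lt_of_le_of_lt (pow_le_pow_iff_left₀ (norm_nonneg _) (norm_nonneg _) two_ne_zero |>.1
      (by nlinarith [sq_nonneg ‖τ.dπ Z d - τ.dπ Z v‖])) hd
  · exact lt_of_le_of_lt (pow_le_pow_iff_left₀ (norm_nonneg _) (norm_nonneg _) two_ne_zero |>.1
      (by nlinarith [sq_nonneg ‖(d : τ.V) - v‖])) hd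

end PreRep

end SuperLie

/-! ### Unitarity from a core, and equivalence from a dense set -/

namespace SuperLie

namespace PreRep

variable {G : SuperLieGroup.{u}} {τ : PreRep.{u, w} G}

/-- An operator on a space of smooth vectors whose square is controlled by the infinitesimal action
of `Z` is a bounded function of the vector and of its image under `Z`. -/
theorem exists_clm_of_sq_le [CompleteSpace τ.V] {B : Type*} [AddCommGroup B] [Module ℂ B]
    (ι : B →ₗ[ℂ] τ.V) (hι : ∀ b, ι b ∈ τ.smoothVectors) (A : B →ₗ[ℂ] τ.V) (Z : G.𝔤₀)
    (h : ∀ b, ‖A b‖ ^ 2 ≤ ‖τ.dπ Z (ι b)‖ * ‖ι b‖) :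
    ∃ S : WithLp 2 (τ.V × τ.V) →L[ℂ] τ.V, ∀ b, A b = S (WithLp.toLp 2 (ι b, τ.dπ Z (ι b))) := by
  let R : B →ₗ[ℂ] WithLp 2 (τ.V × τ.V) := (WithLp.linearEquiv 2 ℂ (τ.V × τ.V)).symm.toLinearMap.comp
    (ι.prod ((τ.dπₗ Z).comp (ι.codRestrict τ.smoothVectors hι)))
  refine exists_clm_eq_comp_of_bound A R ⟨1, fun d => ?_⟩
  have h1 : ‖R d‖ ^ 2 = ‖ι d‖ ^ 2 + ‖τ.dπ Z (ι d)‖ ^ 2 := WithLp.prod_norm_sq_eq_of_L2 _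
  rw [one_mul]
  refine (pow_le_pow_iff_left₀ (norm_nonneg _) (norm_nonneg _) two_ne_zero).1 ?_
  have h2 := h d
  nlinarith [sq_nonneg (‖τ.dπ Z (ι d)‖ - ‖ι d‖), sq_nonneg ‖ι d‖, sq_nonneg ‖τ.dπ Z (ι d)‖]

theorem contMDiff_clm_dπ (S : WithLp 2 (τ.V × τ.V) →L[ℂ] τ.V) {v : τ.V} (hv : v ∈ τ.smoothVectors)
    (Z : G.𝔤₀) : ContMDiff 𝓘(ℝ, G.E) 𝓘(ℝ, τ.V) ∞
      (fun g : G.G₀ => S (WithLp.toLp 2 (τ.π g v, τ.dπ Z (τ.π g v)))) := by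
  let L : τ.V × τ.V →L[ℝ] τ.V :=
    (S.comp (WithLp.prodContinuousLinearEquiv 2 ℂ τ.V τ.V).symm.toContinuousLinearMap).restrictScalars ℝ
  exact L.contDiff.contMDiff.comp ((mem_smoothVectors.1 hv).prodMk_space (contMDiff_dπ_π hv Z))

theorem contMDiff_act_repr {ι : Type*} (b : Module.Basis ι ℝ G.𝔤₁) (X : G.𝔤₁) (j : ι) :
    ContMDiff 𝓘(ℝ, G.E) 𝓘(ℝ, ℝ) ∞ (fun g : G.G₀ => b.repr (G.act g X) j) := by
  have h1 : ContMDiff 𝓘(ℝ, G.E) 𝓘(ℝ, G.𝔤₁) ∞ (fun g : G.G₀ => G.act g X) :=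
    G.contMDiff_act.comp (contMDiff_id.prodMk contMDiff_const)
  have h2 : ContDiff ℝ ∞ (b.coord j) := (b.coord j).toContinuousLinearMap.contDiff
  exact h2.contMDiff.comp h1

/-- A representation given by operators on a dense invariant space of smooth vectors, closed and
restricted to the space of all smooth vectors, is unitary. -/
theorem isUnitary_of_core [CompleteSpace τ.V] (hgr : ∀ k, (τ.gr k)ᗮ = τ.gr (k + 1))
    (hc : ∀ v, Continuous fun g => τ.π g v) (heven : ∀ g k, ∀ v ∈ τ.gr k, τ.π g v ∈ τ.gr k)
    {B : Type*} [AddCommGroup B] [Module ℂ B] (ι : B →ₗ[ℂ] τ.V) (hι : ∀ b, ι b ∈ τ.smoothVectors)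
    (hdense : DenseRange ι) (R : G.𝔤₁ →ₗ[ℝ] B →ₗ[ℂ] B)
    (hact : ∀ g b, ∃ b', ι b' = τ.π g (ι b) ∧ ∀ X, ι (R (G.act g X) b') = τ.π g (ι (R X b)))
    (hodd : ∀ k b, ∃ b', ι b' ∈ τ.gr k ∧ ι b - ι b' ∈ τ.gr (k + 1) ∧ ∀ X, ι (R X b') ∈ τ.gr (k + 1))
    (hsymm : ∀ X b b', inner ℂ (ι (R X b)) (ι b') = inner ℂ (ι b) (ι (R X b')))
    (hsq : ∀ X b, ι (R X (R X b)) = -(Complex.I / 2) • τ.dπ (G.br X X) (ι b))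
    (Γ : G.𝔤₁ → Submodule ℂ (τ.V × τ.V))
    (hΓ : ∀ X p, p ∈ Γ X ↔ ∃ b, p = (ι b, ι (R X b)))
    (hρ : ∀ X, τ.ρ X =
      ((Γ X).topologicalClosure ⊓ τ.smoothVectors.prod ⊤).toLinearPMap) : τ.IsUnitary := by
  -- the closure is contained in the adjoint
  have hadj : ∀ X (p : τ.V × τ.V), p ∈ (Γ X).topologicalClosure → ∀ d : B,
      inner ℂ p.2 (ι d) = inner ℂ p.1 (ι (R X d)) := by
    intro X p hp d
    have hcl : IsClosed {p : τ.V × τ.V | inner ℂ p.2 (ι d) = inner ℂ p.1 (ι (R X d))} :=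
      isClosed_eq (by fun_prop) (by fun_prop)
    refine closure_minimal ?_ hcl hp
    intro q hq
    obtain ⟨e, rfl⟩ := (hΓ X q).1 hq
    exact hsymm X e d
  have huniq : ∀ {a a' : τ.V}, (∀ d : B, inner ℂ a (ι d) = inner ℂ a' (ι d)) → a = a' :=
    fun h => hdense.eq_of_inner_left ℂ h
  -- the operators on the space of smooth vectors
  have hS : ∀ X, ∃ S : WithLp 2 (τ.V × τ.V) →L[ℂ] τ.V, ∀ v ∈ τ.smoothVectors,
      (v, S (WithLp.toLp 2 (v, τ.dπ (G.br X X) v))) ∈ (Γ X).topologicalClosure := by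
    intro X
    -- Symmetry and the square formula give ‖R(X)d‖² = ½ |⟨d, dπ([X,X])d⟩| on the core.
    obtain ⟨S, hS⟩ := exists_clm_of_sq_le ι hι (ι.comp (R X)) (G.br X X) (fun d => by
      change ‖ι (R X d)‖ ^ 2 ≤ _
      have h1 : ‖ι (R X d)‖ ^ 2 = ‖inner ℂ (ι d) (ι (R X (R X d)))‖ := by
        rw [← hsymm, inner_self_eq_norm_sq_to_K]
        simp
      rw [h1, hsq]
      refine (norm_inner_le_norm _ _).trans ?_
      rw [norm_smul]
      have h2 : ‖(-(Complex.I / 2))‖ = 1 / 2 := by simp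
      rw [h2]
      nlinarith [mul_nonneg (norm_nonneg (ι d)) (norm_nonneg (τ.dπ (G.br X X) (ι d)))])
    refine ⟨S, fun v hv => ?_⟩
    -- Because the core approximates v together with dπ([X,X])v, the continuous map F carries this
    -- approximation to one of (v, S(v, dπ([X,X])v)) by elements of Γ(X).
    let F : τ.V × τ.V → τ.V × τ.V := fun p => (p.1, S (WithLp.toLp 2 p))
    have hF : Continuous F := by fun_prop
    have h1 : (v, τ.dπ (G.br X X) v) ∈
        closure (Set.range fun d : B => (ι d, τ.dπ (G.br X X) (ι d))) := by
      rw [Metric.mem_closure_iff]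
      intro ε hε
      obtain ⟨_, ⟨d, rfl⟩, h2, h3⟩ := exists_mem_approx hc (D := LinearMap.range ι)
        (by rintro _ ⟨b, rfl⟩; exact hι b) hdense
        (by
          rintro g _ ⟨b, rfl⟩
          obtain ⟨b', hb', -⟩ := hact g b
          exact ⟨b', hb'⟩) (G.br X X) hv hε
      refine ⟨_, ⟨d, rfl⟩, ?_⟩
      rw [dist_comm, Prod.dist_eq, dist_eq_norm, dist_eq_norm]
      exact max_lt h2 h3
    have h2 := image_closure_subset_closure_image hF (Set.mem_image_of_mem F h1)
    refine closure_mono ?_ h2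
    rintro _ ⟨_, ⟨d, rfl⟩, rfl⟩
    refine (hΓ X _).2 ⟨d, ?_⟩
    simp only [F, Prod.mk.injEq, true_and]
    exact (hS d).symm
  choose S hS using hS
  set op : G.𝔤₁ → τ.V → τ.V := fun X v => S X (WithLp.toLp 2 (v, τ.dπ (G.br X X) v)) with hop
  -- Paired with core vectors, `op X` is the adjoint of R(X). The algebraic properties of `op` are
  -- thereby reduced to identities on the core.
  have hweak : ∀ X, ∀ v ∈ τ.smoothVectors, ∀ d : B,
      inner ℂ (op X v) (ι d) = inner ℂ v (ι (R X d)) := fun X v hv d => hadj X _ (hS X v hv) d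
  have hgraph : ∀ X v a, (v, a) ∈ (τ.ρ X).graph ↔ v ∈ τ.smoothVectors ∧ a = op X v := by
    intro X v a
    rw [hρ, Submodule.toLinearPMap_graph_eq]
    · constructor
      · rintro ⟨h1, h2, -⟩
        exact ⟨h2, huniq fun d => (hadj X _ h1 d).trans (hweak X v h2 d).symm⟩
      · rintro ⟨h1, rfl⟩
        exact ⟨hS X v h1, h1, trivial⟩
    · rintro ⟨x, y⟩ ⟨h1, -⟩ hx
      refine huniq fun d => ?_
      have h2 := hadj X _ h1 d
      simp only at hx h2
      rw [h2, hx]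
      simp
  have hdom : ∀ X, (τ.ρ X).domain = τ.smoothVectors := by
    intro X
    ext v
    constructor
    · intro hv
      exact ((hgraph X v _).1 ((τ.ρ X).mem_graph ⟨v, hv⟩)).1
    · intro hv
      exact LinearPMap.mem_domain_of_mem_graph ((hgraph X v _).2 ⟨hv, rfl⟩)
  have happ : ∀ X (v : (τ.ρ X).domain), τ.ρ X v = op X v := fun X v =>
    ((hgraph X v _).1 ((τ.ρ X).mem_graph v)).2
  have hπop : ∀ g X, ∀ v ∈ τ.smoothVectors, ∀ d : B,
      inner ℂ (τ.π g (op X v)) (ι d) = inner ℂ (τ.π g v) (ι (R (G.act g X) d)) := by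
    intro g X v hv d
    obtain ⟨b, hb, hb'⟩ := hact g⁻¹ d
    rw [inner_π_left, ← hb, hweak X v hv, inner_π_left, ← hb', ← Module.End.mul_apply, ← map_mul,
      inv_mul_cancel, map_one, Module.End.one_apply]
  have hsmooth : ∀ X, ∀ v ∈ τ.smoothVectors, op X v ∈ τ.smoothVectors := by
    intro X v hv
    let b := Module.finBasis ℝ G.𝔤₁
    rw [mem_smoothVectors]
    -- This is π(g) ρ(X) v = ρ(g·X) π(g) v with g·X expanded in a basis. The coefficients are smooth
    -- in g, and each term is a bounded operator applied to (π(g)v, dπ(Z)π(g)v), where Z is the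
    -- bracket of the basis vector with itself.
    have h1 : ∀ g, τ.π g (op X v) = ∑ j, b.repr (G.act g X) j • op (b j) (τ.π g v) := by
      intro g
      refine huniq fun d => ?_
      rw [hπop g X v hv]
      conv_lhs => rw [← b.sum_repr (G.act g X)]
      simp only [map_sum, map_smul, LinearMap.sum_apply, LinearMap.smul_apply,
        LinearMap.map_smul_of_tower, inner_sum, sum_inner]
      refine Finset.sum_congr rfl fun j _ => ?_
      rw [inner_smul_left_eq_smul, inner_smul_right_eq_smul,
        hweak _ _ (π_mem_smoothVectors hv g)]
    simp only [h1]
    refine contMDiff_finsetSum fun j _ => ?_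
    exact (contMDiff_act_repr b X j).smul (contMDiff_clm_dπ (S (b j)) hv _)
  refine ⟨‹_›, hgr, hc, heven, hdom, ?_, ?_, ?_, ?_, ?_, ?_, ?_⟩
  · intro X v
    rw [happ]
    exact hsmooth X v (by rw [← hdom X]; exact v.2)
  · intro X Y
    refine LinearPMap.ext (by rw [LinearPMap.add_domain, hdom, hdom, hdom, inf_idem]) ?_
    intro v hv hv'
    have hv0 : v ∈ τ.smoothVectors := by rwa [hdom] at hv
    rw [happ]
    change _ = τ.ρ X ⟨v, hv'.1⟩ + τ.ρ Y ⟨v, hv'.2⟩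
    rw [happ, happ]
    refine huniq fun d => ?_
    rw [hweak _ _ hv0, inner_add_left, hweak _ _ hv0, hweak _ _ hv0, map_add, LinearMap.add_apply,
      map_add, inner_add_right]
  · intro c X
    refine LinearPMap.ext (by rw [LinearPMap.smul_domain, hdom, hdom]) ?_
    intro v hv hv'
    have hv0 : v ∈ τ.smoothVectors := by rwa [hdom] at hv
    rw [happ]
    change _ = (c : ℂ) • τ.ρ X ⟨v, hv'⟩
    rw [happ]
    refine huniq fun d => ?_
    rw [hweak _ _ hv0, inner_smul_left, hweak _ _ hv0, map_smul, LinearMap.smul_apply,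
      LinearMap.map_smul_of_tower, inner_smul_right_eq_smul]
    simp
  · intro X k v hv
    have hv0 : (v : τ.V) ∈ τ.smoothVectors := by rw [← hdom X]; exact v.2
    rw [happ, ← hgr k, Submodule.mem_orthogonal']
    intro z hz
    -- For z of degree k, replacing an approximating core vector by its part of degree k cannot
    -- increase the distance to z, the discarded part being orthogonal to the remainder.
    have hz' : z ∈ closure {y | ∃ b, ι b = y ∧ ∀ X, ι (R X b) ∈ τ.gr (k + 1)} := by
      rw [Metric.mem_closure_iff]
      intro ε hε
      obtain ⟨_, ⟨d, rfl⟩, hdε⟩ := Metric.mem_closure_iff.1 (hdense z) ε hε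
      obtain ⟨d', hk, hk', hd'⟩ := hodd k d
      refine ⟨ι d', ⟨d', rfl, hd'⟩, lt_of_le_of_lt ?_ hdε⟩
      rw [dist_eq_norm, dist_eq_norm]
      refine (pow_le_pow_iff_left₀ (norm_nonneg _) (norm_nonneg _) two_ne_zero).1 ?_
      have h1 : z - ι d = (z - ι d') - (ι d - ι d') := by abel
      rw [← hgr k] at hk'
      have h2 : inner ℂ (z - ι d') (ι d - ι d') = 0 :=
        Submodule.mem_orthogonal _ _ |>.1 hk' _ (Submodule.sub_mem _ hz hk)
      rw [h1, @norm_sub_sq ℂ _ _ _ _ (z - ι d') (ι d - ι d'), h2]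
      simp
    have hcl : IsClosed {z : τ.V | inner ℂ (op X v) z = 0} :=
      isClosed_eq (by fun_prop) (by fun_prop)
    refine closure_minimal ?_ hcl hz'
    rintro _ ⟨d, rfl, hd⟩
    have h1 := hweak X v hv0 d
    have h2 := hd X
    rw [← hgr k] at h2
    exact h1.trans (Submodule.mem_orthogonal _ _ |>.1 h2 _ hv)
  · intro X v v'
    have hv : (v : τ.V) ∈ τ.smoothVectors := by rw [← hdom X]; exact v.2
    have hv' : (v' : τ.V) ∈ τ.smoothVectors := by rw [← hdom X]; exact v'.2
    rw [happ, happ]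
    have hcl : IsClosed {p : τ.V × τ.V | inner ℂ (op X v) p.1 = inner ℂ (v : τ.V) p.2} :=
      isClosed_eq (by fun_prop) (by fun_prop)
    refine closure_minimal ?_ hcl (hS X v' hv')
    intro q hq
    obtain ⟨e, rfl⟩ := (hΓ X q).1 hq
    exact hweak X v hv e
  · intro X Y v hv a b a' b' ha ha' hb hb'
    obtain ⟨-, rfl⟩ := (hgraph _ _ _).1 ha
    obtain ⟨h1, rfl⟩ := (hgraph _ _ _).1 ha'
    obtain ⟨-, rfl⟩ := (hgraph _ _ _).1 hb
    obtain ⟨h2, rfl⟩ := (hgraph _ _ _).1 hb'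
    refine huniq fun d => ?_
    -- Polarization of the square formula, through its instance at X + Y.
    have h3 : ι (R Y (R X d)) + ι (R X (R Y d)) = -Complex.I • τ.dπ (G.br X Y) (ι d) := by
      have h4 := hsq (X + Y) d
      simp only [map_add, LinearMap.add_apply, hsq, dπ_add_left, smul_add,
        G.br_symm Y X] at h4
      have h5 : -(Complex.I / 2) • τ.dπ (G.br X Y) (ι d) +
          -(Complex.I / 2) • τ.dπ (G.br X Y) (ι d) = -Complex.I • τ.dπ (G.br X Y) (ι d) := by
        rw [← add_smul]
        congr 1
        ring
      rw [← h5]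
      have h6 := sub_eq_zero.2 h4
      rw [← sub_eq_zero, ← h6]
      abel
    rw [inner_add_left, hweak _ _ h1, hweak _ _ hv, hweak _ _ h2, hweak _ _ hv, ← inner_add_right,
      h3, inner_smul_right, inner_smul_left, inner_dπ_left hv (hι d)]
    simp
  · intro g X v a
    rw [hgraph, hgraph]
    have h1 : ∀ v ∈ τ.smoothVectors, op (G.act g X) v = τ.π g (op X (τ.π g⁻¹ v)) := by
      intro v hv
      refine huniq fun d => ?_
      rw [hπop g X _ (π_mem_smoothVectors hv _), π_π_inv, hweak _ _ hv]
    constructor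
    · rintro ⟨hv, rfl⟩
      exact ⟨π_mem_smoothVectors hv _, by rw [h1 v hv, π_inv_π]⟩
    · rintro ⟨hv, ha⟩
      have hv' := π_mem_smoothVectors hv g
      rw [π_π_inv] at hv'
      exact ⟨hv', by rw [h1 v hv', ← ha, π_π_inv]⟩

/-- An even isometry that intertwines the actions of the even group is a unitary equivalence as soon
as it intertwines the odd operators on a dense set. -/
theorem unitarilyEquivalent_of_dense {σ : PreRep.{u, w} G} {τ : PreRep.{u, w'} G} (hσ : σ.IsUnitary)
    (hτ : τ.IsUnitary) (T : σ.V ≃ₗᵢ[ℂ] τ.V) (heven : ∀ k, ∀ v ∈ σ.gr k, T v ∈ τ.gr k)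
    (hπ : ∀ g v, T (σ.π g v) = τ.π g (T v)) {B : Set σ.V} (hB : Dense B)
    (hρ : ∀ X, ∀ b ∈ B, ∃ a, (b, a) ∈ (σ.ρ X).graph ∧ (T b, T a) ∈ (τ.ρ X).graph) :
    σ.UnitarilyEquivalent τ := by
  have hT : ContDiff ℝ ∞ T := (T.toContinuousLinearEquiv.toContinuousLinearMap.restrictScalars ℝ).contDiff
  have hT' : ContDiff ℝ ∞ T.symm :=
    (T.symm.toContinuousLinearEquiv.toContinuousLinearMap.restrictScalars ℝ).contDiff
  have hsm : ∀ v, v ∈ σ.smoothVectors ↔ T v ∈ τ.smoothVectors := by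
    intro v
    rw [mem_smoothVectors, mem_smoothVectors]
    simp only [← hπ]
    refine ⟨fun h => hT.contMDiff.comp h, fun h => (hT'.contMDiff.comp h).congr fun g => ?_⟩
    simp
  have hBT : Dense (T '' B) := T.surjective.denseRange.dense_image T.continuous hB
  have key : ∀ X v a, (v, a) ∈ (σ.ρ X).graph → (T v, T a) ∈ (τ.ρ X).graph := by
    intro X v a hva
    have hv : T v ∈ (τ.ρ X).domain := by
      rw [hτ.ρ_domain, ← hsm, ← hσ.ρ_domain X]
      exact LinearPMap.mem_domain_of_mem_graph hva
    -- Both odd operators are symmetric and correspond under T on B, so both sides have the same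
    -- inner products with the dense set T(B).
    have h1 : τ.ρ X ⟨T v, hv⟩ = T a := by
      refine hBT.eq_of_inner_left ℂ ?_
      rintro _ ⟨b, hb, rfl⟩
      obtain ⟨c, hc, hc'⟩ := hρ X b hb
      obtain ⟨⟨b₁, hb₁⟩, rfl, rfl⟩ := (LinearPMap.mem_graph_iff _).1 hc
      obtain ⟨⟨v₁, hv₁⟩, rfl, rfl⟩ := (LinearPMap.mem_graph_iff _).1 hva
      obtain ⟨⟨b₂, hb₂⟩, hb₃, hb₄⟩ := (LinearPMap.mem_graph_iff _).1 hc'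
      simp only at hb₃ hb₄ ⊢
      subst hb₃
      have h2 := hτ.ρ_symm X ⟨T v₁, hv⟩ ⟨T b₁, hb₂⟩
      have h3 := hσ.ρ_symm X ⟨v₁, hv₁⟩ ⟨b₁, hb₁⟩
      rw [hb₄] at h2
      simp only [LinearIsometryEquiv.inner_map_map] at h2 ⊢
      rw [h2, h3]
    rw [← h1]
    exact (τ.ρ X).mem_graph ⟨T v, hv⟩
  refine ⟨T, heven, hπ, fun X v a => ⟨key X v a, fun h => ?_⟩⟩
  have hv : v ∈ (σ.ρ X).domain := by
    rw [hσ.ρ_domain, hsm, ← hτ.ρ_domain X]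
    exact LinearPMap.mem_domain_of_mem_graph h
  have h1 := (σ.ρ X).mem_graph ⟨v, hv⟩
  have h2 := LinearPMap.mem_graph_snd_inj _ (key X _ _ h1) h rfl
  rwa [← T.injective h2]

end PreRep

end SuperLie

/-! ### Invariant measures on the group and on its coset spaces -/

namespace SuperLie

instance (G : SuperLieGroup.{u}) : LocallyCompactSpace G.G₀ :=
  Manifold.locallyCompact_of_finiteDimensional 𝓘(ℝ, G.E)

/-- Two nonzero right invariant measures agree up to a scalar. -/
theorem exists_eq_smul_of_isMulRightInvariant {G : SuperLieGroup.{u}} (M M' : Measure G.G₀)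
    [M.IsMulRightInvariant] [M'.IsMulRightInvariant] [IsFiniteMeasureOnCompacts M]
    [IsFiniteMeasureOnCompacts M'] (hM : M ≠ 0) (hM' : M' ≠ 0) :
    ∃ c : ℝ≥0∞, c ≠ 0 ∧ c ≠ ⊤ ∧ M' = c • M := by
  -- Inversion exchanges right and left invariant measures and preserves finiteness on compact sets,
  -- so uniqueness of left Haar measure applies.
  have hfin : ∀ N : Measure G.G₀, IsFiniteMeasureOnCompacts N → IsFiniteMeasureOnCompacts N.inv := by
    intro N hN
    refine ⟨fun C hC => ?_⟩
    rw [Measure.inv_apply]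
    exact hC.inv.measure_lt_top
  have := hfin M inferInstance
  have := hfin M' inferInstance
  have hne : M.inv ≠ 0 := fun h => hM (by rw [← Measure.inv_inv M, h]; simp [Measure.inv])
  have : NeZero M.inv := ⟨hne⟩
  have : M.inv.IsHaarMeasure := { }
  have h := Measure.isMulLeftInvariant_eq_smul M'.inv M.inv
  refine ⟨(Measure.haarScalarFactor M'.inv M.inv : ℝ≥0∞), ?_, ENNReal.coe_ne_top, ?_⟩
  · intro h0
    apply hM'
    rw [ENNReal.coe_eq_zero] at h0
    rw [h0, zero_smul] at h
    rw [← Measure.inv_inv M', h]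
    simp [Measure.inv]
  · have h1 := congrArg Measure.inv h
    rw [Measure.inv_inv] at h1
    refine h1.trans ?_
    ext s hs
    rw [Measure.inv_apply, Measure.smul_apply, Measure.smul_apply, Measure.inv_apply, inv_inv]
    rfl

namespace SpecialSub

variable {G H : SuperLieGroup.{u}} (i : SpecialSub H G)

/-- The projection onto the coset space. -/
abbrev proj (g : G.G₀) : i.Cosets := Quotient.mk'' g

theorem measurable_proj : Measurable i.proj := measurable_quotient_mk''

theorem continuous_proj : Continuous i.proj := continuous_quotient_mk'

theorem proj_mul (h : H.G₀) (g : G.G₀) : i.proj (i.even h * g) = i.proj g :=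
  Quotient.sound' (i.rightRel_iff.2 ⟨h⁻¹, by simp⟩)

theorem proj_out (x : i.Cosets) : i.proj x.out = x := Quotient.out_eq' x

theorem exists_out_eq (g : G.G₀) : ∃ h, (i.proj g).out = i.even h * g := by
  obtain ⟨h, hh⟩ := i.rightRel_iff.1 (Quotient.mk_out (s := QuotientGroup.rightRel _) g)
  refine ⟨h⁻¹, ?_⟩
  conv_rhs => rw [← hh]
  rw [map_inv, inv_mul_cancel_left]

theorem continuous_even : Continuous i.even := i.isClosedEmbedding_even.continuous

theorem measurable_even : Measurable i.even := i.continuous_even.measurable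

theorem isCompact_preimage_even {C : Set G.G₀} (hC : IsCompact C) : IsCompact (i.even ⁻¹' C) :=
  i.isClosedEmbedding_even.isCompact_preimage hC

/-- An invariant function on `G₀`, read off at representatives, is measurable on the coset space. -/
theorem measurable_out {β : Type*} [MeasurableSpace β] {φ : G.G₀ → β} (hφ : Measurable φ)
    (hinv : ∀ h g, φ (i.even h * g) = φ g) : Measurable fun x : i.Cosets => φ x.out := by
  rw [measurable_from_quotient]
  convert! hφ using 1
  funext g
  obtain ⟨h, hh⟩ := i.exists_out_eq g
  change φ (i.proj g).out = φ g
  rw [hh, hinv]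

theorem measure_compact_lt_top (μ : i.InvariantMeasure) {C : Set G.G₀} (hC : IsCompact C) : μ.measure (i.proj '' C) < ⊤ :=
  μ.lt_top_of_isCompact _ (hC.image i.continuous_proj)

section Weil

variable (m : Measure H.G₀)

theorem lintegral_orbit_mul [m.IsMulRightInvariant] (φ : G.G₀ → ℝ≥0∞) (h₀ : H.G₀) (g : G.G₀) :
    ∫⁻ h, φ (i.even h * (i.even h₀ * g)) ∂m = ∫⁻ h, φ (i.even h * g) ∂m := by
  rw [← lintegral_mul_right_eq_self (fun h => φ (i.even h * g)) h₀]
  simp only [map_mul, mul_assoc]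

theorem measurable_lintegral_orbit [IsFiniteMeasureOnCompacts m] {φ : G.G₀ → ℝ≥0∞} (hφ : Measurable φ) :
    Measurable fun g => ∫⁻ h, φ (i.even h * g) ∂m := by
  refine Measurable.lintegral_prod_right' (f := fun p : G.G₀ × H.G₀ => φ (i.even p.2 * p.1)) ?_
  exact hφ.comp ((i.measurable_even.comp measurable_snd).mul measurable_fst)

/-- If h₀g lies in C, then hg in C forces hh₀⁻¹ into CC⁻¹, and right invariance removes h₀. The
bound is uniform in g. -/
theorem measure_orbit_le [m.IsMulRightInvariant] (C : Set G.G₀) (g : G.G₀) :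
    m {h | i.even h * g ∈ C} ≤ m (i.even ⁻¹' (C * C⁻¹)) := by
  by_cases hne : ∃ h₀, i.even h₀ * g ∈ C
  · obtain ⟨h₀, hh₀⟩ := hne
    rw [← measure_preimage_mul_right m h₀⁻¹ (i.even ⁻¹' (C * C⁻¹))]
    refine measure_mono fun h hh => ?_
    refine ⟨i.even h * g, hh, (i.even h₀ * g)⁻¹, Set.inv_mem_inv.2 hh₀, ?_⟩
    simp [mul_assoc]
  · push Not at hne
    simp [hne]

variable [m.IsMulRightInvariant] [IsFiniteMeasureOnCompacts m] (μ : i.InvariantMeasure)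

/-- The kernel of the disintegration of a measure on `G₀` over the coset space. -/
def orbitKernel : ProbabilityTheory.Kernel i.Cosets G.G₀ where
  toFun x := m.map fun h => i.even h * x.out
  measurable' := by
    refine Measure.measurable_of_measurable_coe _ fun s hs => ?_
    have h1 : ∀ x : i.Cosets, (m.map fun h => i.even h * x.out) s =
        ∫⁻ h, s.indicator 1 (i.even h * x.out) ∂m := by
      intro x
      rw [← lintegral_indicator_one hs, lintegral_map (measurable_one.indicator hs)
        (i.measurable_even.mul_const _)]
    simp only [h1]
    exact i.measurable_out (i.measurable_lintegral_orbit m (measurable_one.indicator hs))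
      (i.lintegral_orbit_mul m _)

theorem orbitKernel_apply (x : i.Cosets) :
    i.orbitKernel m x = m.map fun h => i.even h * x.out := rfl

/-- The measure on `G₀` obtained from a right invariant measure on `H₀` and an invariant measure on
the coset space. -/
def weil : Measure G.G₀ := μ.measure.bind (i.orbitKernel m)

theorem lintegral_weil {φ : G.G₀ → ℝ≥0∞} (hφ : Measurable φ) :
    ∫⁻ g, φ g ∂(i.weil m μ) = ∫⁻ x, ∫⁻ h, φ (i.even h * x.out) ∂m ∂μ.measure := by
  rw [weil, Measure.lintegral_bind (i.orbitKernel m).measurable.aemeasurable hφ.aemeasurable]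
  refine lintegral_congr fun x => ?_
  rw [orbitKernel_apply, lintegral_map hφ (i.measurable_even.mul_const _)]

theorem integral_weil {F : Type*} [NormedAddCommGroup F] [NormedSpace ℝ F] {φ : G.G₀ → F}
    (hm : StronglyMeasurable φ) (hφ : Integrable φ (i.weil m μ)) :
    ∫ g, φ g ∂(i.weil m μ) = ∫ x, ∫ h, φ (i.even h * x.out) ∂m ∂μ.measure := by
  -- Writing the measure as a composition of kernels makes Fubini for Bochner integrals available.
  have h1 : i.weil m μ = ((i.orbitKernel m).comp (ProbabilityTheory.Kernel.const Unit μ.measure)) () := by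
    rw [ProbabilityTheory.Kernel.comp_apply]
    rfl
  rw [h1] at hφ ⊢
  rw [ProbabilityTheory.Kernel.integral_comp hφ]
  refine integral_congr_ae (.of_forall fun x => ?_)
  simp only
  rw [orbitKernel_apply, integral_map (i.measurable_even.mul_const _).aemeasurable
    hm.aestronglyMeasurable]

/-- Translation permutes the cosets preserving μ. The change of representative in each coset is an
element of H₀, absorbed by the right invariance of m. -/
instance : (i.weil m μ).IsMulRightInvariant := by
  refine ⟨fun g => ?_⟩
  refine Measure.ext_of_lintegral _ fun φ hφ => ?_
  rw [lintegral_map hφ (measurable_mul_const g), i.lintegral_weil m μ (φ := fun a => φ (a * g)) (hφ.comp (measurable_mul_const g)),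
    i.lintegral_weil m μ hφ]
  have h1 := Sect.lintegral_translate (μ := μ)
    (i.measurable_out (i.measurable_lintegral_orbit m hφ) (i.lintegral_orbit_mul m φ)) g
  rw [← h1]
  refine lintegral_congr fun x => ?_
  rw [Sect.translate_out]
  obtain ⟨h₀, hh₀⟩ := i.exists_out_eq (x.out * g)
  change _ = ∫⁻ h, φ (i.even h * (i.proj (x.out * g)).out) ∂m
  rw [hh₀, lintegral_orbit_mul]
  simp only [mul_assoc]

/-- Only cosets in the compact image of C contribute, each at most the finite mass given by
`measure_orbit_le`. -/
instance : IsFiniteMeasureOnCompacts (i.weil m μ) := by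
  refine ⟨fun C hC => ?_⟩
  rw [← lintegral_indicator_one hC.measurableSet,
    i.lintegral_weil m μ (measurable_one.indicator hC.measurableSet)]
  have hfin : m (i.even ⁻¹' (C * C⁻¹)) < ⊤ :=
    (i.isCompact_preimage_even (hC.mul hC.inv)).measure_lt_top
  refine lt_of_le_of_lt (lintegral_mono (g := (i.proj '' C).indicator
    fun _ => m (i.even ⁻¹' (C * C⁻¹))) fun x => ?_) (lt_of_le_of_lt (lintegral_indicator_const_le _ _)
      (ENNReal.mul_lt_top hfin (i.measure_compact_lt_top μ hC)))
  have h1 : ∫⁻ h, C.indicator 1 (i.even h * x.out) ∂m = m {h | i.even h * x.out ∈ C} := by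
    rw [← lintegral_indicator_one]
    · rfl
    · exact (i.measurable_even.mul_const _) hC.measurableSet
  simp only
  rw [h1]
  by_cases hx : x ∈ i.proj '' C
  · rw [Set.indicator_of_mem hx]
    exact i.measure_orbit_le m C _
  · rw [Set.indicator_of_notMem hx]
    refine le_of_eq ?_
    have : {h | i.even h * x.out ∈ C} = ∅ := by
      refine Set.eq_empty_of_forall_notMem fun h hh => hx ⟨_, hh, ?_⟩
      rw [proj_mul, proj_out]
    rw [this, measure_empty]

theorem weil_ne_zero (hm : m ≠ 0) : i.weil m μ ≠ 0 := by
  intro h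
  have h1 := i.lintegral_weil m μ (φ := fun _ => 1) measurable_const
  simp only [lintegral_const, one_mul, h] at h1
  simp only [Measure.coe_zero, Pi.zero_apply] at h1
  rcases mul_eq_zero.1 h1.symm with h2 | h2
  · exact hm (Measure.measure_univ_eq_zero.1 h2)
  · exact μ.ne_zero (Measure.measure_univ_eq_zero.1 h2)

/-- There is a function on `G₀` that integrates to `1` over every coset of `H₀`. -/
theorem exists_bruhat [m.IsOpenPosMeasure] : ∃ β : G.G₀ → ℝ≥0∞, Measurable β ∧
    ∀ g, ∫⁻ h, β (i.even h * g) ∂m = 1 := by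
  let C : CompactExhaustion G.G₀ := default
  let b : ℕ → ℝ≥0∞ := fun n => m (i.even ⁻¹' (C n * (C n)⁻¹)) + 1
  have hb : ∀ n, b n ≠ ⊤ := fun n => by
    have : m (i.even ⁻¹' (C n * (C n)⁻¹)) ≠ ⊤ :=
      (i.isCompact_preimage_even ((C.isCompact n).mul (C.isCompact n).inv)).measure_lt_top.ne
    simp [b, this]
  -- The weights bound the n-th term of an orbit integral S(g) by 2⁻ⁿ, so S is finite; it is
  -- positive since some C n is a neighbourhood of g. As S is constant on orbits, β₀/S is
  -- normalized.
  let β₀ : G.G₀ → ℝ≥0∞ := fun g => ∑' n, (2⁻¹ ^ n * (b n)⁻¹) * (C n : Set G.G₀).indicator 1 g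
  have hCm : ∀ n, MeasurableSet (C n : Set G.G₀) := fun n => (C.isCompact n).measurableSet
  have hβ₀ : Measurable β₀ :=
    Measurable.tsum fun n => (measurable_const.indicator (hCm n)).const_mul _
  let S : G.G₀ → ℝ≥0∞ := fun g => ∫⁻ h, β₀ (i.even h * g) ∂m
  have hS : ∀ g, S g = ∑' n, (2⁻¹ ^ n * (b n)⁻¹) * m {h | i.even h * g ∈ C n} := by
    intro g
    have hmeas : ∀ n, Measurable fun h : H.G₀ => (C n : Set G.G₀).indicator (1 : G.G₀ → ℝ≥0∞) (i.even h * g) :=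
      fun n => (measurable_const.indicator (hCm n)).comp (i.measurable_even.mul_const _)
    simp only [S, β₀]
    rw [lintegral_tsum fun n => ((hmeas n).const_mul _).aemeasurable]
    refine tsum_congr fun n => ?_
    rw [lintegral_const_mul _ (hmeas n), ← lintegral_indicator_one]
    · rfl
    · exact (i.measurable_even.mul_const _) (hCm n)
  have hS_top : ∀ g, S g ≠ ⊤ := by
    intro g
    rw [hS]
    have h2 : ∑' n : ℕ, (2⁻¹ : ℝ≥0∞) ^ n ≠ ⊤ := by
      rw [ENNReal.tsum_geometric]
      simp
    refine ne_top_of_le_ne_top h2 (ENNReal.tsum_le_tsum fun n => ?_)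
    rw [mul_assoc]
    refine mul_le_of_le_one_right' ?_
    rw [mul_comm]
    refine ENNReal.div_le_of_le_mul ?_
    rw [one_mul]
    exact (i.measure_orbit_le m _ g).trans le_self_add
  have hS_zero : ∀ g, S g ≠ 0 := by
    intro g
    rw [hS]
    obtain ⟨n, hn⟩ := C.exists_mem_nhds g
    have hpos : 0 < m {h | i.even h * g ∈ C n} := by
      refine Measure.measure_pos_of_mem_nhds m (x := 1) ?_
      have : ContinuousAt (fun h => i.even h * g) 1 := (i.continuous_even.mul continuous_const).continuousAt
      refine this ?_
      simpa using hn
    intro h0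
    rw [ENNReal.tsum_eq_zero] at h0
    have h1 := h0 n
    simp [hpos.ne', hb n] at h1
  refine ⟨fun g => β₀ g / S g, hβ₀.div (i.measurable_lintegral_orbit m hβ₀), fun g => ?_⟩
  have hSinv : ∀ h, S (i.even h * g) = S g := fun h => i.lintegral_orbit_mul m β₀ h g
  simp only [hSinv, div_eq_mul_inv]
  rw [lintegral_mul_const (f := fun h => β₀ (i.even h * g)) _
    (hβ₀.comp (i.measurable_even.mul_const _))]
  exact ENNReal.mul_inv_cancel (hS_zero g) (hS_top g)

/-- The integral of an invariant function over the coset space, as an integral over `G₀`. -/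
theorem lintegral_weil_bruhat {β : G.G₀ → ℝ≥0∞} (hβ : Measurable β)
    (hβ1 : ∀ g, ∫⁻ h, β (i.even h * g) ∂m = 1) {φ : G.G₀ → ℝ≥0∞} (hφ : Measurable φ)
    (hinv : ∀ h g, φ (i.even h * g) = φ g) :
    ∫⁻ g, φ g * β g ∂(i.weil m μ) = ∫⁻ x, φ x.out ∂μ.measure := by
  rw [i.lintegral_weil m μ (φ := fun g => φ g * β g) (hφ.mul hβ)]
  refine lintegral_congr fun x => ?_
  simp only [hinv]
  rw [lintegral_const_mul (f := fun h => β (i.even h * x.out)) _ (hβ.comp (i.measurable_even.mul_const _)), hβ1, mul_one]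

end Weil

instance (μ : i.InvariantMeasure) : SigmaFinite μ.measure := by
  refine ⟨⟨{ set := fun n => i.proj '' (compactCovering G.G₀ n)
             set_mem := fun _ => trivial
             finite := fun n => i.measure_compact_lt_top μ (isCompact_compactCovering _ n)
             spanning := ?_ }⟩⟩
  rw [← Set.image_iUnion, iUnion_compactCovering, Set.image_univ, Set.range_eq_univ]
  exact Quotient.mk''_surjective

end SpecialSub

end SuperLie

/-! ### Odd operators and homogeneous projections of a unitary representation -/

namespace SuperLie

namespace PreRep

variable {G : SuperLieGroup.{u}} {σ : PreRep.{u, w} G}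

/-- The odd operators of a unitary representation, as endomorphisms of the space of smooth
vectors. -/
def oddOp (hσ : σ.IsUnitary) : G.𝔤₁ →ₗ[ℝ] σ.smoothVectors →ₗ[ℂ] σ.smoothVectors where
  toFun X :=
    { toFun := fun v => ⟨σ.ρ X ⟨v, (hσ.ρ_domain X).ge v.2⟩, hσ.ρ_mem X _⟩
      map_add' := fun v v' => Subtype.ext ((σ.ρ X).map_add ⟨v, _⟩ ⟨v', _⟩)
      map_smul' := fun c v => Subtype.ext ((σ.ρ X).map_smul c ⟨v, _⟩) }
  map_add' X Y := by
    ext v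
    have h := hσ.ρ_add X Y
    have h1 := (LinearPMap.dExt_iff.1 h).2 (x := ⟨v, (hσ.ρ_domain _).ge v.2⟩)
      (y := ⟨v, (hσ.ρ_domain _).ge v.2, (hσ.ρ_domain _).ge v.2⟩) rfl
    exact h1
  map_smul' c X := by
    ext v
    have h := hσ.ρ_smul c X
    have h1 := (LinearPMap.dExt_iff.1 h).2 (x := ⟨v, (hσ.ρ_domain _).ge v.2⟩)
      (y := ⟨v, (hσ.ρ_domain _).ge v.2⟩) rfl
    exact h1

theorem mem_graph_iff_oddOp (hσ : σ.IsUnitary) (X : G.𝔤₁) (v a : σ.V) :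
    (v, a) ∈ (σ.ρ X).graph ↔ ∃ h : v ∈ σ.smoothVectors, (oddOp hσ X ⟨v, h⟩ : σ.V) = a := by
  rw [LinearPMap.mem_graph_iff]
  constructor
  · rintro ⟨⟨y, hy⟩, rfl, rfl⟩
    exact ⟨(hσ.ρ_domain X).le hy, rfl⟩
  · rintro ⟨h, rfl⟩
    exact ⟨⟨v, (hσ.ρ_domain X).ge h⟩, rfl, rfl⟩

theorem oddOp_π (hσ : σ.IsUnitary) (g : G.G₀) (X : G.𝔤₁) (v v' : σ.smoothVectors)
    (hv : (v' : σ.V) = σ.π g v) : (oddOp hσ (G.act g X) v' : σ.V) = σ.π g (oddOp hσ X v) := by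
  have h1 : ((v' : σ.V), σ.π g (oddOp hσ X v)) ∈ (σ.ρ (G.act g X)).graph := by
    rw [hσ.ρ_act, hv, π_inv_π, π_inv_π, mem_graph_iff_oddOp hσ]
    exact ⟨v.2, rfl⟩
  exact ((mem_graph_iff_oddOp hσ _ _ _).1 h1).2

theorem oddOp_oddOp (hσ : σ.IsUnitary) (X : G.𝔤₁) (v : σ.smoothVectors) :
    (oddOp hσ X (oddOp hσ X v) : σ.V) = -(Complex.I / 2) • σ.dπ (G.br X X) v := by
  have h1 : ((v : σ.V), (oddOp hσ X v : σ.V)) ∈ (σ.ρ X).graph :=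
    (mem_graph_iff_oddOp hσ _ _ _).2 ⟨v.2, rfl⟩
  have h2 : ((oddOp hσ X v : σ.V), (oddOp hσ X (oddOp hσ X v) : σ.V)) ∈ (σ.ρ X).graph :=
    (mem_graph_iff_oddOp hσ _ _ _).2 ⟨(oddOp hσ X v).2, rfl⟩
  have h3 := hσ.ρ_comm X X v v.2 _ _ _ _ h1 h2 h1 h2
  rw [← two_smul ℂ] at h3
  have h4 := congrArg (fun x => (2⁻¹ : ℂ) • x) h3
  simp only [smul_smul] at h4
  rw [inv_mul_cancel₀ two_ne_zero, one_smul] at h4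
  rw [h4]
  congr 1
  ring

theorem inner_oddOp_left (hσ : σ.IsUnitary) (X : G.𝔤₁) (v v' : σ.smoothVectors) :
    inner ℂ (oddOp hσ X v : σ.V) (v' : σ.V) = inner ℂ (v : σ.V) (oddOp hσ X v' : σ.V) :=
  hσ.ρ_symm X ⟨v, _⟩ ⟨v', _⟩

theorem oddOp_mem_gr (hσ : σ.IsUnitary) (X : G.𝔤₁) (k : ZMod 2) (v : σ.smoothVectors)
    (hv : (v : σ.V) ∈ σ.gr k) : (oddOp hσ X v : σ.V) ∈ σ.gr (k + 1) :=
  hσ.ρ_odd X k ⟨v, _⟩ hv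

/-- Symmetry together with ρ(X)² = -(i/2) dπ([X,X]) gives the required bound. It is what lets the
unbounded operator ρ(X) be applied to smooth functions without losing smoothness. -/
theorem exists_clm_oddOp (hσ : σ.IsUnitary) (X : G.𝔤₁) :
    ∃ S : WithLp 2 (σ.V × σ.V) →L[ℂ] σ.V, ∀ v : σ.smoothVectors,
      (oddOp hσ X v : σ.V) = S (WithLp.toLp 2 ((v : σ.V), σ.dπ (G.br X X) v)) := by
  have := hσ.complete
  refine exists_clm_of_sq_le σ.smoothVectors.subtype (fun v => v.2)
    (σ.smoothVectors.subtype.comp (oddOp hσ X)) (G.br X X) fun v => ?_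
  change ‖(oddOp hσ X v : σ.V)‖ ^ 2 ≤ ‖σ.dπ (G.br X X) v‖ * ‖(v : σ.V)‖
  have h1 : ‖(oddOp hσ X v : σ.V)‖ ^ 2 =
      ‖inner ℂ (v : σ.V) (oddOp hσ X (oddOp hσ X v) : σ.V)‖ := by
    rw [← inner_oddOp_left, inner_self_eq_norm_sq_to_K]
    simp
  rw [h1, oddOp_oddOp]
  refine (norm_inner_le_norm _ _).trans ?_
  rw [norm_smul]
  have h2 : ‖(-(Complex.I / 2))‖ = 1 / 2 := by simp
  rw [h2]
  nlinarith [mul_nonneg (norm_nonneg (v : σ.V)) (norm_nonneg (σ.dπ (G.br X X) (v : σ.V)))]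

theorem hasOrthogonalProjection_gr (hσ : σ.IsUnitary) (k : ZMod 2) :
    (σ.gr k).HasOrthogonalProjection := by
  have := hσ.complete
  have h1 : IsClosed (σ.gr k : Set σ.V) := by
    have h2 := hσ.gr_orthogonal (k + 1)
    have h3 : k + 1 + 1 = k := by
      rw [add_assoc, CharTwo.add_self_eq_zero, add_zero]
    rw [h3] at h2
    rw [← h2]
    exact Submodule.isClosed_orthogonal _
  have : CompleteSpace (σ.gr k) := h1.completeSpace_coe
  infer_instance

/-- The projection onto the homogeneous part of degree `k`. -/
def grProj (hσ : σ.IsUnitary) (k : ZMod 2) : σ.V →L[ℂ] σ.V :=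
  haveI := hasOrthogonalProjection_gr hσ k
  (σ.gr k).starProjection

theorem grProj_mem (hσ : σ.IsUnitary) (k : ZMod 2) (v : σ.V) : grProj hσ k v ∈ σ.gr k :=
  haveI := hasOrthogonalProjection_gr hσ k
  Submodule.starProjection_apply_mem _ _

theorem sub_grProj_mem (hσ : σ.IsUnitary) (k : ZMod 2) (v : σ.V) :
    v - grProj hσ k v ∈ σ.gr (k + 1) := by
  have := hasOrthogonalProjection_gr hσ k
  rw [← hσ.gr_orthogonal]
  exact Submodule.sub_starProjection_mem_orthogonal _

theorem grProj_eq (hσ : σ.IsUnitary) {k : ZMod 2} {v v' : σ.V} (hv' : v' ∈ σ.gr k)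
    (h : v - v' ∈ σ.gr (k + 1)) : grProj hσ k v = v' := by
  have := hasOrthogonalProjection_gr hσ k
  exact Submodule.eq_starProjection_of_mem_orthogonal hv' (by rw [hσ.gr_orthogonal]; exact h)

theorem grProj_π (hσ : σ.IsUnitary) (k : ZMod 2) (g : G.G₀) (v : σ.V) :
    grProj hσ k (σ.π g v) = σ.π g (grProj hσ k v) :=
  grProj_eq hσ (hσ.π_even g k _ (grProj_mem hσ k v))
    (by rw [← map_sub]; exact hσ.π_even g _ _ (sub_grProj_mem hσ k v))

theorem norm_grProj_le (hσ : σ.IsUnitary) (k : ZMod 2) (v : σ.V) : ‖grProj hσ k v‖ ≤ ‖v‖ :=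
  haveI := hasOrthogonalProjection_gr hσ k
  Submodule.norm_starProjection_apply_le _ _

theorem inner_grProj (hσ : σ.IsUnitary) (k : ZMod 2) (v : σ.V) :
    inner ℂ (grProj hσ k v) v = inner ℂ (grProj hσ k v) (grProj hσ k v) := by
  have h := sub_grProj_mem hσ k v
  rw [← hσ.gr_orthogonal, Submodule.mem_orthogonal] at h
  have h1 := h _ (grProj_mem hσ k v)
  rwa [inner_sub_right, sub_eq_zero] at h1

end PreRep

end SuperLie

/-! ### Completeness and grading of the induced Hilbert space -/

namespace SuperLie

namespace SpecialSub

variable {G H : SuperLieGroup.{u}} {i : SpecialSub H G}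

/-- If `H₀` is unimodular, an invariant measure on the coset space is the image of a measure
on `G₀`. -/
theorem exists_map_proj_eq (hH : H.IsUnimodular) (μ : i.InvariantMeasure) :
    ∃ ν : Measure G.G₀, SigmaFinite ν ∧ ν.map i.proj = μ.measure := by
  have : (Measure.haar : Measure H.G₀).IsMulRightInvariant := hH _ inferInstance
  obtain ⟨β, hβ, hβ1⟩ := i.exists_bruhat (Measure.haar : Measure H.G₀)
  -- The Weil measure, weighted by a function of integral 1 over each coset, projects to μ. Square
  -- integrability over the cosets becomes an L² condition on G₀ itself.
  have key : ((i.weil Measure.haar μ).withDensity β).map i.proj = μ.measure := by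
    ext s hs
    have hs' := i.measurable_proj hs
    rw [Measure.map_apply i.measurable_proj hs, withDensity_apply _ hs',
      ← lintegral_indicator hs', ← lintegral_indicator_one hs]
    have h := i.lintegral_weil_bruhat Measure.haar μ hβ hβ1 (φ := (i.proj ⁻¹' s).indicator 1)
      (measurable_one.indicator hs') fun h g => by
        change s.indicator (1 : i.Cosets → ℝ≥0∞) (i.proj (i.even h * g)) =
          s.indicator (1 : i.Cosets → ℝ≥0∞) (i.proj g)
        rw [proj_mul]
    rw [show (fun x : i.Cosets => (i.proj ⁻¹' s).indicator (1 : G.G₀ → ℝ≥0∞) x.out) =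
      s.indicator 1 from funext fun x => by
        change s.indicator (1 : i.Cosets → ℝ≥0∞) (i.proj x.out) = _
        rw [proj_out]] at h
    rw [← h]
    refine lintegral_congr fun g => ?_
    by_cases hg : g ∈ i.proj ⁻¹' s <;> simp [hg]
  refine ⟨_, ?_, key⟩
  refine SigmaFinite.of_map _ i.measurable_proj.aemeasurable ?_
  rw [key]
  infer_instance

namespace Sect

variable {μ : i.InvariantMeasure} {σ : PreRep.{u, w} H}

theorem _root_.SuperLie.SpecialSub.IsEquivariant.lintegral_enorm_out {f : G.G₀ → σ.V}
    (hf : i.IsEquivariant σ f) (hm : StronglyMeasurable f) {ν : Measure G.G₀}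
    (hν : ν.map i.proj = μ.measure) :
    ∫⁻ x : i.Cosets, ‖f x.out‖ₑ ^ 2 ∂μ.measure = ∫⁻ g, ‖f g‖ₑ ^ 2 ∂ν := by
  rw [← hν, lintegral_map ((hf.measurable_enorm hm).pow_const 2) i.measurable_proj]
  exact lintegral_congr fun g => by rw [hf.enorm_out]

theorem enorm_sq (f : i.Sect μ σ) : ‖f‖ₑ ^ 2 = ∫⁻ x : i.Cosets, ‖f x.out‖ₑ ^ 2 ∂μ.measure := by
  have h1 : ‖f‖ ^ 2 = ∫ x : i.Cosets, ‖f x.out‖ ^ 2 ∂μ.measure := by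
    rw [← @inner_self_eq_norm_sq ℂ, inner_def]
    have := (integral_re (integrable_inner f f)).symm
    refine this.trans (integral_congr_ae (.of_forall fun x => ?_))
    exact inner_self_eq_norm_sq (𝕜 := ℂ) (f x.out)
  rw [← ofReal_norm, ← ENNReal.ofReal_pow (norm_nonneg _), h1,
    ofReal_integral_eq_lintegral_ofReal _ (.of_forall fun x => by positivity)]
  · refine lintegral_congr fun x => ?_
    rw [ENNReal.ofReal_pow (norm_nonneg _), ofReal_norm]
  · refine (integrable_inner f f).re.congr (.of_forall fun x => ?_)
    exact inner_self_eq_norm_sq (𝕜 := ℂ) (f x.out)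

theorem eLpNorm_eq {ν : Measure G.G₀} (hν : ν.map i.proj = μ.measure) (f : i.Sect μ σ) :
    eLpNorm f 2 ν = ‖f‖ₑ := by
  rw [eLpNorm_eq_lintegral_rpow_enorm_toReal (by simp) (by simp)]
  have h := f.enorm_sq
  rw [f.equivariant.lintegral_enorm_out f.stronglyMeasurable hν] at h
  simp only [ENNReal.toReal_ofNat, ENNReal.rpow_ofNat]
  rw [← h, ← ENNReal.rpow_natCast, ← ENNReal.rpow_mul]
  norm_num

theorem memLp {ν : Measure G.G₀} (hν : ν.map i.proj = μ.measure) (f : i.Sect μ σ) :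
    MemLp f 2 ν :=
  ⟨f.stronglyMeasurable.aestronglyMeasurable, by rw [eLpNorm_eq hν]; exact enorm_lt_top⟩

/-- A square integrable equivariant function. -/
def ofMemLp {ν : Measure G.G₀} (hν : ν.map i.proj = μ.measure) (f : G.G₀ → σ.V)
    (hm : StronglyMeasurable f) (he : i.IsEquivariant σ f) (h2 : MemLp f 2 ν) : i.Sect μ σ :=
  ⟨f, hm, he, by
    rw [he.lintegral_enorm_out hm hν]
    have h := (eLpNorm_lt_top_iff_lintegral_rpow_enorm_lt_top (by simp) (by simp)).1 h2.2
    simpa using h⟩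

/-- A fast Cauchy sequence converges almost everywhere for a lift of μ to G₀. The set of pointwise
convergence is H₀-invariant, so the limit, set to zero elsewhere, is equivariant at every point and
not only almost everywhere. -/
theorem completeSpace [CompleteSpace σ.V] (hH : H.IsUnimodular) : CompleteSpace (i.Sect μ σ) := by
  obtain ⟨ν, -, hν⟩ := exists_map_proj_eq hH μ
  refine EMetric.complete_of_convergent_controlled_sequences (fun n => 2⁻¹ ^ n)
    (fun n => ENNReal.pow_pos (by simp) n) fun f hf => ?_
  have hB : ∑' n : ℕ, (2⁻¹ : ℝ≥0∞) ^ n ≠ ⊤ := by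
    rw [ENNReal.tsum_geometric]
    simp
  have hcau : ∀ N n m, N ≤ n → N ≤ m →
      eLpNorm ((f n).toFun - (f m).toFun) 2 ν < (2⁻¹ : ℝ≥0∞) ^ N := by
    intro N n m hn hm
    rw [show ((f n).toFun - (f m).toFun) = (f n - f m : i.Sect μ σ).toFun from rfl, eLpNorm_eq hν,
      ← edist_eq_enorm_sub]
    exact hf N n m hn hm
  have hmeas : ∀ n, StronglyMeasurable (f n).toFun := fun n => (f n).stronglyMeasurable
  let S : Set G.G₀ := {g | ∃ l, Filter.Tendsto (fun n => f n g) Filter.atTop (𝓝 l)}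
  have hS : MeasurableSet S := StronglyMeasurable.measurableSet_exists_tendsto hmeas
  let F : G.G₀ → σ.V := S.indicator fun g => Filter.atTop.limUnder fun n => f n g
  have hFm : StronglyMeasurable F := (StronglyMeasurable.limUnder hmeas).indicator hS
  have hF : ∀ g ∈ S, Filter.Tendsto (fun n => f n g) Filter.atTop (𝓝 (F g)) := by
    intro g hg
    simp only [F, Set.indicator_of_mem hg]
    exact tendsto_nhds_limUnder hg
  have htr : ∀ h g, g ∈ S → i.even h * g ∈ S ∧ F (i.even h * g) = σ.π h (F g) := by
    intro h g hg
    have h1 : Filter.Tendsto (fun n => f n (i.even h * g)) Filter.atTop (𝓝 (σ.π h (F g))) := by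
      simp only [fun n => (f n).equivariant h g]
      exact ((σ.π h).continuous.tendsto _).comp (hF g hg)
    have h2 : i.even h * g ∈ S := ⟨_, h1⟩
    exact ⟨h2, tendsto_nhds_unique (hF _ h2) h1⟩
  have hFe : i.IsEquivariant σ F := by
    intro h g
    by_cases hg : g ∈ S
    · exact (htr h g hg).2
    · have h2 : i.even h * g ∉ S := fun h2 => hg (by
        have := (htr h⁻¹ _ h2).1
        simpa using this)
      simp [F, Set.indicator_of_notMem hg, Set.indicator_of_notMem h2]
  have hae : ∀ᵐ g ∂ν, Filter.Tendsto (fun n => f n g) Filter.atTop (𝓝 (F g)) := by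
    filter_upwards [Lp.ae_tendsto_of_cauchy_eLpNorm (fun n => (hmeas n).aestronglyMeasurable)
      (by simp) hB hcau] with g hg using hF g hg
  have htend := Lp.cauchy_tendsto_of_tendsto (fun n => (hmeas n).aestronglyMeasurable) F hB hcau hae
  have hFL := Lp.memLp_of_cauchy_tendsto (by simp) (fun n => (f n).memLp hν) F
    hFm.aestronglyMeasurable htend
  refine ⟨ofMemLp hν F hFm hFe hFL, ?_⟩
  rw [tendsto_iff_edist_tendsto_0]
  convert htend using 2 with n
  rw [edist_eq_enorm_sub, ← eLpNorm_eq hν]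
  rfl

open PreRep in
/-- The homogeneous part of degree `k` of a section. -/
def grPart (hσ : σ.IsUnitary) (k : ZMod 2) (f : i.Sect μ σ) : i.Sect μ σ :=
  ⟨fun g => grProj hσ k (f g), (grProj hσ k).continuous.comp_stronglyMeasurable f.stronglyMeasurable,
    fun h g => by simp only [f.equivariant h g, grProj_π], by
      refine lt_of_le_of_lt (lintegral_mono fun x => ?_) f.lintegral_lt_top
      gcongr
      exact enorm_le_iff_norm_le.2 (norm_grProj_le hσ k _)⟩

theorem grPart_apply (hσ : σ.IsUnitary) (k : ZMod 2) (f : i.Sect μ σ) (g : G.G₀) :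
    grPart hσ k f g = PreRep.grProj hσ k (f g) := rfl

theorem inner_toInd (f f' : i.Sect μ σ) : inner ℂ (i.toInd μ σ f) (i.toInd μ σ f') = inner ℂ f f' :=
  rfl

end Sect

variable {μ : i.InvariantMeasure} {σ : PreRep.{u, w} H}

/-- Degrees are separated pointwise: the orthogonal projection in 𝒦, applied to values, produces the
homogeneous part of a section, and a class orthogonal to degree k has a degree k part of norm zero.
-/
theorem indGr_orthogonal (hσ : σ.IsUnitary) (k : ZMod 2) :
    (i.indGr μ σ k)ᗮ = i.indGr μ σ (k + 1) := by
  apply le_antisymm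
  · intro v hv
    obtain ⟨f, rfl⟩ := SeparationQuotient.surjective_mk v
    change i.toInd μ σ f ∈ _ at hv
    change i.toInd μ σ f ∈ _
    have h1 := (Submodule.mem_orthogonal _ _).1 hv (i.toInd μ σ (f.grPart hσ k))
      ⟨_, fun g => PreRep.grProj_mem hσ k _, rfl⟩
    have h2 : inner ℂ (f.grPart hσ k) (f.grPart hσ k) = inner ℂ (f.grPart hσ k) f := by
      rw [Sect.inner_def, Sect.inner_def]
      refine integral_congr_ae (.of_forall fun x => ?_)
      exact (PreRep.inner_grProj hσ k (f x.out)).symm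
    have h3 : i.toInd μ σ (f.grPart hσ k) = 0 := by
      rw [← inner_self_eq_zero (𝕜 := ℂ), ← h1]
      exact h2
    refine ⟨f - f.grPart hσ k, fun g => PreRep.sub_grProj_mem hσ k (f g), ?_⟩
    change i.toInd μ σ (f - f.grPart hσ k) = _
    rw [map_sub, h3, sub_zero]
  · rintro _ ⟨f, hf, rfl⟩
    rw [Submodule.mem_orthogonal]
    rintro _ ⟨f', hf', rfl⟩
    change inner ℂ f' f = 0
    rw [Sect.inner_def]
    refine integral_eq_zero_of_ae (.of_forall fun x => ?_)
    have h := hf x.out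
    rw [← hσ.gr_orthogonal, Submodule.mem_orthogonal] at h
    exact h _ (hf' _)

theorem indπ_even (g : G.G₀) (k : ZMod 2) (v : i.IndSpace μ σ) (hv : v ∈ i.indGr μ σ k) :
    i.indπ μ σ g v ∈ i.indGr μ σ k := by
  obtain ⟨f, hf, rfl⟩ := hv
  exact ⟨Sect.rightTranslate g f, fun g' => hf _, rfl⟩

end SpecialSub

end SuperLie

/-! ### Continuous sections with compact support modulo H₀, and their smooth families -/

namespace SuperLie

namespace SpecialSub

variable {G H : SuperLieGroup.{u}}

/-- The function `f` vanishes outside of `H₀ C`. -/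
def SupportedMod {W : Type*} [Zero W] (i : SpecialSub H G) (C : Set G.G₀) (f : G.G₀ → W) : Prop :=
  ∀ g, f g ≠ 0 → ∃ h, ∃ c ∈ C, g = i.even h * c

variable {i : SpecialSub H G} {μ : i.InvariantMeasure} {σ : PreRep.{u, w} H}

theorem IsEquivariant.norm_mul {f : G.G₀ → σ.V} (hf : i.IsEquivariant σ f) (h : H.G₀) (g : G.G₀) :
    ‖f (i.even h * g)‖ = ‖f g‖ := by rw [hf, LinearIsometryEquiv.norm_map]

theorem IsEquivariant.lintegral_le {f : G.G₀ → σ.V} (hf : i.IsEquivariant σ f) {C : Set G.G₀}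
    (hs : i.SupportedMod C f) {r : ℝ} (hr : ∀ c ∈ C, ‖f c‖ ≤ r) :
    ∫⁻ x : i.Cosets, ‖f x.out‖ₑ ^ 2 ∂μ.measure ≤
      ENNReal.ofReal r ^ 2 * μ.measure (i.proj '' C) := by
  refine (lintegral_mono (g := (i.proj '' C).indicator fun _ => ENNReal.ofReal r ^ 2)
    fun x => ?_).trans (lintegral_indicator_const_le _ _)
  by_cases h0 : f x.out = 0
  · simp [h0]
  · obtain ⟨h, c, hc, e⟩ := hs _ h0
    have hx : x ∈ i.proj '' C := ⟨c, hc, by rw [← i.proj_out x, e, proj_mul]⟩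
    rw [Set.indicator_of_mem hx]
    simp only
    gcongr
    rw [← ofReal_norm]
    refine ENNReal.ofReal_le_ofReal ?_
    rw [e, hf.norm_mul]
    exact hr c hc

namespace Sect

/-- A continuous equivariant function whose support is compact modulo `H₀`. -/
def ofContinuous {f : G.G₀ → σ.V} (hf : Continuous f) (he : i.IsEquivariant σ f) {C : Set G.G₀}
    (hC : IsCompact C) (hs : i.SupportedMod C f) : i.Sect μ σ :=
  ⟨f, hf.stronglyMeasurable, he, by
    obtain ⟨r, hr⟩ := hC.exists_bound_of_continuousOn hf.continuousOn
    exact (he.lintegral_le hs hr).trans_lt (ENNReal.mul_lt_top (by simp)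
      (i.measure_compact_lt_top μ hC))⟩

/-- The pointwise norm is constant on cosets, so its supremum over C controls it on H₀C. This is the
bound demanded by `contMDiffAt_of_bound_compact`. -/
theorem norm_le_of_supportedMod (f : i.Sect μ σ) {C : Set G.G₀} (hC : IsCompact C)
    (hs : i.SupportedMod C f) {r : ℝ} (hr0 : 0 ≤ r) (hr : ∀ c ∈ C, ‖f c‖ ≤ r) :
    ‖f‖ ≤ √(μ.measure (i.proj '' C)).toReal * r := by
  have h1 := f.equivariant.lintegral_le (μ := μ) hs hr
  rw [← enorm_sq, ← ofReal_norm, ← ENNReal.ofReal_pow (norm_nonneg _),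
    ← ENNReal.ofReal_pow hr0, ← ENNReal.ofReal_toReal (i.measure_compact_lt_top μ hC).ne,
    ← ENNReal.ofReal_mul (by positivity), ENNReal.ofReal_le_ofReal_iff (by positivity)] at h1
  refine abs_le_of_sq_le_sq' ?_ (by positivity) |>.2
  rw [mul_pow, Real.sq_sqrt ENNReal.toReal_nonneg, mul_comm]
  exact h1

variable (μ σ) in
/-- The continuous sections supported in `H₀ C`. -/
def supported (C : Set G.G₀) : Submodule ℂ (i.Sect μ σ) where
  carrier := {f | Continuous f ∧ i.SupportedMod C f}
  add_mem' := by
    rintro f f' ⟨hf, hs⟩ ⟨hf', hs'⟩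
    refine ⟨hf.add hf', fun g hg => ?_⟩
    by_cases h0 : f g = 0
    · refine hs' g fun h1 => hg ?_
      change f g + f' g = 0
      rw [h0, h1, add_zero]
    · exact hs g h0
  zero_mem' := ⟨continuous_const, fun g hg => (hg rfl).elim⟩
  smul_mem' := by
    rintro c f ⟨hf, hs⟩
    refine ⟨hf.const_smul c, fun g hg => hs g fun h0 => hg ?_⟩
    change c • f g = 0
    rw [h0, smul_zero]

/-- A smooth family of sections, with supports locally uniformly compact modulo `H₀`, is smooth as a
map into the Hilbert space of the induced representation. -/
theorem contMDiffAt_toInd [CompleteSpace (i.IndSpace μ σ)]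
    {E' : Type*} [NormedAddCommGroup E'] [NormedSpace ℝ E'] [FiniteDimensional ℝ E']
    {N : Type*} [TopologicalSpace N] [ChartedSpace E' N] [IsManifold 𝓘(ℝ, E') ∞ N]
    {F : N → G.G₀ → σ.V}
    (hF : ContMDiff (𝓘(ℝ, E').prod 𝓘(ℝ, G.E)) 𝓘(ℝ, σ.V) ∞ (fun p : N × G.G₀ => F p.1 p.2))
    (s : N → i.Sect μ σ) (hs : ∀ x g, s x g = F x g) {x₀ : N} {C : Set G.G₀} (hC : IsCompact C)
    (hsupp : ∀ᶠ x in 𝓝 x₀, i.SupportedMod C (F x)) :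
    ContMDiffAt 𝓘(ℝ, E') 𝓘(ℝ, i.IndSpace μ σ) ∞ (fun x => i.toInd μ σ (s x)) x₀ ∧
      ∀ (X : E') (s' : i.Sect μ σ),
        (∀ g, s' g = (mfderiv 𝓘(ℝ, E') 𝓘(ℝ, σ.V) (fun x => F x g) x₀ : E' → σ.V) X) →
        (mfderiv 𝓘(ℝ, E') 𝓘(ℝ, i.IndSpace μ σ) (fun x => i.toInd μ σ (s x)) x₀ :
          E' → i.IndSpace μ σ) X = i.toInd μ σ s' := by
  have hcpt : CompactSpace C := isCompact_iff_compactSpace.1 hC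
  let ev : supported μ σ C →ₗ[ℝ] C(C, σ.V) :=
    { toFun := fun d => ⟨fun c => d.1 c, d.2.1.comp continuous_subtype_val⟩
      map_add' := fun _ _ => rfl
      map_smul' := fun c d => by
        ext x
        rfl }
  let T : supported μ σ C →ₗ[ℝ] i.IndSpace μ σ :=
    ((i.toInd μ σ).toLinearMap.restrictScalars ℝ).comp
      ((supported μ σ C).subtype.restrictScalars ℝ)
  have hcont : ∀ x, Continuous (F x) := fun x =>
    hF.continuous.comp (Continuous.prodMk_right x)
  have hT : ∃ c, ∀ d, ‖T d‖ ≤ c * ‖ev d‖ :=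
    ⟨_, fun d => norm_le_of_supportedMod d.1 hC d.2.2 (norm_nonneg _) fun c hc =>
      (ev d).norm_coe_le_norm ⟨c, hc⟩⟩
  have hmem : ∀ x, i.SupportedMod C (F x) → s x ∈ supported μ σ C := by
    intro x hx
    have h1 : (s x).toFun = F x := funext fun g => hs x g
    exact ⟨by rw [h1]; exact hcont x, by rw [h1]; exact hx⟩
  have key := contMDiffAt_of_bound_compact C ev T hT hF (Φ := fun x => i.toInd μ σ (s x))
    (x₀ := x₀) (hsupp.mono fun x hx => ⟨⟨s x, hmem x hx⟩, fun y => hs x y, rfl⟩)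
  refine ⟨key.1, fun X s' hs' => ?_⟩
  -- The derivative must be an admissible section too. It is continuous by
  -- `ContMDiff.mfderiv_param`, and vanishes off H₀C because there F(x, g) is zero for all x near
  -- x₀.
  have hF' : ContMDiff (𝓘(ℝ, G.E).prod 𝓘(ℝ, E')) 𝓘(ℝ, σ.V) ∞
      (fun p : G.G₀ × N => F p.2 p.1) :=
    hF.comp (contMDiff_snd.prodMk contMDiff_fst)
  have hd := hF'.mfderiv_param (f := fun g x => F x g) x₀ X
  refine key.2 X ⟨s', ?_, ?_⟩ fun y => hs' y
  · rw [show s'.toFun = _ from funext hs']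
    exact hd.continuous
  · intro g hg
    by_contra hne
    refine hg ?_
    rw [hs']
    have h0 : (fun x => F x g) =ᶠ[𝓝 x₀] fun _ => 0 := by
      filter_upwards [hsupp] with x hx
      by_contra h1
      exact hne (hx g h1)
    rw [h0.mfderiv_eq, mfderiv_const]
    rfl

end Sect

end SpecialSub

end SuperLie

/-! ### The odd operators on smooth sections with compact support modulo H₀ -/

namespace SuperLie

/-- The derivative at `1` of a function on `G₀` in the direction `Z`. -/
def derivOne {G : SuperLieGroup.{u}} {W : Type w} [NormedAddCommGroup W] [NormedSpace ℝ W]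
    (F : G.G₀ → W) (Z : G.𝔤₀) : W := (mfderiv 𝓘(ℝ, G.E) 𝓘(ℝ, W) F 1 Z : W)

namespace SpecialSub

open PreRep

variable {G H : SuperLieGroup.{u}} {i : SpecialSub H G} {μ : i.InvariantMeasure}
  {σ : PreRep.{u, w} H}

theorem oddEquiv_symm_act (h : H.G₀) (X : G.𝔤₁) :
    i.oddEquiv.symm (G.act (i.even h) X) = H.act h (i.oddEquiv.symm X) := by
  rw [LinearEquiv.symm_apply_eq]
  change _ = i.odd (H.act h (i.oddEquiv.symm X))
  rw [i.odd_act]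
  congr 1
  exact (i.oddEquiv.apply_symm_apply X).symm

theorem lieMap_br_oddEquiv_symm (X : G.𝔤₁) :
    SuperLieGroup.lieMap i.even (H.br (i.oddEquiv.symm X) (i.oddEquiv.symm X)) = G.br X X := by
  rw [i.lieMap_br]
  have : i.odd (i.oddEquiv.symm X) = X := i.oddEquiv.apply_symm_apply X
  rw [this]

namespace IsEquivariant

variable {f : G.G₀ → σ.V}

theorem contMDiff_orbit (hf : ContMDiff 𝓘(ℝ, G.E) 𝓘(ℝ, σ.V) ∞ f) :
    ContMDiff (𝓘(ℝ, G.E).prod 𝓘(ℝ, H.E)) 𝓘(ℝ, σ.V) ∞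
      (fun p : G.G₀ × H.G₀ => f (i.even p.2 * p.1)) :=
  hf.comp ((i.contMDiff_even.comp contMDiff_snd).mul contMDiff_fst)

/-- The orbit map of f(g) is h ↦ f(hg), smooth because f is. -/
theorem mem_smoothVectors (he : i.IsEquivariant σ f)
    (hf : ContMDiff 𝓘(ℝ, G.E) 𝓘(ℝ, σ.V) ∞ f) (g : G.G₀) : f g ∈ σ.smoothVectors := by
  rw [PreRep.mem_smoothVectors]
  simp only [← he _ g]
  exact hf.comp (i.contMDiff_even.mul contMDiff_const)

theorem contMDiff_dπ (he : i.IsEquivariant σ f) (hf : ContMDiff 𝓘(ℝ, G.E) 𝓘(ℝ, σ.V) ∞ f)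
    (Z : H.𝔤₀) : ContMDiff 𝓘(ℝ, G.E) 𝓘(ℝ, σ.V) ∞ (fun g => σ.dπ Z (f g)) := by
  have h := ContMDiff.mfderiv_param (f := fun g h => f (i.even h * g)) (contMDiff_orbit hf) 1 Z
  refine h.congr fun g => ?_
  have h3 : (fun h => f (i.even h * g)) = fun h => σ.π h (f g) := funext fun h => he h g
  change _ = (mfderiv 𝓘(ℝ, H.E) 𝓘(ℝ, σ.V) (fun h => f (i.even h * g)) 1 : H.E → σ.V) Z
  rw [h3]
  rfl

theorem dπ_eq (he : i.IsEquivariant σ f) (hf : ContMDiff 𝓘(ℝ, G.E) 𝓘(ℝ, σ.V) ∞ f)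
    (Z : H.𝔤₀) (g : G.G₀) : σ.dπ Z (f g) =
      (mfderiv 𝓘(ℝ, G.E) 𝓘(ℝ, σ.V) (fun x => f (x * g)) 1 (SuperLieGroup.lieMap i.even Z) : σ.V) := by
  have h1 : MDifferentiableAt 𝓘(ℝ, G.E) 𝓘(ℝ, σ.V) (fun x => f (x * g)) (i.even 1) :=
    (hf.comp (contMDiff_id.mul contMDiff_const)).mdifferentiableAt (by simp)
  have h2 : MDifferentiableAt 𝓘(ℝ, H.E) 𝓘(ℝ, G.E) i.even 1 :=
    i.contMDiff_even.mdifferentiableAt (by simp)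
  have h := mfderiv_comp (1 : H.G₀) h1 h2
  have h3 : (fun x => f (x * g)) ∘ i.even = fun h => σ.π h (f g) := funext fun h => he h g
  rw [h3] at h
  unfold PreRep.dπ
  rw [h]
  change (mfderiv 𝓘(ℝ, G.E) 𝓘(ℝ, σ.V) (fun x => f (x * g)) (i.even 1) : G.E → σ.V) _ = _
  rw [map_one]
  rfl

/-- `(ρ(X) f)(g) = ρ^σ(g · X) (f(g))`. -/
def oddFun (hσ : σ.IsUnitary) (he : i.IsEquivariant σ f)
    (hf : ContMDiff 𝓘(ℝ, G.E) 𝓘(ℝ, σ.V) ∞ f) (X : G.𝔤₁) (g : G.G₀) : σ.V :=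
  oddOp hσ (i.oddEquiv.symm (G.act g X)) ⟨f g, he.mem_smoothVectors hf g⟩

/-- In a basis, ρ^σ(g·X) f(g) is a combination, with coefficients smooth in g, of bounded operators
applied to f(g) and to derivatives dσ(Z)f(g), which are smooth by `contMDiff_dπ`. -/
theorem contMDiff_oddFun (hσ : σ.IsUnitary) (he : i.IsEquivariant σ f)
    (hf : ContMDiff 𝓘(ℝ, G.E) 𝓘(ℝ, σ.V) ∞ f) (X : G.𝔤₁) :
    ContMDiff 𝓘(ℝ, G.E) 𝓘(ℝ, σ.V) ∞ (oddFun hσ he hf X) := by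
  let b := Module.finBasis ℝ G.𝔤₁
  choose S hS using fun j => exists_clm_oddOp hσ (i.oddEquiv.symm (b j))
  have h1 : ∀ g, oddFun hσ he hf X g = ∑ j, b.repr (G.act g X) j •
      S j (WithLp.toLp 2 (f g, σ.dπ (H.br (i.oddEquiv.symm (b j)) (i.oddEquiv.symm (b j))) (f g))) := by
    intro g
    have h2 : i.oddEquiv.symm (G.act g X) =
        ∑ j, b.repr (G.act g X) j • i.oddEquiv.symm (b j) := by
      conv_lhs => rw [← b.sum_repr (G.act g X)]
      rw [map_sum]
      simp only [map_smul]
    unfold oddFun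
    rw [h2, map_sum, LinearMap.sum_apply, Submodule.coe_sum]
    refine Finset.sum_congr rfl fun j _ => ?_
    rw [map_smul, ← hS j ⟨f g, he.mem_smoothVectors hf g⟩]
    rfl
  refine ContMDiff.congr ?_ h1
  refine contMDiff_finsetSum fun j _ => ?_
  refine (contMDiff_act_repr b X j).smul ?_
  let L : σ.V × σ.V →L[ℝ] σ.V :=
    ((S j).comp (WithLp.prodContinuousLinearEquiv 2 ℂ σ.V σ.V).symm.toContinuousLinearMap).restrictScalars ℝ
  exact L.contDiff.contMDiff.comp (hf.prodMk_space (he.contMDiff_dπ hf _))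

theorem oddFun_equivariant (hσ : σ.IsUnitary) (he : i.IsEquivariant σ f)
    (hf : ContMDiff 𝓘(ℝ, G.E) 𝓘(ℝ, σ.V) ∞ f) (X : G.𝔤₁) :
    i.IsEquivariant σ (oddFun hσ he hf X) := by
  intro h g
  unfold oddFun
  rw [map_mul]
  change (oddOp hσ (i.oddEquiv.symm (G.act (i.even h) (G.act g X))) _ : σ.V) = _
  rw [oddEquiv_symm_act]
  exact oddOp_π hσ h _ _ _ (he h g)

/-- Squaring ρ^σ(g·X) gives dσ in the direction [g·X, g·X] = Ad(g)[X,X]. By equivariance this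
differentiates f(xg) at x = 1, and conjugation by g turns it into the derivative of f(gx) in the
direction [X,X], which is the infinitesimal right translation. -/
theorem oddFun_oddFun (hσ : σ.IsUnitary) (he : i.IsEquivariant σ f)
    (hf : ContMDiff 𝓘(ℝ, G.E) 𝓘(ℝ, σ.V) ∞ f) (X : G.𝔤₁) (g : G.G₀) :
    oddFun hσ (oddFun_equivariant hσ he hf X) (contMDiff_oddFun hσ he hf X) X g =
      -(Complex.I / 2) • derivOne (fun x => f (g * x)) (G.br X X) := by
  have h1 : oddFun hσ (oddFun_equivariant hσ he hf X) (contMDiff_oddFun hσ he hf X) X g =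
    oddOp hσ (i.oddEquiv.symm (G.act g X)) (oddOp hσ (i.oddEquiv.symm (G.act g X))
      ⟨f g, he.mem_smoothVectors hf g⟩) := rfl
  rw [h1, oddOp_oddOp]
  congr 1
  simp only
  rw [he.dπ_eq hf, lieMap_br_oddEquiv_symm, ← G.adjointAction_br]
  have h2 : MDifferentiableAt 𝓘(ℝ, G.E) 𝓘(ℝ, σ.V) (fun x => f (x * g)) (g * 1 * g⁻¹) :=
    (hf.comp (contMDiff_id.mul contMDiff_const)).mdifferentiableAt (by simp)
  have h3 : MDifferentiableAt 𝓘(ℝ, G.E) 𝓘(ℝ, G.E) (fun x : G.G₀ => g * x * g⁻¹) 1 :=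
    ((contMDiff_const.mul contMDiff_id).mul contMDiff_const (I := 𝓘(ℝ, G.E))
      (n := ∞)).mdifferentiableAt (by simp)
  have h := mfderiv_comp (1 : G.G₀) h2 h3
  have h4 : (fun x => f (x * g)) ∘ (fun x : G.G₀ => g * x * g⁻¹) = fun x => f (g * x) :=
    funext fun x => by simp
  rw [h4] at h
  unfold derivOne
  rw [h]
  change _ = (mfderiv 𝓘(ℝ, G.E) 𝓘(ℝ, σ.V) (fun x => f (x * g)) (g * 1 * g⁻¹) : G.E → σ.V) _
  rw [mul_one, mul_inv_cancel]
  rfl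

end IsEquivariant

namespace Sect

variable (μ σ) in
/-- The smooth sections with compact support modulo `H₀`. -/
def smoothCompact : Submodule ℂ (i.Sect μ σ) where
  carrier := {f | f.IsSmoothCompact}
  add_mem' := by
    rintro f₁ f₂ ⟨hs₁, C₁, hC₁, hc₁⟩ ⟨hs₂, C₂, hC₂, hc₂⟩
    refine ⟨hs₁.add hs₂, C₁ ∪ C₂, hC₁.union hC₂, fun g hg => ?_⟩
    by_cases hg₁ : f₁ g = 0
    · have hg₂ : f₂ g ≠ 0 := fun h0 => hg (by
        change f₁ g + f₂ g = 0
        rw [hg₁, h0, add_zero])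
      obtain ⟨h, c, hc, e⟩ := hc₂ g hg₂
      exact ⟨h, c, Or.inr hc, e⟩
    · obtain ⟨h, c, hc, e⟩ := hc₁ g hg₁
      exact ⟨h, c, Or.inl hc, e⟩
  zero_mem' := ⟨contMDiff_const, ∅, isCompact_empty, fun g hg => (hg rfl).elim⟩
  smul_mem' := by
    rintro a f ⟨hs, C, hC, hc⟩
    have ha : ContDiff ℝ ∞ (fun x : σ.V => a • x) := contDiff_const_smul a
    refine ⟨ha.contMDiff.comp hs, C, hC, fun g hg => hc g fun h0 => hg ?_⟩
    change a • f g = 0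
    rw [h0, smul_zero]

theorem exists_smoothCompact {f : G.G₀ → σ.V} (hf : ContMDiff 𝓘(ℝ, G.E) 𝓘(ℝ, σ.V) ∞ f)
    (he : i.IsEquivariant σ f) {C : Set G.G₀} (hC : IsCompact C) (hs : i.SupportedMod C f) :
    ∃ b : smoothCompact μ σ, (b : i.Sect μ σ).toFun = f :=
  ⟨⟨ofContinuous hf.continuous he hC hs, hf, C, hC, hs⟩, rfl⟩

theorem smoothCompact_contMDiff (b : smoothCompact μ σ) :
    ContMDiff 𝓘(ℝ, G.E) 𝓘(ℝ, σ.V) ∞ (b : i.Sect μ σ) := b.2.1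

theorem exists_supportedMod (b : smoothCompact μ σ) :
    ∃ C, IsCompact C ∧ i.SupportedMod C (b : i.Sect μ σ) := b.2.2

theorem exists_odd (hσ : σ.IsUnitary) (X : G.𝔤₁) (b : smoothCompact μ σ) :
    ∃ b' : smoothCompact μ σ, ∀ g, (b' : i.Sect μ σ) g =
      oddOp hσ (i.oddEquiv.symm (G.act g X)) ⟨(b : i.Sect μ σ) g,
        (b : i.Sect μ σ).equivariant.mem_smoothVectors (smoothCompact_contMDiff b) g⟩ := by
  obtain ⟨C, hC, hs⟩ := exists_supportedMod b
  have hs' : i.SupportedMod C (IsEquivariant.oddFun hσ (b : i.Sect μ σ).equivariant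
      (smoothCompact_contMDiff b) X) := by
    refine fun g hg => hs g fun h0 => hg ?_
    unfold IsEquivariant.oddFun
    simp only [h0]
    rw [show (⟨0, _⟩ : σ.smoothVectors) = 0 from rfl, map_zero, Submodule.coe_zero]
  obtain ⟨b', hb'⟩ := exists_smoothCompact (μ := μ)
    (IsEquivariant.contMDiff_oddFun hσ (b : i.Sect μ σ).equivariant (smoothCompact_contMDiff b) X)
    (IsEquivariant.oddFun_equivariant hσ _ _ X) hC hs'
  exact ⟨b', fun g => by rw [hb']; rfl⟩

/-- The operator `(ρ(X) f)(g) = ρ^σ(g · X) (f(g))` on smooth sections with compact support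
modulo `H₀`. -/
def oddSect (hσ : σ.IsUnitary) : G.𝔤₁ →ₗ[ℝ] smoothCompact μ σ →ₗ[ℂ] smoothCompact μ σ where
  toFun X :=
    { toFun := fun b => (exists_odd hσ X b).choose
      map_add' := fun b b' => by
        apply Subtype.ext
        apply Subtype.ext
        funext g
        refine ((exists_odd hσ X (b + b')).choose_spec g).trans ?_
        refine Eq.trans ?_ (congrArg₂ (· + ·) ((exists_odd hσ X b).choose_spec g)
          ((exists_odd hσ X b').choose_spec g)).symm
        rw [← Submodule.coe_add, ← map_add]
        rfl
      map_smul' := fun c b => by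
        apply Subtype.ext
        apply Subtype.ext
        funext g
        refine ((exists_odd hσ X (c • b)).choose_spec g).trans ?_
        refine Eq.trans ?_ (congrArg (c • ·) ((exists_odd hσ X b).choose_spec g)).symm
        rw [← Submodule.coe_smul, ← map_smul]
        rfl }
  map_add' X Y := by
    ext b
    apply Subtype.ext
    funext g
    refine ((exists_odd hσ (X + Y) b).choose_spec g).trans ?_
    refine Eq.trans ?_ (congrArg₂ (· + ·) ((exists_odd hσ X b).choose_spec g)
      ((exists_odd hσ Y b).choose_spec g)).symm
    rw [map_add, map_add, map_add]
    rfl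
  map_smul' c X := by
    ext b
    apply Subtype.ext
    funext g
    refine ((exists_odd hσ (c • X) b).choose_spec g).trans ?_
    refine Eq.trans ?_ (congrArg (c • ·) ((exists_odd hσ X b).choose_spec g)).symm
    rw [map_smul, map_smul, map_smul]
    rfl

theorem oddSect_apply (hσ : σ.IsUnitary) (X : G.𝔤₁) (b : smoothCompact μ σ) (g : G.G₀) :
    (oddSect hσ X b : i.Sect μ σ) g =
      oddOp hσ (i.oddEquiv.symm (G.act g X)) ⟨(b : i.Sect μ σ) g,
        (b : i.Sect μ σ).equivariant.mem_smoothVectors (smoothCompact_contMDiff b) g⟩ :=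
  (exists_odd hσ X b).choose_spec g

theorem oddSect_oddSect (hσ : σ.IsUnitary) (X : G.𝔤₁) (b : smoothCompact μ σ) (g : G.G₀) :
    (oddSect hσ X (oddSect hσ X b) : i.Sect μ σ) g = -(Complex.I / 2) •
      derivOne (fun x => (b : i.Sect μ σ) (g * x)) (G.br X X) := by
  rw [← IsEquivariant.oddFun_oddFun hσ (b : i.Sect μ σ).equivariant (smoothCompact_contMDiff b) X g,
    oddSect_apply]
  unfold IsEquivariant.oddFun
  congr 2
  exact Subtype.ext (oddSect_apply hσ X b g)

theorem mem_indGraph_iff (hσ : σ.IsUnitary) (X : G.𝔤₁) (p : i.IndSpace μ σ × i.IndSpace μ σ) :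
    p ∈ i.indGraph μ σ X ↔ ∃ b : smoothCompact μ σ,
      p = (i.toInd μ σ b, i.toInd μ σ (oddSect hσ X b : i.Sect μ σ)) := by
  constructor
  · rintro ⟨f, f', hf, hff, rfl⟩
    refine ⟨⟨f, hf⟩, ?_⟩
    have : f' = oddSect hσ X ⟨f, hf⟩ := by
      apply Subtype.ext
      funext g
      obtain ⟨h1, h2⟩ := (mem_graph_iff_oddOp hσ _ _ _).1 (hff g)
      exact h2.symm.trans (oddSect_apply hσ X ⟨f, hf⟩ g).symm
    rw [this]
  · rintro ⟨b, rfl⟩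
    exact ⟨b, oddSect hσ X b, b.2, fun g => (mem_graph_iff_oddOp hσ _ _ _).2
      ⟨_, (oddSect_apply hσ X b g).symm⟩, rfl⟩

theorem exists_rightTranslate (g : G.G₀) (b : smoothCompact μ σ) :
    ∃ b' : smoothCompact μ σ, (b' : i.Sect μ σ) = rightTranslate g b := by
  obtain ⟨C, hC, hs⟩ := exists_supportedMod b
  refine ⟨⟨rightTranslate g b, (smoothCompact_contMDiff b).comp
    (contMDiff_id.mul contMDiff_const), (· * g⁻¹) '' C, hC.image (by fun_prop), fun g' hg' => ?_⟩, rfl⟩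
  obtain ⟨h, c, hc, e⟩ := hs (g' * g) hg'
  exact ⟨h, c * g⁻¹, ⟨c, hc, rfl⟩, by rw [← mul_assoc, ← e]; group⟩

theorem exists_grPart (hσ : σ.IsUnitary) (k : ZMod 2) (b : smoothCompact μ σ) :
    ∃ b' : smoothCompact μ σ, (b' : i.Sect μ σ) = grPart hσ k b := by
  obtain ⟨C, hC, hs⟩ := exists_supportedMod b
  refine ⟨⟨grPart hσ k b, ?_, C, hC, fun g hg => hs g fun h0 => hg ?_⟩, rfl⟩
  · exact ((grProj hσ k).restrictScalars ℝ).contDiff.contMDiff.comp (smoothCompact_contMDiff b)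
  · rw [grPart_apply, h0, map_zero]

end Sect

end SpecialSub

end SuperLie

/-! ### Smoothness of right translation, density of averages, unitarity of induction -/

namespace SuperLie

namespace SpecialSub

open PreRep

variable {G H : SuperLieGroup.{u}} {i : SpecialSub H G}

section Smooth

variable {μ : i.InvariantMeasure} {σ : PreRep.{u, w} H}

/-- For x in a compact neighbourhood L of x₀ the translate lives over CL⁻¹, so a single compact set
serves all of them. -/
theorem eventually_supportedMod {W : Type*} [Zero W] {C : Set G.G₀} (hC : IsCompact C)
    {f : G.G₀ → W} (hs : i.SupportedMod C f) (x₀ : G.G₀) :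
    ∃ C', IsCompact C' ∧ ∀ᶠ x in 𝓝 x₀, i.SupportedMod C' (fun g => f (g * x)) := by
  obtain ⟨L, hL, hx⟩ := exists_compact_mem_nhds x₀
  refine ⟨C * L⁻¹, hC.mul hL.inv, ?_⟩
  filter_upwards [hx] with x hxL g hg
  obtain ⟨h, c, hc, e⟩ := hs _ hg
  exact ⟨h, c * x⁻¹, Set.mul_mem_mul hc (Set.inv_mem_inv.2 hxL), by
    rw [← mul_assoc, ← e, mul_inv_cancel_right]⟩

namespace Sect

variable [CompleteSpace (i.IndSpace μ σ)]

/-- The smooth family is (x, g) ↦ b(gx). The derivative formula is kept along with smoothness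
because it identifies dπ on the core. -/
theorem contMDiffAt_indπ (b : smoothCompact μ σ) (x₀ : G.G₀) :
    ContMDiffAt 𝓘(ℝ, G.E) 𝓘(ℝ, i.IndSpace μ σ) ∞
      (fun x => i.toInd μ σ (rightTranslate x b)) x₀ ∧
      ∀ (X : G.E) (s' : i.Sect μ σ),
        (∀ g, s' g = (mfderiv 𝓘(ℝ, G.E) 𝓘(ℝ, σ.V)
          (fun x => (b : i.Sect μ σ) (g * x)) x₀ : G.E → σ.V) X) →
        (mfderiv 𝓘(ℝ, G.E) 𝓘(ℝ, i.IndSpace μ σ) (fun x => i.toInd μ σ (rightTranslate x b)) x₀ :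
          G.E → i.IndSpace μ σ) X = i.toInd μ σ s' := by
  obtain ⟨C, hC, hs⟩ := exists_supportedMod b
  obtain ⟨C', hC', hs'⟩ := eventually_supportedMod hC hs x₀
  exact contMDiffAt_toInd (F := fun x g => (b : i.Sect μ σ) (g * x))
    ((smoothCompact_contMDiff b).comp (contMDiff_snd.mul contMDiff_fst))
    (fun x => rightTranslate x (b : i.Sect μ σ)) (fun x g => rfl) hC' hs'

theorem toInd_mem_smoothVectors (b : smoothCompact μ σ) :
    (i.toInd μ σ b : (i.ind μ σ).V) ∈ (i.ind μ σ).smoothVectors :=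
  fun x₀ => (contMDiffAt_indπ b x₀).1

theorem dπ_toInd (b : smoothCompact μ σ) (Z : G.𝔤₀) (s' : i.Sect μ σ)
    (hs' : ∀ g, s' g = derivOne (fun x => (b : i.Sect μ σ) (g * x)) Z) :
    (i.ind μ σ).dπ Z (i.toInd μ σ b) = i.toInd μ σ s' :=
  (contMDiffAt_indπ b 1).2 Z s' hs'

end Sect

/-- A representation by isometries is strongly continuous if it is so on a dense set of vectors. -/
theorem _root_.SuperLie.PreRep.continuous_π_of_dense {τ : PreRep.{u, w} G} {S : Set τ.V} (hS : Dense S)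
    (h : ∀ v ∈ S, Continuous fun g => τ.π g v) (v : τ.V) : Continuous fun g => τ.π g v := by
  refine continuous_of_uniform_approx_of_continuous fun u hu => ?_
  obtain ⟨ε, hε, hεu⟩ := Metric.mem_uniformity_dist.1 hu
  obtain ⟨v', hv', hd⟩ := Metric.dense_iff.1 hS v ε hε
  refine ⟨_, h v' hd, fun g => hεu ?_⟩
  rw [(τ.π g).dist_map, dist_comm]
  exact hv'

end Smooth

section Average

variable (i) (m : Measure H.G₀) {W : Type*} [NormedAddCommGroup W] [NormedSpace ℝ W]

/-- The integral of `φ` over the cosets of `H₀`, with weight `v`. -/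
def orbitAverage (φ : G.G₀ → ℝ) (v : H.G₀ → W) (g : G.G₀) : W :=
  ∫ h, φ (i.even h * g) • v h ∂m

variable {i} {φ : G.G₀ → ℝ} {v : H.G₀ → W}

theorem hasCompactSupport_orbit (hc : HasCompactSupport φ) (g : G.G₀) :
    HasCompactSupport fun h => φ (i.even h * g) • v h := by
  have h1 : HasCompactSupport fun h => φ (i.even h * g) :=
    hc.comp_isClosedEmbedding ((Homeomorph.mulRight g).isClosedEmbedding.comp
      i.isClosedEmbedding_even)
  exact h1.smul_right

theorem integrable_orbit [IsFiniteMeasureOnCompacts m] (hφ : Continuous φ)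
    (hc : HasCompactSupport φ) (hv : Continuous v) (g : G.G₀) :
    Integrable (fun h => φ (i.even h * g) • v h) m :=
  ((hφ.comp (i.continuous_even.mul continuous_const)).smul hv).integrable_of_hasCompactSupport
    (hasCompactSupport_orbit hc g)

theorem supportedMod_orbitAverage : i.SupportedMod (tsupport φ) (i.orbitAverage m φ v) := by
  intro g hg
  by_contra hne
  refine hg ?_
  unfold orbitAverage
  refine integral_eq_zero_of_ae (.of_forall fun h => ?_)
  have : φ (i.even h * g) = 0 := by
    by_contra h1
    exact hne ⟨h⁻¹, _, subset_tsupport _ h1, by simp⟩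
  simp [this]

/-- For g near g₀ the integrand is supported in one compact subset of H₀. Integration against v
there is bounded by the supremum norm, so smoothness comes from φ alone and continuity of v
suffices. -/
theorem contMDiff_orbitAverage [CompleteSpace W] [IsFiniteMeasureOnCompacts m]
    (hφ : ContMDiff 𝓘(ℝ, G.E) 𝓘(ℝ, ℝ) ∞ φ) (hc : HasCompactSupport φ) (hv : Continuous v) :
    ContMDiff 𝓘(ℝ, G.E) 𝓘(ℝ, W) ∞ (i.orbitAverage m φ v) := by
  intro g₀
  obtain ⟨L, hL, hx⟩ := exists_compact_mem_nhds g₀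
  let C : Set H.G₀ := i.even ⁻¹' (tsupport φ * L⁻¹)
  have hC : IsCompact C := i.isCompact_preimage_even (hc.isCompact.mul hL.inv)
  have : CompactSpace C := isCompact_iff_compactSpace.1 hC
  have hfin : IsFiniteMeasure (m.comap ((↑) : C → H.G₀)) := by
    refine ⟨?_⟩
    rw [Measure.comap_apply _ Subtype.val_injective
      (fun s hs => hC.measurableSet.subtype_image hs) _ MeasurableSet.univ]
    simpa using hC.measure_lt_top
  have hint : ∀ d : C(C, ℝ), Integrable (fun y : C => d y • v y) (m.comap ((↑) : C → H.G₀)) :=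
    fun d => (d.continuous.smul (hv.comp continuous_subtype_val)).integrable_of_hasCompactSupport
      (HasCompactSupport.of_compactSpace _)
  let T : C(C, ℝ) →ₗ[ℝ] W :=
    { toFun := fun d => ∫ y : C, d y • v y ∂(m.comap ((↑) : C → H.G₀))
      map_add' := fun d d' => by
        rw [← integral_add (hint d) (hint d')]
        simp [add_smul]
      map_smul' := fun c d => by
        simp only [ContinuousMap.smul_apply, RingHom.id_apply, smul_assoc, integral_smul] }
  obtain ⟨r, hr⟩ := hC.exists_bound_of_continuousOn hv.continuousOn
  refine (contMDiffAt_of_bound_compact C LinearMap.id T ?_ (f := fun g h => φ (i.even h * g))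
    (hφ.comp ((i.contMDiff_even.comp contMDiff_snd).mul contMDiff_fst)) ?_).1
  · refine ⟨r * (m.comap ((↑) : C → H.G₀)).real Set.univ, fun d => ?_⟩
    refine (norm_integral_le_of_norm_le_const (C := ‖d‖ * r) (.of_forall fun y => ?_)).trans
      (le_of_eq ?_)
    · rw [norm_smul]
      exact mul_le_mul (d.norm_coe_le_norm y) (hr y y.2) (norm_nonneg _) (norm_nonneg _)
    · simp only [LinearMap.id_apply]
      ring
  · filter_upwards [hx] with g hg
    refine ⟨⟨fun y => φ (i.even y * g), ?_⟩, fun y => rfl, ?_⟩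
    · exact hφ.continuous.comp ((i.continuous_even.comp continuous_subtype_val).mul continuous_const)
    · change ∫ h, φ (i.even h * g) • v h ∂m = ∫ y : C, φ (i.even y * g) • v y ∂_
      rw [integral_subtype_comap hC.measurableSet (fun h => φ (i.even h * g) • v h)]
      refine (setIntegral_eq_integral_of_forall_compl_eq_zero fun h hh => ?_).symm
      have : φ (i.even h * g) = 0 := by
        by_contra h1
        exact hh ⟨_, subset_tsupport _ h1, g⁻¹, Set.inv_mem_inv.2 hg, by simp⟩
      simp [this]

end Average

section Density

variable {σ : PreRep.{u, w} H} (m : Measure H.G₀) [m.IsMulRightInvariant]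

theorem isEquivariant_orbitAverage (φ : G.G₀ → ℝ) (u : σ.V) :
    i.IsEquivariant σ (i.orbitAverage m φ fun h => σ.π h⁻¹ u) := by
  intro h₀ g
  unfold orbitAverage
  have h1 := integral_mul_right_eq_self (μ := m)
    (fun h => φ (i.even h * g) • σ.π (h₀ * h⁻¹) u) h₀
  have h2 : ∀ h, φ (i.even h * (i.even h₀ * g)) • σ.π h⁻¹ u =
      φ (i.even (h * h₀) * g) • σ.π (h₀ * (h * h₀)⁻¹) u := by
    intro h
    congr 2
    · rw [map_mul, mul_assoc]
    · congr 2
      group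
  simp only [h2]
  rw [h1, ← LinearIsometryEquiv.coe_toContinuousLinearEquiv]
  have h3 := ((σ.π h₀).toContinuousLinearEquiv.restrictScalars ℝ).integral_comp_comm (μ := m)
    (fun h => φ (i.even h * g) • σ.π h⁻¹ u)
  refine Eq.trans ?_ h3
  refine integral_congr_ae (.of_forall fun h => ?_)
  simp only [map_smul]
  rw [π_mul_apply]
  rfl

variable [IsFiniteMeasureOnCompacts m] {μ : i.InvariantMeasure}

/-- Only cosets meeting a compact set C contribute, each by at most a constant times ‖f‖. Since ‖f‖
≤ 1 + ‖f‖², square integrability over the cosets and finite measure of the image of C suffice. -/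
theorem Sect.locallyIntegrable (f : i.Sect μ σ) : LocallyIntegrable f (i.weil m μ) := by
  rw [locallyIntegrable_iff]
  intro C hC
  refine ⟨f.stronglyMeasurable.aestronglyMeasurable, ?_⟩
  have hf := f.stronglyMeasurable.enorm
  rw [hasFiniteIntegral_iff_enorm, ← lintegral_indicator hC.measurableSet,
    i.lintegral_weil m μ (hf.indicator hC.measurableSet)]
  have hfin : m (i.even ⁻¹' (C * C⁻¹)) < ⊤ :=
    (i.isCompact_preimage_even (hC.mul hC.inv)).measure_lt_top
  calc _ ≤ ∫⁻ x : i.Cosets, m (i.even ⁻¹' (C * C⁻¹)) *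
        ((i.proj '' C).indicator 1 x + ‖f x.out‖ₑ ^ 2) ∂μ.measure := by
        refine lintegral_mono fun x => ?_
        by_cases hx : x ∈ i.proj '' C
        · rw [Set.indicator_of_mem hx]
          refine (lintegral_mono (g := {h | i.even h * x.out ∈ C}.indicator
            fun _ => ‖f x.out‖ₑ) fun h => ?_).trans ((lintegral_indicator_const_le _ _).trans ?_)
          · simp only
            by_cases hh : i.even h * x.out ∈ C
            · rw [Set.indicator_of_mem hh, Set.indicator_of_mem (a := h) hh, ← ofReal_norm,
                f.equivariant.norm_mul, ofReal_norm]
            · rw [Set.indicator_of_notMem hh]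
              exact zero_le
          · rw [mul_comm]
            refine mul_le_mul' (i.measure_orbit_le m C _) ?_
            rcases le_total ‖f x.out‖ₑ 1 with h1 | h1
            · exact h1.trans le_self_add
            · calc ‖f x.out‖ₑ = ‖f x.out‖ₑ * 1 := (mul_one _).symm
                _ ≤ ‖f x.out‖ₑ * ‖f x.out‖ₑ := by gcongr
                _ = ‖f x.out‖ₑ ^ 2 := (sq _).symm
                _ ≤ _ := le_add_self
        · have h0 : ∀ h, C.indicator (fun g => ‖f g‖ₑ) (i.even h * x.out) = 0 := fun h =>
            Set.indicator_of_notMem (fun hh => hx ⟨_, hh, by rw [proj_mul, proj_out]⟩) _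
          simp [h0]
    _ < ⊤ := by
        rw [lintegral_const_mul' _ _ hfin.ne]
        refine ENNReal.mul_lt_top hfin ?_
        rw [lintegral_add_right _
          ((f.equivariant.measurable_enorm f.stronglyMeasurable).pow_const 2)]
        refine ENNReal.add_lt_top.2 ⟨?_, f.lintegral_lt_top⟩
        exact (lintegral_indicator_const_le _ _).trans_lt (by
          simpa using i.measure_compact_lt_top μ hC)

/-- A section orthogonal to all the averages is zero almost everywhere. -/
theorem Sect.toInd_eq_zero_of_inner_orbitAverage [CompleteSpace σ.V] [m.IsOpenPosMeasure]
    (hc : ∀ v, Continuous fun g => σ.π g v)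
    {U : Set σ.V} (hU : Dense U) (f : i.Sect μ σ)
    (hf : ∀ φ : G.G₀ → ℝ, ContMDiff 𝓘(ℝ, G.E) 𝓘(ℝ, ℝ) ∞ φ → HasCompactSupport φ → ∀ u ∈ U,
      ∀ s : i.Sect μ σ, s.toFun = i.orbitAverage m φ (fun h => σ.π h⁻¹ u) → inner ℂ f s = 0) :
    i.toInd μ σ f = 0 := by
  have hloc := f.locallyIntegrable m
  -- Moving σ(h⁻¹) to the other side and using equivariance, the pairing of f with an average
  -- unfolds to the integral of φ⟨f, u⟩ for the Weil measure. Density of U then kills the vector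
  -- integral of φf.
  have key : ∀ φ : G.G₀ → ℝ, ContMDiff 𝓘(ℝ, G.E) 𝓘(ℝ, ℝ) ∞ φ → HasCompactSupport φ →
      ∫ g, φ g • f g ∂(i.weil m μ) = 0 := by
    intro φ hφ hφc
    have hint : Integrable (fun g => φ g • f g) (i.weil m μ) :=
      hloc.integrable_smul_left_of_hasCompactSupport hφ.continuous hφc
    refine (Dense.eq_zero_of_inner_left ℂ hU fun u hu => ?_)
    have hcu : Continuous fun h : H.G₀ => σ.π h⁻¹ u := (hc u).comp continuous_inv
    let s : i.Sect μ σ := ofContinuous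
      (contMDiff_orbitAverage m hφ hφc hcu).continuous
      (isEquivariant_orbitAverage m φ u) hφc.isCompact (supportedMod_orbitAverage m)
    have h1 := hf φ hφ hφc u hu s rfl
    rw [inner_def] at h1
    have h2 : ∀ x : i.Cosets, inner ℂ (f x.out) (s x.out) =
        ∫ h, (fun g => φ g • inner ℂ (f g) u) (i.even h * x.out) ∂m := by
      intro x
      change inner ℂ (f x.out) (∫ h, φ (i.even h * x.out) • σ.π h⁻¹ u ∂m) = _
      rw [← integral_inner (integrable_orbit m hφ.continuous hφc hcu _)]
      refine integral_congr_ae (.of_forall fun h => ?_)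
      simp only
      rw [f.equivariant h, inner_π_left, RCLike.real_smul_eq_coe_smul (K := ℂ) _ (σ.π h⁻¹ u),
        inner_smul_real_right]
    simp only [h2] at h1
    have h3 : ∀ g, φ g • inner ℂ (f g) u = inner ℂ (φ g • f g) u := fun g => by
      rw [RCLike.real_smul_eq_coe_smul (K := ℂ) (φ g) (f g), inner_smul_real_left]
    have hint' : Integrable (fun g => φ g • inner ℂ (f g) u) (i.weil m μ) := by
      simp only [h3]
      exact hint.inner_const u
    rw [← i.integral_weil m μ (φ := fun g => φ g • inner ℂ (f g) u) (hφ.continuous.stronglyMeasurable.smul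
      (f.stronglyMeasurable.inner stronglyMeasurable_const)) hint'] at h1
    simp only [h3] at h1
    rw [← inner_conj_symm, ← integral_inner hint, ← integral_conj]
    simpa only [inner_conj_symm] using h1
  have hae : ∀ᵐ g ∂(i.weil m μ), f g = 0 :=
    ae_eq_zero_of_integral_contMDiff_smul_eq_zero 𝓘(ℝ, G.E) hloc key
  -- The Bruhat weight turns vanishing almost everywhere on G₀ into vanishing of the norm over the
  -- coset space.
  obtain ⟨β, hβ, hβ1⟩ := i.exists_bruhat m
  have h1 := i.lintegral_weil_bruhat m μ hβ hβ1 (φ := fun g => ‖f g‖ₑ ^ 2)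
    (f.stronglyMeasurable.enorm.pow_const 2) fun h g => by
      rw [← ofReal_norm, f.equivariant.norm_mul, ofReal_norm]
  rw [← enorm_sq, lintegral_eq_zero_of_ae_eq_zero] at h1
  · have h2 : ‖f‖ₑ = 0 := pow_eq_zero_iff (two_ne_zero) |>.1 h1.symm
    rw [← norm_eq_zero]
    change ‖f‖ = 0
    rw [← ofReal_norm, ENNReal.ofReal_eq_zero] at h2
    exact le_antisymm h2 (norm_nonneg _)
  · filter_upwards [hae] with g hg
    simp [hg]

/-- A subspace that contains the averages of a dense set of vectors is dense. -/
theorem dense_of_orbitAverage_mem [m.IsOpenPosMeasure] (hσ : σ.IsUnitary)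
    [CompleteSpace (i.IndSpace μ σ)] {U : Set σ.V} (hU : Dense U)
    (K : Submodule ℂ (i.IndSpace μ σ))
    (hK : ∀ φ : G.G₀ → ℝ, ContMDiff 𝓘(ℝ, G.E) 𝓘(ℝ, ℝ) ∞ φ → HasCompactSupport φ → ∀ u ∈ U,
      ∀ s : i.Sect μ σ, s.toFun = i.orbitAverage m φ (fun h => σ.π h⁻¹ u) → i.toInd μ σ s ∈ K) :
    Dense (K : Set (i.IndSpace μ σ)) := by
  have := hσ.complete
  rw [Submodule.dense_iff_topologicalClosure_eq_top, Submodule.topologicalClosure_eq_top_iff,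
    Submodule.eq_bot_iff]
  intro v hv
  obtain ⟨f, rfl⟩ := SeparationQuotient.surjective_mk v
  refine Sect.toInd_eq_zero_of_inner_orbitAverage m hσ.continuous_π hU f
    fun φ hφ hφc u hu s hs => ?_
  exact (Submodule.mem_orthogonal' _ _).1 hv _ (hK φ hφ hφc u hu s hs)

end Density

section Unitary

variable {σ : PreRep.{u, w} H} {μ : i.InvariantMeasure}

theorem dense_toInd_smoothCompact (hH : H.IsUnimodular) (hσ : σ.IsUnitary)
    [CompleteSpace (i.IndSpace μ σ)] :
    DenseRange ((i.toInd μ σ).toLinearMap.comp (Sect.smoothCompact μ σ).subtype) := by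
  have := hσ.complete
  have : (Measure.haar : Measure H.G₀).IsMulRightInvariant := hH _ inferInstance
  have h := dense_of_orbitAverage_mem (Measure.haar : Measure H.G₀) hσ dense_univ
    (LinearMap.range ((i.toInd μ σ).toLinearMap.comp (Sect.smoothCompact μ σ).subtype))
    (fun φ hφ hφc u _ s hs => ?_)
  · exact h
  · refine ⟨⟨s, ?_, tsupport φ, hφc.isCompact, ?_⟩, rfl⟩
    · rw [hs]
      exact contMDiff_orbitAverage _ hφ hφc ((hσ.continuous_π u).comp continuous_inv)
    · rw [hs]
      exact supportedMod_orbitAverage _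

theorem Sect.inner_oddSect_left (hσ : σ.IsUnitary) (X : G.𝔤₁) (b b' : Sect.smoothCompact μ σ) :
    inner ℂ (Sect.oddSect hσ X b : i.Sect μ σ) (b' : i.Sect μ σ) =
      inner ℂ (b : i.Sect μ σ) (Sect.oddSect hσ X b' : i.Sect μ σ) := by
  rw [Sect.inner_def, Sect.inner_def]
  refine integral_congr_ae (.of_forall fun x => ?_)
  simp only [Sect.oddSect_apply]
  exact inner_oddOp_left hσ _ ⟨_, _⟩ ⟨_, _⟩

/-- `Submodule.toLinearPMap` recovers the given subspace as its graph only if that subspace is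
single-valued. Symmetry extends to the closure, so a closure element (0, y) has y orthogonal to the
dense core. -/
theorem Sect.mem_graph_ind_ρ (hH : H.IsUnimodular) (hσ : σ.IsUnitary)
    [CompleteSpace (i.IndSpace μ σ)] (X : G.𝔤₁) (b : Sect.smoothCompact μ σ) :
    (i.toInd μ σ b, i.toInd μ σ (Sect.oddSect hσ X b : i.Sect μ σ)) ∈
      ((i.ind μ σ).ρ X).graph := by
  have hdense := dense_toInd_smoothCompact (i := i) (μ := μ) hH hσ
  have hadj : ∀ p ∈ (i.indGraph μ σ X).topologicalClosure, ∀ d : Sect.smoothCompact μ σ,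
      inner ℂ p.2 (i.toInd μ σ d) =
        inner ℂ p.1 (i.toInd μ σ (Sect.oddSect hσ X d : i.Sect μ σ)) := by
    intro p hp d
    have hclosed : IsClosed {p : i.IndSpace μ σ × i.IndSpace μ σ | inner ℂ p.2 (i.toInd μ σ d) =
        inner ℂ p.1 (i.toInd μ σ (Sect.oddSect hσ X d : i.Sect μ σ))} :=
      isClosed_eq (continuous_snd.inner continuous_const) (continuous_fst.inner continuous_const)
    refine closure_minimal (fun p hp => ?_) hclosed hp
    obtain ⟨b, rfl⟩ := (Sect.mem_indGraph_iff hσ X p).1 hp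
    exact Sect.inner_oddSect_left hσ X b d
  unfold ind
  rw [Submodule.toLinearPMap_graph_eq]
  · exact ⟨Submodule.le_topologicalClosure _ ((Sect.mem_indGraph_iff hσ X _).2 ⟨b, rfl⟩),
      Sect.toInd_mem_smoothVectors b, trivial⟩
  · rintro ⟨x, y⟩ ⟨h1, -⟩ hx
    refine hdense.eq_zero_of_inner_left ℂ fun d => ?_
    have h2 := hadj _ h1 d
    simp only at hx h2
    rw [hx, inner_zero_left] at h2
    exact h2

/-- Smooth sections with compact support modulo H₀ form the core in `isUnitary_of_core`: they are
dense, translation invariant, stable under homogeneous parts, and their odd operators are computed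
pointwise. -/
theorem ind_isUnitary (hH : H.IsUnimodular) (μ : i.InvariantMeasure) (hσ : σ.IsUnitary) :
    (i.ind μ σ).IsUnitary := by
  have := hσ.complete
  have : CompleteSpace (i.Sect μ σ) := Sect.completeSpace hH
  have hcI : CompleteSpace (i.IndSpace μ σ) := inferInstance
  have hcV : CompleteSpace (i.ind μ σ).V := hcI
  have hdense := dense_toInd_smoothCompact (i := i) (μ := μ) hH hσ
  refine PreRep.isUnitary_of_core (τ := i.ind μ σ) (fun k => indGr_orthogonal hσ k) ?_
    (fun g k v hv => indπ_even g k v hv)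
    ((i.toInd μ σ).toLinearMap.comp (Sect.smoothCompact μ σ).subtype)
    (fun b => Sect.toInd_mem_smoothVectors b) hdense (Sect.oddSect hσ) ?_ ?_ ?_ ?_
    (i.indGraph μ σ) (fun X p => Sect.mem_indGraph_iff hσ X p) (fun X => rfl)
  · refine PreRep.continuous_π_of_dense hdense ?_
    rintro _ ⟨b, rfl⟩
    exact (PreRep.mem_smoothVectors.1 (Sect.toInd_mem_smoothVectors b)).continuous
  · intro g b
    obtain ⟨b', hb'⟩ := Sect.exists_rightTranslate g b
    refine ⟨b', congrArg (i.toInd μ σ) hb', fun X => ?_⟩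
    refine congrArg (i.toInd μ σ) (a₂ := Sect.rightTranslate g (Sect.oddSect hσ X b : i.Sect μ σ)) ?_
    apply Subtype.ext
    funext x
    refine (Sect.oddSect_apply hσ _ b' x).trans ?_
    refine Eq.trans ?_ (Sect.oddSect_apply hσ X b (x * g)).symm
    simp only [hb', map_mul]
    rfl
  · intro k b
    obtain ⟨b', hb'⟩ := Sect.exists_grPart hσ k b
    refine ⟨b', ⟨b', fun g => ?_, rfl⟩, ⟨b - b', fun g => ?_, rfl⟩, fun X =>
      ⟨Sect.oddSect hσ X b', fun g => ?_, rfl⟩⟩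
    · rw [hb']
      exact grProj_mem hσ k _
    · rw [hb']
      exact sub_grProj_mem hσ k _
    · rw [Sect.oddSect_apply]
      refine oddOp_mem_gr hσ _ k _ ?_
      simp only [hb']
      exact grProj_mem hσ k _
  · exact fun X b b' => Sect.inner_oddSect_left hσ X b b'
  · intro X b
    -- The pointwise derivative has to be exhibited as a section. It is 2i times the square of the
    -- odd operator, 2i being the inverse of -(i/2).
    have h1 := Sect.dπ_toInd b (G.br X X)
      ((2 * Complex.I) • (Sect.oddSect hσ X (Sect.oddSect hσ X b) : i.Sect μ σ)) fun g => by
        change (2 * Complex.I) • (Sect.oddSect hσ X (Sect.oddSect hσ X b) : i.Sect μ σ) g = _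
        rw [Sect.oddSect_oddSect, smul_smul]
        have : 2 * Complex.I * -(Complex.I / 2) = 1 := by
          ring_nf
          simp
        rw [this, one_smul]
    change i.toInd μ σ (Sect.oddSect hσ X (Sect.oddSect hσ X b) : i.Sect μ σ) =
      -(Complex.I / 2) • (i.ind μ σ).dπ (G.br X X) (i.toInd μ σ b)
    rw [h1, map_smul]
    refine Eq.symm ((smul_smul (-(Complex.I / 2)) (2 * Complex.I) (i.toInd μ σ
      (Sect.oddSect hσ X (Sect.oddSect hσ X b) : i.Sect μ σ))).trans ?_)
    have : -(Complex.I / 2) * (2 * Complex.I) = 1 := by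
      ring_nf
      simp
    rw [this, one_smul]

end Unitary

end SpecialSub

end SuperLie

/-! ### Integration in stages and the staging map -/

namespace SuperLie

namespace SpecialSub

open PreRep

section Integral

variable {G K H : SuperLieGroup.{u}} {i : SpecialSub K G} {j : SpecialSub H K}

/-- Integration over `H₀ \ G₀` in stages. -/
theorem exists_lintegral_stages (hH : H.IsUnimodular) (μGH : (i.comp j).InvariantMeasure)
    (μGK : i.InvariantMeasure) (μKH : j.InvariantMeasure) :
    ∃ c : ℝ≥0∞, c ≠ 0 ∧ c ≠ ⊤ ∧ ∀ ψ : G.G₀ → ℝ≥0∞, Measurable ψ →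
      (∀ h g, ψ ((i.comp j).even h * g) = ψ g) →
      ∫⁻ x : i.Cosets, ∫⁻ y : j.Cosets, ψ (i.even y.out * x.out) ∂μKH.measure ∂μGK.measure =
        c * ∫⁻ x : (i.comp j).Cosets, ψ x.out ∂μGH.measure := by
  let m : Measure H.G₀ := Measure.haar
  have hm : m.IsMulRightInvariant := hH _ inferInstance
  have hm0 : m ≠ 0 := NeZero.ne m
  -- The Weil measure built directly from H₀ and the one built through K₀ are both nonzero and right
  -- invariant on G₀. Testing them on ψ times the Bruhat function of H₀ collapses the integral over
  -- H₀ to 1 on either side.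
  obtain ⟨c, hc0, hct, hc⟩ := exists_eq_smul_of_isMulRightInvariant ((i.comp j).weil m μGH)
    (i.weil (j.weil m μKH) μGK) ((i.comp j).weil_ne_zero m μGH hm0)
    (i.weil_ne_zero _ μGK (j.weil_ne_zero m μKH hm0))
  obtain ⟨β, hβ, hβ1⟩ := (i.comp j).exists_bruhat m
  refine ⟨c, hc0, hct, fun ψ hψ hinv => ?_⟩
  rw [← (i.comp j).lintegral_weil_bruhat m μGH hβ hβ1 hψ hinv, ← smul_eq_mul,
    ← lintegral_smul_measure, ← hc, i.lintegral_weil _ μGK (φ := fun g => ψ g * β g) (hψ.mul hβ)]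
  refine lintegral_congr fun x => ?_
  rw [j.lintegral_weil m μKH (φ := fun k => ψ (i.even k * x.out) * β (i.even k * x.out))
    ((hψ.mul hβ).comp (i.measurable_even.mul_const _))]
  refine lintegral_congr fun y => ?_
  have h1 : ∀ h, i.even (j.even h * y.out) * x.out =
      (i.comp j).even h * (i.even y.out * x.out) := fun h => by
    rw [map_mul, mul_assoc]
    rfl
  simp only [h1, hinv]
  rw [lintegral_const_mul (f := fun h => β ((i.comp j).even h * (i.even y.out * x.out))) _
    (hβ.comp ((i.comp j).measurable_even.mul_const _)), hβ1, mul_one]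

end Integral

section Slice

variable {G K H : SuperLieGroup.{u}} {i : SpecialSub K G} {j : SpecialSub H K}
  {μGH : (i.comp j).InvariantMeasure} {μGK : i.InvariantMeasure} {μKH : j.InvariantMeasure}
  {σ : PreRep.{u, w} H}

theorem Sect.smoothCompact_ext {i : SpecialSub H G} {μ : i.InvariantMeasure}
    {b b' : Sect.smoothCompact μ σ} (h : ∀ g, (b : i.Sect μ σ) g = (b' : i.Sect μ σ) g) : b = b' :=
  Subtype.ext (Subtype.ext (funext h))

/-- From kg = hc follows h⁻¹k = cg⁻¹ in CL⁻¹. Letting g range over a set L gives one compact subset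
of K₀ for all g in a neighbourhood. -/
theorem SupportedMod.slice {W : Type*} [Zero W] {f : G.G₀ → W} {C L : Set G.G₀}
    (hs : (i.comp j).SupportedMod C f) {g : G.G₀} (hg : g ∈ L) :
    j.SupportedMod (i.even ⁻¹' (C * L⁻¹)) (fun k => f (i.even k * g)) := by
  intro k hk
  obtain ⟨h, c, hc, e⟩ := hs _ hk
  refine ⟨h, (j.even h)⁻¹ * k, ⟨c, hc, g⁻¹, Set.inv_mem_inv.2 hg, ?_⟩, by simp⟩
  have h1 : (i.comp j).even h = i.even (j.even h) := rfl
  rw [h1] at e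
  simp only [map_mul, map_inv]
  rw [eq_comm, inv_mul_eq_iff_eq_mul, ← mul_assoc, ← e, mul_inv_cancel_right]

theorem IsEquivariant.slice {f : G.G₀ → σ.V} (he : (i.comp j).IsEquivariant σ f) (g : G.G₀) :
    j.IsEquivariant σ (fun k => f (i.even k * g)) := by
  intro h k
  simp only
  rw [map_mul, mul_assoc]
  exact he h _

theorem exists_slice (b : Sect.smoothCompact μGH σ) (g : G.G₀) : ∃ s : Sect.smoothCompact μKH σ,
    ∀ k, (s : j.Sect μKH σ) k = (b : (i.comp j).Sect μGH σ) (i.even k * g) := by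
  obtain ⟨C, hC, hs⟩ := Sect.exists_supportedMod b
  obtain ⟨s, hs⟩ := Sect.exists_smoothCompact (μ := μKH)
    ((Sect.smoothCompact_contMDiff b).comp (i.contMDiff_even.mul (contMDiff_const (c := g))))
    ((b : (i.comp j).Sect μGH σ).equivariant.slice g)
    (i.isCompact_preimage_even (hC.mul isCompact_singleton.inv)) (hs.slice rfl)
  exact ⟨s, fun k => congrFun hs k⟩

variable (μKH) in
/-- The restriction of a section to the coset `K₀ g`, as a section over `H₀ \ K₀`. -/
def slice (g : G.G₀) : Sect.smoothCompact μGH σ →ₗ[ℂ] Sect.smoothCompact μKH σ where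
  toFun b := (exists_slice b g).choose
  map_add' b b' := Sect.smoothCompact_ext fun k => by
    refine ((exists_slice (b + b') g).choose_spec k).trans ?_
    exact (congrArg₂ (· + ·) ((exists_slice b g).choose_spec k)
      ((exists_slice b' g).choose_spec k)).symm
  map_smul' c b := Sect.smoothCompact_ext fun k => by
    refine ((exists_slice (c • b) g).choose_spec k).trans ?_
    exact (congrArg (c • ·) ((exists_slice b g).choose_spec k)).symm

theorem slice_apply (b : Sect.smoothCompact μGH σ) (g : G.G₀) (k : K.G₀) :
    (slice μKH g b : j.Sect μKH σ) k = (b : (i.comp j).Sect μGH σ) (i.even k * g) :=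
  (exists_slice b g).choose_spec k

/-- Smoothness in g of the Hilbert space valued map comes from the smooth function f(kg) through
`Sect.contMDiffAt_toInd`. Equivariance under K₀ is associativity, and the support remains in K₀C. -/
theorem exists_stage [CompleteSpace (j.IndSpace μKH σ)] (b : Sect.smoothCompact μGH σ) :
    ∃ s : Sect.smoothCompact μGK (j.ind μKH σ), ∀ g,
      (s : i.Sect μGK (j.ind μKH σ)) g = j.toInd μKH σ (slice μKH g b : j.Sect μKH σ) := by
  obtain ⟨C, hC, hs⟩ := Sect.exists_supportedMod b
  have hsmooth : ContMDiff 𝓘(ℝ, G.E) 𝓘(ℝ, j.IndSpace μKH σ) ∞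
      (fun g => j.toInd μKH σ (slice μKH g b : j.Sect μKH σ)) := by
    intro g₀
    obtain ⟨L, hL, hx⟩ := exists_compact_mem_nhds g₀
    refine (Sect.contMDiffAt_toInd
      (F := fun g k => (b : (i.comp j).Sect μGH σ) (i.even k * g)) ?_ _
      (fun g k => slice_apply b g k) (i.isCompact_preimage_even (hC.mul hL.inv))
      (Filter.mem_of_superset hx fun g hg => hs.slice hg)).1
    exact (Sect.smoothCompact_contMDiff b).comp
      ((i.contMDiff_even.comp contMDiff_snd).mul contMDiff_fst)
  have hequiv : i.IsEquivariant (j.ind μKH σ)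
      (fun g => j.toInd μKH σ (slice μKH g b : j.Sect μKH σ)) := by
    intro k₀ g
    refine congrArg (j.toInd μKH σ) (a₂ := Sect.rightTranslate k₀ (slice μKH g b : j.Sect μKH σ)) ?_
    apply Subtype.ext
    funext k
    refine (slice_apply b _ k).trans (Eq.trans ?_ (slice_apply b g (k * k₀)).symm)
    rw [map_mul, mul_assoc]
  have hsupp : i.SupportedMod C (fun g => j.toInd μKH σ (slice μKH g b : j.Sect μKH σ)) := by
    intro g hg
    by_contra hne
    refine hg ?_
    have h0 : slice μKH g b = 0 := Sect.smoothCompact_ext fun k => by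
      rw [slice_apply]
      by_contra h1
      obtain ⟨h, c, hc, e⟩ := hs _ h1
      refine hne ⟨k⁻¹ * j.even h, c, hc, ?_⟩
      rw [map_mul, map_inv, mul_assoc, eq_inv_mul_iff_mul_eq]
      exact e
    simp only [h0, Submodule.coe_zero, map_zero]
  obtain ⟨s, hs⟩ := Sect.exists_smoothCompact (μ := μGK) (σ := j.ind μKH σ) hsmooth hequiv hC hsupp
  exact ⟨s, fun g => congrFun hs g⟩

variable (μGK μKH) in
/-- A section over `H₀ \ G₀`, as a section over `K₀ \ G₀` with values in sections
over `H₀ \ K₀`. -/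
def stage [CompleteSpace (j.IndSpace μKH σ)] :
    Sect.smoothCompact μGH σ →ₗ[ℂ] Sect.smoothCompact μGK (j.ind μKH σ) where
  toFun b := (exists_stage b).choose
  map_add' b b' := Sect.smoothCompact_ext fun g => by
    refine ((exists_stage (b + b')).choose_spec g).trans ?_
    refine Eq.trans ?_ (congrArg₂ (· + ·) ((exists_stage b).choose_spec g)
      ((exists_stage b').choose_spec g)).symm
    rw [map_add, Submodule.coe_add, map_add]
    rfl
  map_smul' c b := Sect.smoothCompact_ext fun g => by
    refine ((exists_stage (c • b)).choose_spec g).trans ?_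
    refine Eq.trans ?_ (congrArg (c • ·) ((exists_stage b).choose_spec g)).symm
    rw [map_smul, Submodule.coe_smul, map_smul]
    rfl

variable [CompleteSpace (j.IndSpace μKH σ)]

theorem stage_apply (b : Sect.smoothCompact μGH σ) (g : G.G₀) :
    (stage μGK μKH b : i.Sect μGK (j.ind μKH σ)) g =
      j.toInd μKH σ (slice μKH g b : j.Sect μKH σ) :=
  (exists_stage b).choose_spec g

/-- Integration in stages is applied to ‖b‖². The factor is the square root of the measure constant
and does not depend on b. -/
theorem exists_norm_stage (hH : H.IsUnimodular) : ∃ c : ℝ, 0 < c ∧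
    ∀ b : Sect.smoothCompact μGH σ, ‖(stage μGK μKH b : i.Sect μGK (j.ind μKH σ))‖ =
      c * ‖(b : (i.comp j).Sect μGH σ)‖ := by
  obtain ⟨c, hc0, hct, hc⟩ := exists_lintegral_stages hH μGH μGK μKH
  refine ⟨√c.toReal, Real.sqrt_pos.2 (ENNReal.toReal_pos hc0 hct), fun b => ?_⟩
  have h1 := hc (fun g => ‖(b : (i.comp j).Sect μGH σ) g‖ₑ ^ 2)
    ((b : (i.comp j).Sect μGH σ).stronglyMeasurable.enorm.pow_const 2) fun h g => by
      rw [← ofReal_norm, (b : (i.comp j).Sect μGH σ).equivariant.norm_mul, ofReal_norm]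
  rw [← Sect.enorm_sq] at h1
  have h2 : ∀ x : i.Cosets, ∫⁻ y : j.Cosets,
      ‖(b : (i.comp j).Sect μGH σ) (i.even y.out * x.out)‖ₑ ^ 2 ∂μKH.measure =
      ‖(stage μGK μKH b : i.Sect μGK (j.ind μKH σ)) x.out‖ₑ ^ 2 := by
    intro x
    rw [stage_apply]
    refine Eq.trans ?_ (Sect.enorm_sq (slice μKH x.out b : j.Sect μKH σ)).symm
    simp only [slice_apply]
  simp only [h2] at h1
  rw [← Sect.enorm_sq, ← ofReal_norm, ← ofReal_norm, ← ENNReal.ofReal_pow (norm_nonneg _),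
    ← ENNReal.ofReal_pow (norm_nonneg _), ← ENNReal.ofReal_toReal hct,
    ← ENNReal.ofReal_mul ENNReal.toReal_nonneg,
    ENNReal.ofReal_eq_ofReal_iff (by positivity) (by positivity)] at h1
  rw [← Real.sqrt_sq (norm_nonneg (stage μGK μKH b : i.Sect μGK (j.ind μKH σ))), h1,
    Real.sqrt_mul ENNReal.toReal_nonneg, Real.sqrt_sq (norm_nonneg _)]

end Slice

end SpecialSub

end SuperLie

/-! ### Integrals of translates, and density of the staging map -/

namespace SuperLie

namespace SpecialSub

open PreRep

section Convolution

variable {G H : SuperLieGroup.{u}} {i : SpecialSub H G} {μ : i.InvariantMeasure}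
  {σ : PreRep.{u, w} H}

theorem Sect.inner_eq_integral {ν : Measure G.G₀} (hν : ν.map i.proj = μ.measure)
    (f f' : i.Sect μ σ) : inner ℂ f f' = ∫ g, inner ℂ (f g) (f' g) ∂ν := by
  rw [inner_def, ← hν, integral_map i.measurable_proj.aemeasurable
    (measurable_inner f f').aestronglyMeasurable]
  exact integral_congr_ae (.of_forall fun g => f.equivariant.inner_out f'.equivariant g)

theorem Sect.integrable_inner_lift {ν : Measure G.G₀} (hν : ν.map i.proj = μ.measure)
    (f f' : i.Sect μ σ) : Integrable (fun g => inner ℂ (f g) (f' g)) ν := by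
  have h := integrable_inner f f'
  rw [← hν] at h
  refine (h.comp_measurable i.measurable_proj).congr (.of_forall fun g => ?_)
  exact f.equivariant.inner_out f'.equivariant g

/-- The bound sees f' only through its norm, which translation preserves. It is thus uniform over
translates, as Fubini requires in `Sect.toInd_integral_translate`. -/
theorem Sect.integral_norm_inner_le {ν : Measure G.G₀} (hν : ν.map i.proj = μ.measure)
    (f f' : i.Sect μ σ) : ∫ g, ‖inner ℂ (f g) (f' g)‖ ∂ν ≤ ‖f‖ ^ 2 + ‖f'‖ ^ 2 := by
  have hsq : ∀ f : i.Sect μ σ, Integrable (fun g => ‖f g‖ ^ 2) ν ∧ ∫ g, ‖f g‖ ^ 2 ∂ν = ‖f‖ ^ 2 := by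
    intro f
    have h1 : ∀ g, RCLike.re (inner ℂ (f g) (f g)) = ‖f g‖ ^ 2 := fun g =>
      inner_self_eq_norm_sq (𝕜 := ℂ) (f g)
    have h2 := integrable_inner_lift hν f f
    refine ⟨h2.re.congr (.of_forall h1), ?_⟩
    rw [← @inner_self_eq_norm_sq ℂ, inner_eq_integral hν]
    refine Eq.trans ?_ (integral_re h2)
    exact integral_congr_ae (.of_forall fun g => (h1 g).symm)
  rw [← (hsq f).2, ← (hsq f').2, ← integral_add (hsq f).1 (hsq f').1]
  refine integral_mono (integrable_inner_lift hν f f').norm ((hsq f).1.add (hsq f').1) fun g => ?_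
  refine (norm_inner_le_norm _ _).trans ?_
  change _ ≤ ‖f g‖ ^ 2 + ‖f' g‖ ^ 2
  nlinarith [sq_nonneg (‖f g‖ - ‖f' g‖), sq_nonneg ‖f g‖, sq_nonneg ‖f' g‖]

/-- A weighted integral of translates of a section, computed pointwise. -/
theorem Sect.toInd_integral_translate (hH : H.IsUnimodular) (hσ : σ.IsUnitary)
    [CompleteSpace (i.IndSpace μ σ)]
    (m : Measure G.G₀) [IsFiniteMeasureOnCompacts m] {a : G.G₀ → ℝ} (ha : Continuous a)
    (hac : HasCompactSupport a) (b : smoothCompact μ σ) (s : i.Sect μ σ)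
    (hs : ∀ x, s x = ∫ g, a g • (b : i.Sect μ σ) (x * g⁻¹) ∂m) :
    i.toInd μ σ s = ∫ g, a g • i.indπ μ σ g⁻¹ (i.toInd μ σ b) ∂m := by
  have := hσ.complete
  obtain ⟨ν, hνσ, hν⟩ := exists_map_proj_eq hH μ
  have hbc : Continuous (b : i.Sect μ σ) := (smoothCompact_contMDiff b).continuous
  have hπc : Continuous fun g : G.G₀ => i.indπ μ σ g⁻¹ (i.toInd μ σ b) :=
    ((PreRep.mem_smoothVectors.1 (toInd_mem_smoothVectors b)).continuous).comp continuous_inv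
  have hint1 : Integrable (fun g => a g • i.indπ μ σ g⁻¹ (i.toInd μ σ b)) m :=
    (ha.smul hπc).integrable_of_hasCompactSupport hac.smul_right
  -- The identity is checked weakly: after pairing with a section t, both sides are iterated
  -- integrals of the same scalar function in opposite orders, once μ is lifted to a measure ν on
  -- G₀.
  refine ext_inner_left ℂ fun v => ?_
  obtain ⟨t, rfl⟩ := SeparationQuotient.surjective_mk v
  change inner ℂ (i.toInd μ σ t) _ = inner ℂ (i.toInd μ σ t) _
  rw [← integral_inner hint1]
  have h1 : ∀ g, inner ℂ (i.toInd μ σ t) (a g • i.indπ μ σ g⁻¹ (i.toInd μ σ b)) =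
      ∫ x, a g • inner ℂ (t x) ((b : i.Sect μ σ) (x * g⁻¹)) ∂ν := by
    intro g
    rw [RCLike.real_smul_eq_coe_smul (K := ℂ) (a g) (i.indπ μ σ g⁻¹ (i.toInd μ σ b)),
      inner_smul_real_right, integral_smul]
    congr 1
    exact inner_eq_integral hν t (rightTranslate g⁻¹ b)
  have h2 : ∀ x, inner ℂ (t x) (s x) =
      ∫ g, a g • inner ℂ (t x) ((b : i.Sect μ σ) (x * g⁻¹)) ∂m := by
    intro x
    have hint2 : Integrable (fun g => a g • (b : i.Sect μ σ) (x * g⁻¹)) m :=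
      (ha.smul (hbc.comp (continuous_const.mul continuous_inv))).integrable_of_hasCompactSupport
        hac.smul_right
    rw [hs, ← integral_inner hint2]
    refine integral_congr_ae (.of_forall fun g => ?_)
    simp only
    rw [RCLike.real_smul_eq_coe_smul (K := ℂ) (a g) ((b : i.Sect μ σ) (x * g⁻¹)),
      inner_smul_real_right]
  rw [inner_toInd, inner_eq_integral hν]
  simp only [h1, h2]
  refine integral_integral_swap
    (f := fun x g => a g • inner ℂ (t x) ((b : i.Sect μ σ) (x * g⁻¹))) ?_
  have hmeas : StronglyMeasurable (fun p : G.G₀ × G.G₀ =>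
      a p.2 • inner ℂ (t p.1) ((b : i.Sect μ σ) (p.1 * p.2⁻¹))) :=
    (ha.comp continuous_snd).stronglyMeasurable.smul
      ((t.stronglyMeasurable.comp_measurable measurable_fst).inner
        (hbc.comp (continuous_fst.mul continuous_snd.inv)).stronglyMeasurable)
  refine (integrable_prod_iff' hmeas.aestronglyMeasurable).2 ⟨.of_forall fun g => ?_, ?_⟩
  · exact (integrable_inner_lift hν t (rightTranslate g⁻¹ b)).smul (a g)
  · refine Integrable.mono' (g := fun g => |a g| * (‖t‖ ^ 2 + ‖(b : i.Sect μ σ)‖ ^ 2)) ?_ ?_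
      (.of_forall fun g => ?_)
    · exact ((ha.abs).integrable_of_hasCompactSupport
        (hac.comp_left (g := abs) abs_zero)).mul_const _
    · exact hmeas.norm.integral_prod_left'.aestronglyMeasurable
    · rw [Real.norm_of_nonneg (integral_nonneg fun x => norm_nonneg _)]
      simp only [norm_smul, Real.norm_eq_abs]
      rw [integral_const_mul]
      refine mul_le_mul_of_nonneg_left ?_ (abs_nonneg _)
      refine (integral_norm_inner_le hν t (rightTranslate g⁻¹ b)).trans (le_of_eq ?_)
      rw [norm_rightTranslate]

theorem orbitAverage_mul {W : Type*} [NormedAddCommGroup W] [NormedSpace ℝ W] (m : Measure H.G₀)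
    [m.IsMulRightInvariant] (φ : G.G₀ → ℝ) (v : H.G₀ → W) (h₀ : H.G₀) (g : G.G₀) :
    i.orbitAverage m φ v (i.even h₀ * g) = ∫ h, φ (i.even h * g) • v (h * h₀⁻¹) ∂m := by
  rw [← integral_mul_right_eq_self (μ := m) (fun h => φ (i.even h * g) • v (h * h₀⁻¹)) h₀]
  simp only [map_mul, mul_assoc, mul_inv_cancel, mul_one]
  rfl

end Convolution

section Stages

variable {G K H : SuperLieGroup.{u}} {i : SpecialSub K G} {j : SpecialSub H K}
  {μGH : (i.comp j).InvariantMeasure} {μGK : i.InvariantMeasure} {μKH : j.InvariantMeasure}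
  {σ : PreRep.{u, w} H}

/-- With b taken at k⁻¹, the substitution k ↦ kh⁻¹ makes left equivariance of b into equivariance of
the average. A nonzero contribution has k⁻¹ = hc with c in C, hence g = h·c·(kg) lies in H₀ times C
times the support of φ. -/
theorem exists_smoothCompact_orbitAverage (hσ : σ.IsUnitary) (m : Measure K.G₀)
    [m.IsMulRightInvariant] [IsFiniteMeasureOnCompacts m] {φ : G.G₀ → ℝ}
    (hφ : ContMDiff 𝓘(ℝ, G.E) 𝓘(ℝ, ℝ) ∞ φ) (hφc : HasCompactSupport φ)
    (b : Sect.smoothCompact μKH σ) : ∃ b' : Sect.smoothCompact μGH σ,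
      (b' : (i.comp j).Sect μGH σ).toFun =
        i.orbitAverage m φ (fun k => (b : j.Sect μKH σ) k⁻¹) := by
  have := hσ.complete
  have hbc : Continuous (b : j.Sect μKH σ) := (Sect.smoothCompact_contMDiff b).continuous
  obtain ⟨C, hC, hs⟩ := Sect.exists_supportedMod b
  refine Sect.exists_smoothCompact (contMDiff_orbitAverage m hφ hφc (hbc.comp continuous_inv)) ?_
    ((hC.image i.continuous_even).mul hφc.isCompact) ?_
  · intro h g
    change i.orbitAverage m φ _ (i.even (j.even h) * g) = _
    rw [orbitAverage_mul]
    have h3 := ((σ.π h).toContinuousLinearEquiv.restrictScalars ℝ).integral_comp_comm (μ := m)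
      (fun k => φ (i.even k * g) • (b : j.Sect μKH σ) k⁻¹)
    refine Eq.trans ?_ h3
    refine integral_congr_ae (.of_forall fun k => ?_)
    simp only [map_smul, mul_inv_rev, inv_inv, (b : j.Sect μKH σ).equivariant h]
    rfl
  · intro g hg
    by_contra hne
    refine hg ?_
    unfold orbitAverage
    refine integral_eq_zero_of_ae (.of_forall fun k => ?_)
    change φ (i.even k * g) • (b : j.Sect μKH σ) k⁻¹ = 0
    by_contra h1
    obtain ⟨h2, h3⟩ := smul_ne_zero_iff.1 h1
    obtain ⟨h, c, hc, e⟩ := hs _ h3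
    refine hne ⟨h, i.even c * (i.even k * g), Set.mul_mem_mul ⟨c, hc, rfl⟩
      (subset_tsupport _ h2), ?_⟩
    change g = i.even (j.even h) * _
    rw [← mul_assoc, ← map_mul, ← e, ← mul_assoc, ← map_mul, inv_mul_cancel, map_one, one_mul]

variable [CompleteSpace (j.IndSpace μKH σ)]

/-- It suffices to reach the K₀-averages of a dense set of vectors, here classes of smooth compactly
supported b. Put F(g) = ∫ φ(kg) b(k⁻¹) dk; then F(k'g) = ∫ φ(kg) b(k'k⁻¹) dk, so the slice of F at g
is the average of the translates of b. -/
theorem denseRange_stage (hK : K.IsUnimodular) (hH : H.IsUnimodular) (hσ : σ.IsUnitary)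
    [CompleteSpace (i.IndSpace μGK (j.ind μKH σ))] :
    DenseRange ((i.toInd μGK (j.ind μKH σ)).toLinearMap.comp
      ((Sect.smoothCompact μGK (j.ind μKH σ)).subtype.comp (stage (μGH := μGH) μGK μKH))) := by
  have hτ := ind_isUnitary hH μKH hσ
  have : (Measure.haar : Measure K.G₀).IsMulRightInvariant := hK _ inferInstance
  have hU : Dense (Set.range fun b : Sect.smoothCompact μKH σ =>
      (j.toInd μKH σ (b : j.Sect μKH σ) : (j.ind μKH σ).V)) := dense_toInd_smoothCompact hH hσ
  refine dense_of_orbitAverage_mem (Measure.haar : Measure K.G₀) hτ hU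
    (LinearMap.range ((i.toInd μGK (j.ind μKH σ)).toLinearMap.comp
      ((Sect.smoothCompact μGK (j.ind μKH σ)).subtype.comp (stage (μGH := μGH) μGK μKH)))) ?_
  rintro φ hφ hφc _ ⟨b, rfl⟩ s hs
  obtain ⟨b', hb'⟩ := exists_smoothCompact_orbitAverage (i := i) (μGH := μGH) hσ
    (Measure.haar : Measure K.G₀) hφ hφc b
  refine ⟨b', congrArg (i.toInd μGK (j.ind μKH σ)) ?_⟩
  apply Subtype.ext
  funext g
  refine (stage_apply b' g).trans (Eq.trans ?_ (congrFun hs g).symm)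
  refine Sect.toInd_integral_translate hH hσ Measure.haar (a := fun k => φ (i.even k * g))
    (hφ.continuous.comp (i.continuous_even.mul continuous_const))
    (hφc.comp_isClosedEmbedding ((Homeomorph.mulRight g).isClosedEmbedding.comp
      i.isClosedEmbedding_even)) b _ fun k' => ?_
  rw [slice_apply, hb', orbitAverage_mul]
  simp only [mul_inv_rev, inv_inv]

/-- At g, the inner odd operator for g·X acts on a slice, and on the core of the inner induced
representation it is computed pointwise. At k it uses k·(g·X) = (kg)·X, the vector used by the
one-step operator at kg. -/
theorem oddSect_stage (hσ : σ.IsUnitary) (hτ : (j.ind μKH σ).IsUnitary) (hH : H.IsUnimodular)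
    (X : G.𝔤₁) (b : Sect.smoothCompact μGH σ) :
    Sect.oddSect hτ X (stage μGK μKH b) = stage μGK μKH (Sect.oddSect hσ X b) := by
  refine Sect.smoothCompact_ext fun g => ?_
  rw [Sect.oddSect_apply]
  refine Eq.trans ?_ (stage_apply _ g).symm
  have h1 := Sect.mem_graph_ind_ρ hH hσ (i.oddEquiv.symm (G.act g X)) (slice μKH g b)
  obtain ⟨h2, h3⟩ := (mem_graph_iff_oddOp hτ _ _ _).1 h1
  have h4 : Sect.oddSect hσ (i.oddEquiv.symm (G.act g X)) (slice μKH g b) =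
      slice μKH g (Sect.oddSect hσ X b) := by
    refine Sect.smoothCompact_ext fun k => ?_
    rw [Sect.oddSect_apply]
    refine Eq.trans ?_ ((slice_apply _ g k).trans (Sect.oddSect_apply hσ X b _)).symm
    have h5 : j.oddEquiv.symm (K.act k (i.oddEquiv.symm (G.act g X))) =
        (i.comp j).oddEquiv.symm (G.act (i.even k * g) X) := by
      rw [← oddEquiv_symm_act, map_mul, LinearEquiv.symm_apply_eq, LinearEquiv.symm_apply_eq]
      exact ((i.comp j).oddEquiv.apply_symm_apply _).symm
    rw [h5]
    congr 2
    exact Subtype.ext (slice_apply b g k)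
  rw [← h4]
  refine Eq.trans ?_ h3
  congr 2
  exact Subtype.ext (stage_apply b g)

theorem stage_mem_gr {k : ZMod 2} {b : Sect.smoothCompact μGH σ}
    (hb : ∀ g, (b : (i.comp j).Sect μGH σ) g ∈ σ.gr k) :
    i.toInd μGK (j.ind μKH σ) (stage μGK μKH b : i.Sect μGK (j.ind μKH σ)) ∈
      i.indGr μGK (j.ind μKH σ) k := by
  refine ⟨stage μGK μKH b, fun g => ?_, rfl⟩
  rw [stage_apply]
  exact ⟨slice μKH g b, fun k' => by rw [slice_apply]; exact hb _, rfl⟩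

theorem stage_rightTranslate {x : G.G₀} {b b' : Sect.smoothCompact μGH σ}
    (hb : (b' : (i.comp j).Sect μGH σ) = Sect.rightTranslate x b) :
    (stage μGK μKH b' : i.Sect μGK (j.ind μKH σ)) = Sect.rightTranslate x (stage μGK μKH b) := by
  apply Subtype.ext
  funext g
  refine (stage_apply b' g).trans (Eq.trans ?_ (stage_apply b (g * x)).symm)
  congr 2
  refine Sect.smoothCompact_ext fun k => ?_
  rw [slice_apply, slice_apply, hb, Sect.rightTranslate_apply, mul_assoc]

end Stages

/-! ### The equivalence -/

/-- Induction in stages. -/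
theorem ind_comp_unitarilyEquivalent {G K H : SuperLieGroup.{u}} (i : SpecialSub K G)
    (j : SpecialSub H K) (hK : K.IsUnimodular) (hH : H.IsUnimodular)
    (μGH : (i.comp j).InvariantMeasure) (μGK : i.InvariantMeasure) (μKH : j.InvariantMeasure)
    {σ : PreRep.{u, w} H} (hσ : σ.IsUnitary) :
    ((i.comp j).ind μGH σ).UnitarilyEquivalent (i.ind μGK (j.ind μKH σ)) := by
  have hτ := ind_isUnitary hH μKH hσ
  have h₁ := ind_isUnitary hH μGH hσ
  have h₂ := ind_isUnitary hK μGK hτ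
  have hc : CompleteSpace (j.IndSpace μKH σ) := hτ.complete
  have hc₁ : CompleteSpace ((i.comp j).IndSpace μGH σ) := h₁.complete
  have hc₂ : CompleteSpace (i.IndSpace μGK (j.ind μKH σ)) := h₂.complete
  obtain ⟨c, hc0, hnorm⟩ := exists_norm_stage (i := i) (μGH := μGH) (μGK := μGK) (μKH := μKH)
    (σ := σ) hH
  let e₁ : Sect.smoothCompact μGH σ →ₗ[ℂ] (i.comp j).IndSpace μGH σ :=
    ((i.comp j).toInd μGH σ).toLinearMap.comp (Sect.smoothCompact μGH σ).subtype
  let e : Sect.smoothCompact μGH σ →ₗ[ℂ] i.IndSpace μGK (j.ind μKH σ) :=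
    (i.toInd μGK (j.ind μKH σ)).toLinearMap.comp
      ((Sect.smoothCompact μGK (j.ind μKH σ)).subtype.comp (stage μGK μKH))
  -- Division by c makes the staging map isometric; with dense domain and dense range it extends to
  -- a unitary map.
  let e₂ : Sect.smoothCompact μGH σ →ₗ[ℂ] i.IndSpace μGK (j.ind μKH σ) := ((c⁻¹ : ℝ) : ℂ) • e
  have hd₁ : DenseRange e₁ := dense_toInd_smoothCompact hH hσ
  have hd : DenseRange e := denseRange_stage hK hH hσ
  have hd₂ : DenseRange e₂ := by
    have hcc : ((c⁻¹ : ℝ) : ℂ) ≠ 0 := by exact_mod_cast (inv_pos.2 hc0).ne'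
    exact ((Homeomorph.smulOfNeZero _ hcc).surjective.denseRange).comp hd
      (continuous_const_smul ((c⁻¹ : ℝ) : ℂ))
  have hn : ∀ b, ‖e₂ (LinearEquiv.refl ℂ _ b)‖ = ‖e₁ b‖ := by
    intro b
    change ‖((c⁻¹ : ℝ) : ℂ) • e b‖ = _
    rw [norm_smul]
    have h3 : ‖e b‖ = c * ‖e₁ b‖ := hnorm b
    rw [h3, Complex.norm_real, Real.norm_of_nonneg (inv_pos.2 hc0).le,
      inv_mul_cancel_left₀ hc0.ne']
  let T := (LinearEquiv.refl ℂ (Sect.smoothCompact μGH σ)).extendOfIsometry e₁ e₂ hd₁ hd₂ hn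
  have hT : ∀ b, T (e₁ b) = ((c⁻¹ : ℝ) : ℂ) • e b := fun b =>
    LinearEquiv.extendOfIsometry_eq _ e₁ e₂ hd₁ hd₂ hn b
  refine PreRep.unitarilyEquivalent_of_dense h₁ h₂ T ?_ ?_ hd₁ ?_
  · intro k v hv
    -- Evenness is tested on the projections to degree k of arbitrary vectors: these projections
    -- preserve the core, and the condition is closed.
    have hclosed : IsClosed {v : (i.comp j).IndSpace μGH σ |
        T (grProj h₁ k v) ∈ i.indGr μGK (j.ind μKH σ) k} := by
      have h3 : IsClosed (i.indGr μGK (j.ind μKH σ) k : Set (i.IndSpace μGK (j.ind μKH σ))) := by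
        have h4 := indGr_orthogonal (i := i) (μ := μGK) hτ (k + 1)
        rw [add_assoc, CharTwo.add_self_eq_zero, add_zero] at h4
        rw [← h4]
        exact Submodule.isClosed_orthogonal _
      exact h3.preimage (T.continuous.comp (grProj h₁ k).continuous)
    have h5 : ∀ v : (i.comp j).IndSpace μGH σ, T (grProj h₁ k v) ∈ i.indGr μGK (j.ind μKH σ) k := by
      intro v
      refine hd₁.induction_on (p := fun v => T (grProj h₁ k v) ∈ i.indGr μGK (j.ind μKH σ) k) v
        hclosed fun b => ?_
      obtain ⟨b', hb'⟩ := Sect.exists_grPart hσ k b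
      have h6 : grProj h₁ k (e₁ b) = e₁ b' := by
        refine grProj_eq h₁ ⟨b', fun g => ?_, rfl⟩ ⟨b - b', fun g => ?_, rfl⟩
        · rw [hb']
          exact grProj_mem hσ k _
        · rw [hb']
          exact sub_grProj_mem hσ k _
      rw [h6, hT]
      refine Submodule.smul_mem _ _ (stage_mem_gr fun g => ?_)
      rw [hb']
      exact grProj_mem hσ k _
    have h7 : grProj h₁ k v = v := grProj_eq h₁ hv (by rw [sub_self]; exact Submodule.zero_mem _)
    rw [← h7]
    exact h5 v
  · intro g v
    refine hd₁.induction_on (p := fun v => T (((i.comp j).ind μGH σ).π g v) =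
      (i.ind μGK (j.ind μKH σ)).π g (T v)) v
      (isClosed_eq (T.continuous.comp (((i.comp j).ind μGH σ).π g).continuous)
        (((i.ind μGK (j.ind μKH σ)).π g).continuous.comp T.continuous)) fun b => ?_
    obtain ⟨b', hb'⟩ := Sect.exists_rightTranslate g b
    have h3 : ((i.comp j).ind μGH σ).π g (e₁ b) = e₁ b' :=
      congrArg ((i.comp j).toInd μGH σ) hb'.symm
    have h4 : (i.ind μGK (j.ind μKH σ)).π g (e b) = e b' :=
      congrArg (i.toInd μGK (j.ind μKH σ)) (stage_rightTranslate hb').symm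
    rw [h3, hT, hT, ← h4]
    exact (map_smul ((i.ind μGK (j.ind μKH σ)).π g) _ _).symm
  · rintro X _ ⟨b, rfl⟩
    refine ⟨_, Sect.mem_graph_ind_ρ hH hσ X b, ?_⟩
    have h3 := Sect.mem_graph_ind_ρ hK hτ X (stage (μGH := μGH) μGK μKH b)
    rw [oddSect_stage hσ hτ hH] at h3
    -- The graph is a complex subspace, so the normalizing factor passes through it.
    have h4 := Submodule.smul_mem _ ((c⁻¹ : ℝ) : ℂ) h3
    have h5 : T (e₁ (Sect.oddSect hσ X b)) = ((c⁻¹ : ℝ) : ℂ) • e (Sect.oddSect hσ X b) := hT _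
    refine Eq.mp ?_ h4
    congr 1
    exact Prod.ext (hT b).symm h5.symm

end SpecialSub

end SuperLie

end

theorem mainTheorem11 {G K H : SuperLie.SuperLieGroup.{u}}
    (i : SuperLie.SpecialSub K G) (j : SuperLie.SpecialSub H K)
    (hG : G.IsUnimodular) (hK : K.IsUnimodular) (hH : H.IsUnimodular)
    (μGH : (i.comp j).InvariantMeasure) (μGK : i.InvariantMeasure) (μKH : j.InvariantMeasure)
    (σ : SuperLie.PreRep.{u, w} H) (hσ : σ.IsUnitary) :
    ((i.comp j).ind μGH σ).IsUnitary ∧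
    (j.ind μKH σ).IsUnitary ∧
    (i.ind μGK (j.ind μKH σ)).IsUnitary ∧
    ((i.comp j).ind μGH σ).UnitarilyEquivalent (i.ind μGK (j.ind μKH σ)) := by
  have hτ := SuperLie.SpecialSub.ind_isUnitary hH μKH hσ
  exact ⟨SuperLie.SpecialSub.ind_isUnitary hH μGH hσ, hτ,
    SuperLie.SpecialSub.ind_isUnitary hK μGK hτ,
    SuperLie.SpecialSub.ind_comp_unitarilyEquivalent i j hK hH μGH μGK μKH hσ⟩
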